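/- **Model.** Let $d\in\mathbb N$, $[d]=\{1,\dots,d\}$, $\mathcal S_1\subseteq[d]$, let $\mathcal S_2$ be a set of pairs $\mathbf j=(j_1,j_2)$ with $1\le j_1<j_2\le d$, and let $\mathcal S_2^{\mathrm{var}}\subseteq[d]$ be the set of coordinates occurring in $\mathcal S_2$, with $\mathcal S_1\cap\mathcal S_2^{\mathrm{var}}=\emptyset$. On $[-1,1]^d$, $$f(x)=f(0)+\sum_{p\in\mathcal S_1}\phi_p(x_p)+\sum_{\mathbf j\in\mathcal S_2}\phi_{\mathbf j}(x_{j_1},x_{j_2})+\sum_{l\in\mathcal S_2^{\mathrm{var}}}\phi_l(x_l),$$ where $\phi_p(0)=0$, $\phi_{\mathbf j}(t,0)=\phi_{\mathbf j}(0,t)=0$, all components are Hölder continuous on $[-1,1]$, resp. $[-1,1]^2$ with the Euclidean norm, with constant $L>0$ and exponent $\alpha\in(0,1]$, and, for some $D_1,D_2>0$, every $\phi_p$ with $p\in\mathcal S_1$ satisfies $|\phi_p|>D_1$ somewhere on $[-1,1]$ and every $\phi_{\mathbf j}$ with $\mathbf j\in\mathcal S_2$ satisfies $|\phi_{\mathbf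 j}|>D_2$ somewhere on $[-1,1]^2$. Each query at a point $x$ returns $f(x)+\eta$, with noise $\eta\sim\mathcal N(0,\sigma^2)$, $\sigma>0$, independent across queries. **Algorithm.** Let $\mathcal H$ be a $(d,2)$-hash family, i.e. a finite family of maps $h:[d]\to\{1,2\}$ such that any two distinct elements of $[d]$ are separated by some $h\in\mathcal H$. Let $m_i,n_i,N_i\in\mathbb N$, $\epsilon_i\ge0$, $\nu_i\ge 0$ $(i=1,2)$. Write $G_m=\{k/m:\ -m\le k\le m\}$. All queries are repeated ($N_2$ times in the first stage, $N_1$ times in the second) and the answers averaged; $\tilde f$ denotes such an average, with fresh noise at each use. *First stage.* Draw independent uniform $\beta_1,\dots,\beta_{n_2}\in\{-1,1\}^d$ and let $B$ be the $n_2\times\binom d2$ matrix with entries $B_{i,\mathbf j}=\beta_{i,j_1}\beta_{i,j_2}$. For each $h\in\mathcal H$ and $c_1,c_2\in G_{m_2}$ let $x_q=c_{h(q)}$, $q\in[d]$. For each $i$ query the points $x_{i,1},\dots,x_{i,4}$ that are obtained from $x$ by keeping the coordinates $q$ with $s\beta_{i,q}=1$ and setting the others to $0$, where the sign $s$ for coordinates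 with $(h(q)=1;\ h(q)=2)$ is $(+;+),(-;+),(+;-),(-;-)$, respectively. Put $y_i=\tilde f(x_{i,1})-\tilde f(x_{i,2})-\tilde f(x_{i,3})+\tilde f(x_{i,4})$ and let $\hat z$ be a solution of $$(P2)\qquad\min_z\|z\|_1\ \text{ s.t. }\ \|y-Bz\|_1\le\nu_2 .$$ All $\mathbf j$ with $h(j_1)\ne h(j_2)$ and $|\hat z_{\mathbf j}|>\epsilon_2$ are put into $\hat{\mathcal S}_2$. *Second stage.* Let $\mathcal P=[d]\setminus\hat{\mathcal S}_2^{\mathrm{var}}$, draw independent uniform $\beta_1,\dots,\beta_{n_1}\in\{-1,1\}^{\mathcal P}$, independent of the first stage, and let $B$ be the $n_1\times|\mathcal P|$ matrix with these rows. For each $c\in G_{m_1}$ and each $i$ query $x_i^{\pm}$, which equals $c$ at the coordinates $q\in\mathcal P$ with $\beta_{i,q}=\pm1$ and $0$ elsewhere. Put $y_i=\tilde f(x_i^+)-\tilde f(x_i^-)$ and let $\hat z\in\mathbb R^{\mathcal P}$ be a solution of $$(P1)\qquad\min_z\|z\|_1\ \text{ s.t. }\ \|y-Bz\|_2\le\nu_1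 .$$ All $p\in\mathcal P$ with $|\hat z_p|>\epsilon_1$ are put into $\hat{\mathcal S}_1$. (If a program has no solution, $\hat z$ is arbitrary.) **Theorem.** There are absolute constants $C_2,C_4,\tilde c_2,c_3,\tilde c_3,\tilde c_4,\tilde c_5>0$ and, for every $\theta\in(0,1)$, constants $\tilde c_1,c,C>0$ depending only on $\theta$, such that the following holds for all data as above with $|\mathcal S_1|\le\theta\,(d-|\mathcal S_2^{\mathrm{var}}|)$ and all $\varepsilon\in(0,1)$. Write $$s_2=|\mathcal S_2|\log\frac{d^2}{|\mathcal S_2|},\qquad s_1=|\mathcal S_1|\log\frac{d-|\mathcal S_2^{\mathrm{var}}|}{|\mathcal S_1|}$$ (each read as $0$ if the set is empty). Let $$\nu_2=\frac{2\sigma(1+\varepsilon)n_2}{\sqrt{N_2}},\quad \nu_1=\sqrt2(1+\varepsilon)\sigma\sqrt{\frac{n_1}{N_1}},\quad \epsilon_2=C_4\sqrt{\tfrac2\pi}(1+\varepsilon)\frac{2\sigma}{\sqrt{N_2}},\quad \epsilon_1=\frac{\sqrt2\,C_2(1+\varepsilon)\sigma}{\sqrt{N_1}},$$ and suppose $$N_2\ge\Bigl\lfloor\frac{72C_4^2(1+\varepsilon)^2\sigma^2}{\pi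 D_2^2}\Bigr\rfloor+1,\quad m_2\ge\sqrt2\Bigl(\frac{3L}{D_2}\Bigr)^{1/\alpha},\quad n_2\ge\max\Bigl\{\tilde c_3 s_2,\ \frac{2\log[(2m_2+1)^2e|\mathcal H|]}{\tilde c_5\varepsilon^2}\Bigr\},$$ $$N_1\ge\Bigl\lfloor\frac{18C_2^2(1+\varepsilon)^2\sigma^2}{D_1^2}\Bigr\rfloor+1,\quad m_1\ge\Bigl(\frac{3L}{D_1}\Bigr)^{1/\alpha},\quad n_1\ge\max\Bigl\{\tilde c_1 s_1,\ \frac{2\log(2m_1+1)}{c_3\varepsilon^2}\Bigr\}.$$ Then, with probability at least $$1-e^{-\tilde c_4n_2}-e^{-\tilde c_5n_2\varepsilon^2/2}-2e^{-\tilde c_2n_1}-2e^{-c_3\varepsilon^2n_1/2},$$ one has $\hat{\mathcal S}_2=\mathcal S_2$ and $\hat{\mathcal S}_1=\mathcal S_1$, for all choices of the solutions of (P2) and (P1). The total number of queries is $$Q=4(2m_2+1)^2n_2N_2|\mathcal H|+2(2m_1+1)n_1N_1,$$ and with $\bar c_i=\bigl(1+(3L/D_i)^{1/\alpha}\bigr)^i\bigl(1+\sigma^2/D_i^2\bigr)>1$,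 $i=1,2$, $$Q\ \ge\ c\,\bigl(\bar c_2\,s_2\,|\mathcal H|+\bar c_1\,s_1\bigr).$$ Conversely, if $N_2,m_2,n_2,N_1,m_1,n_1$ are the smallest natural numbers satisfying the conditions, then $$Q\ \le\ C\Bigl(\bar c_2\,|\mathcal H|\Bigl(s_2+\frac{\log[(2m_2+1)^2e|\mathcal H|]}{\varepsilon^2}\Bigr)+\bar c_1\Bigl(s_1+\frac{\log(2m_1+1)}{\varepsilon^2}\Bigr)\Bigr).$$ -/

import Mathlib

open MeasureTheory ProbabilityTheory
open scoped Matrix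

noncomputable section

namespace SPAM

/-! ### The additive model -/

/-- Ordered pairs `(j₁, j₂)` of coordinates with `j₁ < j₂`. -/
abbrev Pair (d : ℕ) : Type := {j : Fin d × Fin d // j.1 < j.2}

/-- The set of coordinates that occur in some pair of `S`. -/
def pairVars {d : ℕ} (S : Finset (Pair d)) : Finset (Fin d) :=
  S.biUnion fun j => {j.1.1, j.1.2}

/-- `f` is, on `[-1,1]^d`, a sparse additive model with univariate support `S₁`, bivariate
support `S₂`, anchored components `φ` and `ψ`, all Hölder continuous with exponent `α` and
constant `L`, and with identifiability levels `D₁` (for `S₁`) and `D₂` (for `S₂`). -/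
structure IsBivariateModel {d : ℕ} (f : (Fin d → ℝ) → ℝ) (S₁ : Finset (Fin d))
    (S₂ : Finset (Pair d)) (φ : Fin d → ℝ → ℝ) (ψ : Pair d → ℝ → ℝ → ℝ)
    (L α D₁ D₂ : ℝ) : Prop where
  disjoint : Disjoint S₁ (pairVars S₂)
  repr : ∀ x : Fin d → ℝ, (∀ i, x i ∈ Set.Icc (-1 : ℝ) 1) →
    f x = f 0 + ∑ p ∈ S₁, φ p (x p) + ∑ j ∈ S₂, ψ j (x j.1.1) (x j.1.2)
      + ∑ l ∈ pairVars S₂, φ l (x l)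
  uni_anchor : ∀ p ∈ S₁ ∪ pairVars S₂, φ p 0 = 0
  biv_anchor : ∀ j ∈ S₂, ∀ t ∈ Set.Icc (-1 : ℝ) 1, ψ j t 0 = 0 ∧ ψ j 0 t = 0
  uni_holder : ∀ p ∈ S₁ ∪ pairVars S₂, ∀ s ∈ Set.Icc (-1 : ℝ) 1, ∀ t ∈ Set.Icc (-1 : ℝ) 1,
    |φ p s - φ p t| ≤ L * |s - t| ^ α
  biv_holder : ∀ j ∈ S₂, ∀ s ∈ Set.Icc (-1 : ℝ) 1, ∀ s' ∈ Set.Icc (-1 : ℝ) 1,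
    ∀ t ∈ Set.Icc (-1 : ℝ) 1, ∀ t' ∈ Set.Icc (-1 : ℝ) 1,
    |ψ j s s' - ψ j t t'| ≤ L * (√((s - t) ^ 2 + (s' - t') ^ 2)) ^ α
  uni_ident : ∀ p ∈ S₁, ∃ s ∈ Set.Icc (-1 : ℝ) 1, D₁ < |φ p s|
  biv_ident : ∀ j ∈ S₂, ∃ s ∈ Set.Icc (-1 : ℝ) 1, ∃ t ∈ Set.Icc (-1 : ℝ) 1, D₂ < |ψ j s t|

/-! ### Hash families and the sparse recovery programs -/

/-- `(d,t)`-hash family: every `t` distinct elements are separated by some member. -/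
def IsHashFamily {M d t : ℕ} (H : Fin M → Fin d → Fin t) : Prop :=
  ∀ i : Fin t → Fin d, Function.Injective i → ∃ l, Function.Injective (H l ∘ i)

def l1norm {ι : Type} [Fintype ι] (v : ι → ℝ) : ℝ := ∑ i, |v i|

def l2norm {ι : Type} [Fintype ι] (v : ι → ℝ) : ℝ := √(∑ i, v i ^ 2)

/-- `z` solves (P1): minimize `‖z‖₁` subject to `‖y - B z‖₂ ≤ ν`. -/
def SolvesP1 {n : ℕ} {ι : Type} [Fintype ι] (ν : ℝ) (B : Matrix (Fin n) ι ℝ) (y : Fin n → ℝ)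
    (z : ι → ℝ) : Prop :=
  l2norm (y - B *ᵥ z) ≤ ν ∧ ∀ w : ι → ℝ, l2norm (y - B *ᵥ w) ≤ ν → l1norm z ≤ l1norm w

/-- `z` solves (P2): minimize `‖z‖₁` subject to `‖y - B z‖₁ ≤ ν`. -/
def SolvesP2 {n : ℕ} {ι : Type} [Fintype ι] (ν : ℝ) (B : Matrix (Fin n) ι ℝ) (y : Fin n → ℝ)
    (z : ι → ℝ) : Prop :=
  l1norm (y - B *ᵥ z) ≤ ν ∧ ∀ w : ι → ℝ, l1norm (y - B *ᵥ w) ≤ ν → l1norm z ≤ l1norm w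

/-- A routine that, from `B` and `y`, returns a vector indexed by `ι`. -/
abbrev SparseRec (n : ℕ) (ι : Type) : Type := Matrix (Fin n) ι ℝ → (Fin n → ℝ) → ι → ℝ

/-- The routine returns a solution of (P1) whenever there is one. -/
def SparseRec.IsP1 {n : ℕ} {ι : Type} [Fintype ι] (R : SparseRec n ι) (ν : ℝ) : Prop :=
  ∀ B y, (∃ z, SolvesP1 ν B y z) → SolvesP1 ν B y (R B y)

/-- The routine returns a solution of (P2) whenever there is one. -/
def SparseRec.IsP2 {n : ℕ} {ι : Type} [Fintype ι] (R : SparseRec n ι) (ν : ℝ) : Prop :=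
  ∀ B y, (∃ z, SolvesP2 ν B y z) → SolvesP2 ν B y (R B y)

/-! ### The algorithm -/

/-- Parameters of the algorithm: the family `hash` of `M` hash functions, and, for the stage
estimating `S₂` (index `2`) and the stage estimating `S₁` (index `1`), the grid fineness `m`,
the number `n` of measurements, the number `N` of repetitions of every query and the
threshold `thr`. -/
structure Params (d : ℕ) where
  M : ℕ
  hash : Fin M → Fin d → Fin 2
  m₂ : ℕ
  n₂ : ℕ
  N₂ : ℕ
  thr₂ : ℝ
  m₁ : ℕ
  n₁ : ℕ
  N₁ : ℕ
  thr₁ : ℝ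

/-- The queries of the first loop: hash function, base point (a pair of grid indices),
measurement, which of the four points, repetition. -/
abbrev Query₂ {d : ℕ} (A : Params d) : Type :=
  Fin A.M × (Fin (2 * A.m₂ + 1) × Fin (2 * A.m₂ + 1)) × Fin A.n₂ × Fin 4 × Fin A.N₂

/-- The queries of the second loop: base point, measurement, which of the two points,
repetition. -/
abbrev Query₁ {d : ℕ} (A : Params d) : Type :=
  Fin (2 * A.m₁ + 1) × Fin A.n₁ × Fin 2 × Fin A.N₁

/-- All queries made during one run. -/
abbrev Query {d : ℕ} (A : Params d) : Type := Query₂ A ⊕ Query₁ A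

/-- The number of queries made during one run. -/
def numQueries {d : ℕ} (A : Params d) : ℕ := Fintype.card (Query A)

/-- The grid `-1, -(m-1)/m, …, (m-1)/m, 1`. -/
def gridValue (m : ℕ) (k : Fin (2 * m + 1)) : ℝ := ((k : ℝ) - m) / m

/-- The sign encoded by a bit. -/
def sgn (b : Bool) : ℝ := if b then 1 else -1

/-- The indicator that the sign encoded by a bit is `+1`. -/
def ind (b : Bool) : ℝ := if b then 1 else 0

/-- `c₁ e₁(h) + c₂ e₂(h)`. -/
def basePoint₂ {d : ℕ} (m : ℕ) (h : Fin d → Fin 2)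
    (c : Fin (2 * m + 1) × Fin (2 * m + 1)) : Fin d → ℝ :=
  fun q => if h q = 0 then gridValue m c.1 else gridValue m c.2

/-- The four query points made from a base point `x`, a sign vector `β` and a partition `h`. -/
def samplePoint₂ {d : ℕ} (h : Fin d → Fin 2) (β : Fin d → Bool) (x : Fin d → ℝ) (t : Fin 4) :
    Fin d → ℝ :=
  fun i => ind (if h i = 0 then ![β i, !β i, β i, !β i] t else ![β i, β i, !β i, !β i] t) * x i

/-- The location of a query of the first loop. -/
def queryPoint₂ {d : ℕ} (A : Params d) (β : Fin A.n₂ → Fin d → Bool) (q : Query₂ A) :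
    Fin d → ℝ :=
  samplePoint₂ (A.hash q.1) (β q.2.2.1) (basePoint₂ A.m₂ (A.hash q.1) q.2.1) q.2.2.2.1

/-- The matrix with rows `(β_{j₁} β_{j₂})_j`. -/
def signMatrix₂ {n d : ℕ} (β : Fin n → Fin d → Bool) : Matrix (Fin n) (Pair d) ℝ :=
  Matrix.of fun i j => sgn (β i j.1.1) * sgn (β i j.1.2)

/-- The measurement vector at hash function `l` and base point `c`, from the answers to the
queries; the answers to the repetitions of a query are averaged. -/
def measurement₂ {d : ℕ} (A : Params d) (ans : Query₂ A → ℝ) (l : Fin A.M)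
    (c : Fin (2 * A.m₂ + 1) × Fin (2 * A.m₂ + 1)) : Fin A.n₂ → ℝ :=
  fun i =>
    let a : Fin 4 → ℝ := fun t => (∑ r, ans (l, c, i, t, r)) / A.N₂
    a 0 - a 1 - a 2 + a 3

open Classical in
/-- The output of the first loop. -/
def estimate₂ {d : ℕ} (A : Params d) (R : SparseRec A.n₂ (Pair d))
    (β : Fin A.n₂ → Fin d → Bool) (ans : Query₂ A → ℝ) : Finset (Pair d) :=
  Finset.univ.filter fun j => ∃ l c, A.hash l j.1.1 ≠ A.hash l j.1.2 ∧
    A.thr₂ < |R (signMatrix₂ β) (measurement₂ A ans l c) j|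

/-- The two query points made from a grid value `s`, a sign vector `β` and a set `P` of
active coordinates: `s` at the active coordinates with sign `+1` (for `t = 0`) or `-1`
(for `t = 1`), and `0` elsewhere. -/
def samplePoint₁ {d : ℕ} (P : Finset (Fin d)) (β : Fin d → Bool) (s : ℝ) (t : Fin 2) :
    Fin d → ℝ :=
  fun i => if i ∈ P then ind (![β i, !β i] t) * s else 0

/-- The location of a query of the second loop, with active coordinates `P`. -/
def queryPoint₁ {d : ℕ} (A : Params d) (P : Finset (Fin d)) (β : Fin A.n₁ → Fin d → Bool)
    (q : Query₁ A) : Fin d → ℝ :=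
  samplePoint₁ P (β q.2.1) (gridValue A.m₁ q.1) q.2.2.1

/-- The sign matrix with columns restricted to `P`. -/
def signMatrix₁ {n d : ℕ} (P : Finset (Fin d)) (β : Fin n → Fin d → Bool) :
    Matrix (Fin n) P ℝ :=
  Matrix.of fun i p => sgn (β i p)

/-- The measurement vector at base point `c`. -/
def measurement₁ {d : ℕ} (A : Params d) (ans : Query₁ A → ℝ) (c : Fin (2 * A.m₁ + 1)) :
    Fin A.n₁ → ℝ :=
  fun i =>
    let a : Fin 2 → ℝ := fun t => (∑ r, ans (c, i, t, r)) / A.N₁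
    a 0 - a 1

open Classical in
/-- The output of the second loop, with active coordinates `P`. -/
def estimate₁ {d : ℕ} (A : Params d) (P : Finset (Fin d)) (R : SparseRec A.n₁ P)
    (β : Fin A.n₁ → Fin d → Bool) (ans : Query₁ A → ℝ) : Finset (Fin d) :=
  Finset.univ.filter fun p => ∃ c, ∃ hp : p ∈ P,
    A.thr₁ < |R (signMatrix₁ P β) (measurement₁ A ans c) ⟨p, hp⟩|

/-- All the randomness of a run: the sign vectors of the two loops and one noise value per
query. The second loop uses its sign vectors only at the active coordinates. -/
abbrev Outcome {d : ℕ} (A : Params d) : Type :=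
  (Fin A.n₂ → Fin d → Bool) × (Fin A.n₁ → Fin d → Bool) × (Query A → ℝ)

/-- The output of a run of the whole algorithm on `f`: the estimate of `S₂` and, with the
remaining coordinates as active ones, the estimate of `S₁`. The answer to a query is the value
of `f` at its location plus the noise value of that query. -/
def output {d : ℕ} (A : Params d) (f : (Fin d → ℝ) → ℝ) (R₂ : SparseRec A.n₂ (Pair d))
    (R₁ : (P : Finset (Fin d)) → SparseRec A.n₁ P) (ω : Outcome A) :
    Finset (Pair d) × Finset (Fin d) :=
  let T₂ := estimate₂ A R₂ ω.1 fun q => f (queryPoint₂ A ω.1 q) + ω.2.2 (Sum.inl q)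
  let P := (pairVars T₂)ᶜ
  let T₁ := estimate₁ A P (R₁ P) ω.2.1
    fun q => f (queryPoint₁ A P ω.2.1 q) + ω.2.2 (Sum.inr q)
  (T₂, T₁)

/-- A fair bit, so that `sgn` of it is a Rademacher variable. -/
def coin : Measure Bool := (PMF.uniformOfFintype Bool).toMeasure

/-- The law of the randomness: independent Rademacher signs and independent `N(0, σ²)` noise. -/
def law {d : ℕ} (A : Params d) (σ : ℝ) : Measure (Outcome A) :=
  (Measure.pi fun _ => Measure.pi fun _ => coin).prod
    ((Measure.pi fun _ => Measure.pi fun _ => coin).prod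
      (Measure.pi fun _ => gaussianReal 0 (σ ^ 2).toNNReal))

/-! ### Size of the query count -/

/-- The factor `(1 + (3L/D)^{1/α})^i (1 + σ²/D²)`. -/
def costFactor (i : ℕ) (L D α σ : ℝ) : ℝ :=
  (1 + (3 * L / D) ^ (1 / α)) ^ i * (1 + σ ^ 2 / D ^ 2)

theorem one_lt_costFactor {i : ℕ} (hi : i ≠ 0) {L D : ℝ} (α σ : ℝ) (hL : 0 < L) (hD : 0 < D) :
    1 < costFactor i L D α σ := by
  have h1 : 0 < (3 * L / D) ^ (1 / α) := by positivity
  have h2 : 1 < (1 + (3 * L / D) ^ (1 / α)) ^ i := one_lt_pow₀ (by linarith) hi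
  have h3 : 0 ≤ σ ^ 2 / D ^ 2 := by positivity
  unfold costFactor
  nlinarith

/-- The number of pairs times the logarithmic factor, `|S₂| log(d²/|S₂|)`. -/
def complexity₂ {d : ℕ} (S₂ : Finset (Pair d)) : ℝ :=
  (S₂.card : ℝ) * Real.log ((d : ℝ) ^ 2 / S₂.card)

/-- `|S₁| log((d - |S₂ᵛᵃʳ|)/|S₁|)`, where `S₂ᵛᵃʳ` is the set of variables occurring in `S₂`. -/
def complexity₁ {d : ℕ} (S₁ : Finset (Fin d)) (S₂ : Finset (Pair d)) : ℝ :=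
  (S₁.card : ℝ) * Real.log (((d : ℝ) - (pairVars S₂).card) / S₁.card)

end SPAM

end

/-! Exact recovery splits into a deterministic statement about `ℓ₁`-minimisation and a probabilistic
one about sign matrices and noise.

Deterministic part. By anchoring, the alternating sum of four values of `f` (first stage) or the
difference of two (second stage) equals one row of `B *ᵥ z`, where `z` is supported on the unknown
set (`alternating_sum`, `difference`); the averaged noise is added to it. Call `B` stable on `S`
(`IsStableOn`) if `n |h i| ≤ 2 ^ 14 ‖B h‖₁` whenever at least half of the `ℓ₁`-mass of `h` lies on
`S`. Minimality puts the error of a solution in this cone. If the noise obeys the constraint, truth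
and solution are both feasible, so each entry is recovered up to the threshold. The threshold is at
most `D / 3`, while the hash family, the grid and Hölder continuity provide a base point at which a
given active entry exceeds `2 D / 3`. Hence thresholding makes no mistake.

Stability. Rows are Rademacher vectors or Rademacher chaoses of order two. The latter have only
subexponential tails, so `‖B x‖₁ / n` is compared with `‖x‖₂`: for fixed `x` the ratio lies in `[2 ^
(-12), 24]` up to a probability exponentially small in `n`
(`IsSubexpRow.measureReal_not_isometric_le`). The upper bound is Chernoff; the lower one holds
because the second and exponential moments keep the first absolute moment away from `0`. The
exponential moment of the chaos comes from decoupling by a random partition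
(`integral_exp_chaos_le`). A union bound over sparse integer vectors, with logarithmic cardinality
of order `s (1 + log (N / s))`, extends the comparison to all sparse vectors, and cutting vectors
into blocks extends it to the cone (`abs_le_of_mem_cone`). The linear rows satisfy the same
hypotheses; (P1) is handled through `‖·‖₁ ≤ √n ‖·‖₂`.

Noise. Squared norms of Gaussian vectors get a Chernoff bound, followed by a union bound over base
points and hash functions. The second stage is analysed for the complement of the true `pairVars
S₂`, a deterministic set: on the good event the first stage has already returned `S₂`.

The query count is a product formula; its two estimates only compare floors and ceilings with the
real quantities they round. -/

namespace SPAM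

/-! ### Norms of vectors and sparse vectors -/

section Sparse

variable {ι : Type}

/-- `x` has at most `k` nonzero entries. -/
def IsSparse (k : ℕ) (x : ι → ℝ) : Prop := ∃ T : Finset ι, T.card ≤ k ∧ ∀ i ∉ T, x i = 0

theorem IsSparse.smul {k : ℕ} {x : ι → ℝ} (h : IsSparse k x) (c : ℝ) : IsSparse k (c • x) := by
  obtain ⟨T, hT, hx⟩ := h
  exact ⟨T, hT, fun i hi => by simp [hx i hi]⟩

open Classical in
/-- The restriction of a vector to a set of coordinates. -/
noncomputable def restrictTo (T : Finset ι) (x : ι → ℝ) : ι → ℝ := fun i => if i ∈ T then x i else 0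

theorem isSparse_restrictTo (T : Finset ι) (x : ι → ℝ) : IsSparse T.card (restrictTo T x) :=
  ⟨T, le_rfl, fun i hi => by simp [restrictTo, hi]⟩

/-- The `k` largest entries of a vector. -/
theorem exists_top_entries [DecidableEq ι] (y : ι → ℝ) (W : Finset ι) :
    ∀ k : ℕ, k ≤ W.card → ∃ T ⊆ W, T.card = k ∧ ∀ i ∈ T, ∀ j ∈ W \ T, y j ≤ y i := by
  intro k
  induction k with
  | zero => intro _; exact ⟨∅, by simp, by simp, by simp⟩
  | succ k ih =>
    intro hk
    obtain ⟨T, hTW, hT, hle⟩ := ih (by omega)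
    have hne : (W \ T).Nonempty := by
      rw [← Finset.card_pos, Finset.card_sdiff_of_subset hTW]; omega
    obtain ⟨m, hm, hmax⟩ := Finset.exists_max_image (W \ T) y hne
    rw [Finset.mem_sdiff] at hm
    refine ⟨insert m T, Finset.insert_subset hm.1 hTW, ?_, ?_⟩
    · rw [Finset.card_insert_of_notMem hm.2, hT]
    · intro i hi j hj
      simp only [Finset.mem_sdiff, Finset.mem_insert, not_or] at hj
      have hj' : j ∈ W \ T := by simp [hj]
      rcases Finset.mem_insert.1 hi with rfl | hi
      · exact hmax j hj'
      · exact hle i hi j hj'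

end Sparse

section Norms

variable {ι : Type} [Fintype ι]

theorem l1norm_nonneg (x : ι → ℝ) : 0 ≤ l1norm x := Finset.sum_nonneg fun _ _ => abs_nonneg _

theorem l2norm_nonneg (x : ι → ℝ) : 0 ≤ l2norm x := Real.sqrt_nonneg _

theorem l2norm_sq (x : ι → ℝ) : l2norm x ^ 2 = ∑ i, x i ^ 2 :=
  Real.sq_sqrt (Finset.sum_nonneg fun _ _ => sq_nonneg _)

theorem l1norm_add_le (x y : ι → ℝ) : l1norm (x + y) ≤ l1norm x + l1norm y := by
  unfold l1norm
  rw [← Finset.sum_add_distrib]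
  exact Finset.sum_le_sum fun i _ => abs_add_le _ _

theorem l1norm_smul (c : ℝ) (x : ι → ℝ) : l1norm (c • x) = |c| * l1norm x := by
  simp [l1norm, abs_mul, Finset.mul_sum]

theorem l2norm_smul (c : ℝ) (x : ι → ℝ) : l2norm (c • x) = |c| * l2norm x := by
  simp only [l2norm, Pi.smul_apply, smul_eq_mul, mul_pow, ← Finset.mul_sum]
  rw [Real.sqrt_mul (sq_nonneg c), Real.sqrt_sq_eq_abs]

theorem l2norm_eq_norm (x : ι → ℝ) : l2norm x = ‖WithLp.toLp 2 x‖ := by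
  simp [EuclideanSpace.norm_eq, l2norm]

theorem l2norm_add_le (x y : ι → ℝ) : l2norm (x + y) ≤ l2norm x + l2norm y := by
  simp only [l2norm_eq_norm, WithLp.toLp_add]
  exact norm_add_le _ _

theorem abs_le_l2norm (x : ι → ℝ) (i : ι) : |x i| ≤ l2norm x := by
  apply Real.abs_le_sqrt
  exact Finset.single_le_sum (f := fun i => x i ^ 2) (fun _ _ => sq_nonneg _) (Finset.mem_univ i)

theorem l2norm_le_of_abs_le {x y : ι → ℝ} (h : ∀ i, |x i| ≤ |y i|) : l2norm x ≤ l2norm y :=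
  Real.sqrt_le_sqrt (Finset.sum_le_sum fun i _ => sq_le_sq.2 (h i))

theorem sum_abs_le_sqrt_card_mul_l2norm (T : Finset ι) (x : ι → ℝ) :
    ∑ i ∈ T, |x i| ≤ √(T.card : ℝ) * l2norm x := by
  rw [l2norm, ← Real.sqrt_mul (Nat.cast_nonneg _)]
  apply Real.le_sqrt_of_sq_le
  calc (∑ i ∈ T, |x i|) ^ 2 ≤ T.card * ∑ i ∈ T, |x i| ^ 2 := sq_sum_le_card_mul_sum_sq
    _ ≤ T.card * ∑ i, x i ^ 2 := by
      simp only [sq_abs]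
      gcongr
      exact Finset.subset_univ T

theorem l1norm_le_sqrt_card_mul_l2norm (x : ι → ℝ) :
    l1norm x ≤ √(Fintype.card ι : ℝ) * l2norm x :=
  sum_abs_le_sqrt_card_mul_l2norm Finset.univ x

theorem IsSparse.l1norm_le {k : ℕ} {x : ι → ℝ} (h : IsSparse k x) :
    l1norm x ≤ √(k : ℝ) * l2norm x := by
  obtain ⟨T, hT, hx⟩ := h
  have : l1norm x = ∑ i ∈ T, |x i| :=
    (Finset.sum_subset (Finset.subset_univ T) fun i _ hi => by simp [hx i hi]).symm
  rw [this]
  refine (sum_abs_le_sqrt_card_mul_l2norm T x).trans ?_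
  have := l2norm_nonneg x
  gcongr

theorem IsSparse.l2norm_le {k : ℕ} {x : ι → ℝ} (h : IsSparse k x) {M : ℝ} (hM : 0 ≤ M)
    (hx : ∀ i, |x i| ≤ M) : l2norm x ≤ √(k : ℝ) * M := by
  obtain ⟨T, hT, hx0⟩ := h
  rw [← Real.sqrt_sq hM, ← Real.sqrt_mul (Nat.cast_nonneg _)]
  apply Real.sqrt_le_sqrt
  calc ∑ i, x i ^ 2 = ∑ i ∈ T, x i ^ 2 :=
        (Finset.sum_subset (Finset.subset_univ T) fun i _ hi => by simp [hx0 i hi]).symm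
    _ ≤ ∑ i ∈ T, M ^ 2 := Finset.sum_le_sum fun i _ => by
        rw [← sq_abs]; exact pow_le_pow_left₀ (abs_nonneg _) (hx i) 2
    _ ≤ k * M ^ 2 := by
        rw [Finset.sum_const, nsmul_eq_mul]
        gcongr

theorem l1norm_restrictTo (T : Finset ι) (x : ι → ℝ) :
    l1norm (restrictTo T x) = ∑ i ∈ T, |x i| := by
  classical
  rw [l1norm, ← Finset.sum_subset (Finset.subset_univ T)]
  · exact Finset.sum_congr rfl fun i hi => by simp [restrictTo, hi]
  · intro i _ hi; simp [restrictTo, hi]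

variable [DecidableEq ι]

theorem restrictTo_add_compl (T : Finset ι) (x : ι → ℝ) :
    restrictTo T x + restrictTo Tᶜ x = x := by
  ext i
  by_cases h : i ∈ T <;> simp [restrictTo, h]

/-! ### Decomposition of vectors into sparse blocks -/

/-- A subadditive functional bounded by `b ‖·‖₂` on `k`-sparse vectors is bounded by
`b (√k ‖·‖_∞ + ‖·‖₁ / √k)` on all vectors. -/
theorem le_of_le_on_sparse {p : (ι → ℝ) → ℝ} (hadd : ∀ x y, p (x + y) ≤ p x + p y) {b : ℝ}
    (hb : 0 ≤ b) {k : ℕ} (hk : 0 < k) (hp : ∀ x, IsSparse k x → p x ≤ b * l2norm x)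
    (W : Finset ι) : ∀ (x : ι → ℝ) (M : ℝ), (∀ i ∉ W, x i = 0) → (∀ i, |x i| ≤ M) → 0 ≤ M →
      p x ≤ b * (√(k : ℝ) * M + l1norm x / √(k : ℝ)) := by
  have hk' : (0 : ℝ) < k := by exact_mod_cast hk
  have hsk : 0 < √(k : ℝ) := Real.sqrt_pos.2 hk'
  induction W using Finset.strongInduction with
  | H W ih =>
    intro x M hW hx hM
    by_cases hc : W.card ≤ k
    · have hs : IsSparse k x := ⟨W, hc, hW⟩
      refine (hp x hs).trans ?_
      gcongr
      have h1 := hs.l2norm_le hM hx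
      have h2 : 0 ≤ l1norm x / √(k : ℝ) := div_nonneg (l1norm_nonneg x) hsk.le
      linarith
    · obtain ⟨T, hTW, hT, hle⟩ := exists_top_entries (fun i => |x i|) W k (by omega)
      have hTne : T.Nonempty := by rw [← Finset.card_pos]; omega
      obtain ⟨m, hm, hmin⟩ := Finset.exists_min_image T (fun i => |x i|) hTne
      have hTabs : (k : ℝ) * |x m| ≤ ∑ i ∈ T, |x i| := by
        rw [← hT, ← nsmul_eq_mul]
        exact Finset.card_nsmul_le_sum T _ _ hmin
      have hsub : W \ T ⊂ W := by
        refine ⟨Finset.sdiff_subset, fun h => ?_⟩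
        have := h (hTW hm)
        simp [hm] at this
      have hrec := ih (W \ T) hsub (restrictTo Tᶜ x) |x m| (by
          intro i hi
          simp only [Finset.mem_sdiff, not_and, not_not] at hi
          by_cases hiW : i ∈ W
          · simp [restrictTo, hi hiW]
          · simp [restrictTo, hW i hiW]) (by
          intro i
          by_cases hiT : i ∈ T
          · simp [restrictTo, hiT]
          · by_cases hiW : i ∈ W
            · simpa [restrictTo, hiT] using hle m hm i (by simp [hiT, hiW])
            · simp [restrictTo, hW i hiW]) (abs_nonneg _)
      have hhead : p (restrictTo T x) ≤ b * (√(k : ℝ) * M) := by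
        have hs : IsSparse k (restrictTo T x) := hT ▸ isSparse_restrictTo T x
        refine (hp _ hs).trans ?_
        gcongr
        refine hs.l2norm_le hM fun i => ?_
        by_cases hiT : i ∈ T
        · simpa [restrictTo, hiT] using hx i
        · simpa [restrictTo, hiT] using hM
      have hsum : l1norm x = ∑ i ∈ T, |x i| + l1norm (restrictTo Tᶜ x) := by
        rw [l1norm_restrictTo, l1norm, Finset.sum_add_sum_compl]
      -- The new sup bound `|x m|` is the smallest entry of the block `T`, hence at most the average
      -- over `T`. Thus the sup term of each tail is paid for by the `ℓ₁`-mass of the preceding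
      -- block.
      have hxm : √(k : ℝ) * |x m| ≤ (∑ i ∈ T, |x i|) / √(k : ℝ) := by
        rw [le_div_iff₀ hsk]
        calc √(k : ℝ) * |x m| * √(k : ℝ) = (√(k : ℝ) * √(k : ℝ)) * |x m| := by ring
          _ = k * |x m| := by rw [Real.mul_self_sqrt hk'.le]
          _ ≤ _ := hTabs
      calc p x = p (restrictTo T x + restrictTo Tᶜ x) := by rw [restrictTo_add_compl]
        _ ≤ b * (√(k : ℝ) * M)
            + b * (√(k : ℝ) * |x m| + l1norm (restrictTo Tᶜ x) / √(k : ℝ)) :=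
          (hadd _ _).trans (add_le_add hhead hrec)
        _ ≤ b * (√(k : ℝ) * M) + b * ((∑ i ∈ T, |x i|) / √(k : ℝ)
            + l1norm (restrictTo Tᶜ x) / √(k : ℝ)) := by gcongr
        _ = b * (√(k : ℝ) * M + l1norm x / √(k : ℝ)) := by rw [hsum]; ring

/-- A seminorm that is comparable to `‖·‖₂` on sparse vectors controls all entries of the vectors
in the cone `‖h_{Sᶜ}‖₁ ≤ ‖h_S‖₁`. -/
theorem abs_le_of_mem_cone {p : (ι → ℝ) → ℝ} (hadd : ∀ x y, p (x + y) ≤ p x + p y)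
    (hneg : ∀ x, p (-x) = p x) {a b : ℝ} (ha : 0 < a) (hb : 0 ≤ b) (S : Finset ι)
    (hS : S.Nonempty) {k : ℕ} (hk : S.card ≤ k)
    (hak : 2 * b * √(S.card : ℝ) ≤ a / 2 * √(k : ℝ))
    (hlow : ∀ x, IsSparse (k + S.card) x → a * l2norm x ≤ p x)
    (hupp : ∀ x, IsSparse k x → p x ≤ b * l2norm x) (h : ι → ℝ)
    (hcone : ∑ i ∈ Sᶜ, |h i| ≤ ∑ i ∈ S, |h i|) (i : ι) : a / 2 * |h i| ≤ p h := by
  have hs0 : 0 < S.card := Finset.card_pos.2 hS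
  have hk0 : 0 < k := by omega
  have hk' : (0 : ℝ) < k := by exact_mod_cast hk0
  have hsk : 0 < √(k : ℝ) := Real.sqrt_pos.2 hk'
  set v := restrictTo Sᶜ h with hv
  have hv1 : l1norm v ≤ √(S.card : ℝ) * l2norm (restrictTo S h) := by
    rw [hv, l1norm_restrictTo]
    refine hcone.trans ?_
    rw [← l1norm_restrictTo]
    exact (isSparse_restrictTo S h).l1norm_le
  -- Cutting at the level `‖v‖₁ / k` leaves at most `k` larger entries outside `S`. They join `S` in
  -- the sparse part `U`; what remains is small both in sup norm and in `ℓ₁`.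
  set τ := l1norm v / k with hτ
  have hτ0 : 0 ≤ τ := div_nonneg (l1norm_nonneg v) hk'.le
  set T := Finset.univ.filter fun i => τ < |v i| with hT
  have hTk : T.card ≤ k := by
    by_contra hcon
    push Not at hcon
    have hne : T.Nonempty := by rw [← Finset.card_pos]; omega
    have h1 : ∑ i ∈ T, τ < ∑ i ∈ T, |v i| :=
      Finset.sum_lt_sum_of_nonempty hne fun i hi => (Finset.mem_filter.1 hi).2
    have h2 : ∑ i ∈ T, |v i| ≤ l1norm v :=
      Finset.sum_le_sum_of_subset_of_nonneg (Finset.subset_univ T) fun _ _ _ => abs_nonneg _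
    rw [Finset.sum_const, nsmul_eq_mul] at h1
    have h3 : (k : ℝ) * τ ≤ T.card * τ := by gcongr
    have h4 : (k : ℝ) * τ = l1norm v := by rw [hτ]; field_simp
    linarith
  set U := S ∪ T with hU
  have hUc : U.card ≤ k + S.card := (Finset.card_union_le _ _).trans (by omega)
  have hmono : l2norm (restrictTo S h) ≤ l2norm (restrictTo U h) := by
    apply l2norm_le_of_abs_le
    intro i
    by_cases hi : i ∈ S
    · simp [restrictTo, hU, hi]
    · simp [restrictTo, hi]
  have hsmall : ∀ i ∉ U, |h i| ≤ τ := by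
    intro i hi
    simp only [hU, Finset.mem_union, not_or, hT, Finset.mem_filter, Finset.mem_univ, true_and,
      not_lt] at hi
    simpa [hv, restrictTo, hi.1] using hi.2
  -- Both terms of the block estimate are at most `‖v‖₁ / √k`, and the cone condition gives `‖v‖₁ ≤
  -- √s ‖h_S‖₂`. With `k` a large multiple of `s`, the remainder costs only half of the lower bound
  -- on `U`.
  have hrest : p (restrictTo Uᶜ h) ≤ a / 2 * l2norm (restrictTo U h) := by
    have h1 := le_of_le_on_sparse hadd hb hk0 hupp Finset.univ (restrictTo Uᶜ h) τ (by simp)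
      (by
        intro i
        by_cases hi : i ∈ U
        · simpa [restrictTo, hi] using hτ0
        · simpa [restrictTo, hi] using hsmall i hi) hτ0
    have h2 : l1norm (restrictTo Uᶜ h) ≤ l1norm v := by
      rw [hv, l1norm_restrictTo, l1norm_restrictTo]
      apply Finset.sum_le_sum_of_subset_of_nonneg
      · intro i hi
        simp only [hU, Finset.mem_compl, Finset.mem_union, not_or] at hi ⊢
        exact hi.1
      · intros; exact abs_nonneg _
    have h3 : √(k : ℝ) * τ = l1norm v / √(k : ℝ) := by
      rw [hτ, eq_div_iff hsk.ne']
      calc √(k : ℝ) * (l1norm v / k) * √(k : ℝ) = √(k : ℝ) * √(k : ℝ) * (l1norm v / k) := by ring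
        _ = l1norm v := by rw [Real.mul_self_sqrt hk'.le]; field_simp
    have h4 : l1norm (restrictTo Uᶜ h) / √(k : ℝ) ≤ l1norm v / √(k : ℝ) := by gcongr
    have hl := l2norm_nonneg (restrictTo U h)
    calc p (restrictTo Uᶜ h) ≤ b * (l1norm v / √(k : ℝ) + l1norm v / √(k : ℝ)) := by
          refine h1.trans ?_
          rw [h3]
          gcongr
      _ = 2 * b * l1norm v / √(k : ℝ) := by ring
      _ ≤ 2 * b * (√(S.card : ℝ) * l2norm (restrictTo U h)) / √(k : ℝ) := by
          gcongr
          exact hv1.trans (by gcongr)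
      _ = 2 * b * √(S.card : ℝ) * l2norm (restrictTo U h) / √(k : ℝ) := by ring
      _ ≤ a / 2 * √(k : ℝ) * l2norm (restrictTo U h) / √(k : ℝ) := by gcongr
      _ = a / 2 * l2norm (restrictTo U h) := by field_simp
  have hmain : a / 2 * l2norm (restrictTo U h) ≤ p h := by
    have h1 : a * l2norm (restrictTo U h) ≤ p (restrictTo U h) := by
      apply hlow
      obtain ⟨T', hT', hx⟩ := isSparse_restrictTo U h
      exact ⟨T', hT'.trans hUc, hx⟩
    have h2 : p (restrictTo U h) ≤ p h + p (restrictTo Uᶜ h) := by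
      have h3 : restrictTo U h = h + -restrictTo Uᶜ h := by
        rw [eq_add_neg_iff_add_eq, restrictTo_add_compl]
      calc p (restrictTo U h) = p (h + -restrictTo Uᶜ h) := by rw [← h3]
        _ ≤ _ := by rw [← hneg (restrictTo Uᶜ h)]; exact hadd _ _
    linarith
  refine le_trans ?_ hmain
  gcongr
  by_cases hi : i ∈ U
  · simpa [restrictTo, hi] using abs_le_l2norm (restrictTo U h) i
  · refine (hsmall i hi).trans ?_
    have hl := l2norm_nonneg (restrictTo U h)
    rw [hτ, div_le_iff₀ hk']
    have h5 : √(S.card : ℝ) ≤ k := by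
      rw [Real.sqrt_le_left hk'.le]
      have h6 : (S.card : ℝ) ≤ k := by exact_mod_cast hk
      have h7 : (1 : ℝ) ≤ k := by exact_mod_cast hk0
      nlinarith
    calc l1norm v ≤ √(S.card : ℝ) * l2norm (restrictTo S h) := hv1
      _ ≤ k * l2norm (restrictTo U h) := mul_le_mul h5 hmono (l2norm_nonneg _) hk'.le
      _ = _ := mul_comm _ _

end Norms

/-! ### A net of sparse integer vectors -/

section Net

variable {ι : Type} [Fintype ι]

open Classical in
/-- Integer vectors with at most `K` nonzero entries and `ℓ₁`-norm at most `m`. -/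
noncomputable def latticeNet (ι : Type) [Fintype ι] (K m : ℕ) : Finset (ι → ℤ) :=
  (Fintype.piFinset fun _ => Finset.Icc (-(m : ℤ)) m).filter fun w =>
    (Finset.univ.filter fun i => w i ≠ 0).card ≤ K ∧ ∑ i, (w i).natAbs ≤ m

/-- One-coordinate generating function: the weight charges `lam` for a nonzero entry and `1/2` per
unit of size, and the geometric series sums to at most `1` on either side of zero. -/
theorem sum_latticeWeight_le {lam : ℝ} (hlam : 0 ≤ lam) (m : ℕ) :
    ∑ a ∈ Finset.Icc (-(m : ℤ)) m, (if a = 0 then 1 else lam) * (1 / 2 : ℝ) ^ a.natAbs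
      ≤ 1 + 2 * lam := by
  have key : ∑ a ∈ Finset.Icc (-(m : ℤ)) m, (if a = 0 then 1 else lam) * (1 / 2 : ℝ) ^ a.natAbs
      = 1 + 2 * lam * (1 - (1 / 2) ^ m) := by
    induction m with
    | zero => simp
    | succ m ih =>
      have hIcc : Finset.Icc (-((m + 1 : ℕ) : ℤ)) (m + 1 : ℕ)
          = insert (-(m + 1 : ℤ)) (insert (m + 1 : ℤ) (Finset.Icc (-(m : ℤ)) m)) := by
        ext a
        simp only [Finset.mem_Icc, Finset.mem_insert]
        push_cast
        omega
      have h1 : (-(m + 1 : ℤ)) ∉ insert (m + 1 : ℤ) (Finset.Icc (-(m : ℤ)) m) := by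
        simp only [Finset.mem_Icc, Finset.mem_insert]
        omega
      have h2 : (m + 1 : ℤ) ∉ Finset.Icc (-(m : ℤ)) m := by
        simp only [Finset.mem_Icc]
        omega
      have h3 : (-(m + 1 : ℤ)) ≠ 0 := by omega
      have h4 : (m + 1 : ℤ) ≠ 0 := by omega
      have h5 : (m + 1 : ℤ).natAbs = m + 1 := by omega
      rw [hIcc, Finset.sum_insert h1, Finset.sum_insert h2, ih, if_neg h3, if_neg h4,
        Int.natAbs_neg, h5, pow_succ]
      ring
  rw [key]
  have : (0 : ℝ) ≤ (1 / 2) ^ m := by positivity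
  nlinarith

/-- Each vector of the net has product weight at least `lam ^ K * (1/2) ^ m`, while all weights
together sum to at most `(1 + 2 * lam) ^ |ι|`. With `lam` about `s / |ι|` the exponential factor is
only `exp (O(s))`, so no binomial coefficients are needed. -/
theorem card_latticeNet_le {lam : ℝ} (hlam : 0 < lam) (hlam1 : lam ≤ 1) (K m : ℕ) :
    ((latticeNet ι K m).card : ℝ)
      ≤ (lam⁻¹) ^ K * 2 ^ m * Real.exp (2 * (lam * Fintype.card ι)) := by
  classical
  set g : ℤ → ℝ := fun a => (if a = 0 then 1 else lam) * (1 / 2 : ℝ) ^ a.natAbs with hg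
  have hg0 : ∀ a, 0 ≤ g a := fun a => by
    simp only [hg]
    split_ifs <;> positivity
  have hweight : ∀ w ∈ latticeNet ι K m, 1 ≤ (lam⁻¹) ^ K * 2 ^ m * ∏ i, g (w i) := by
    intro w hw
    obtain ⟨-, hK, hm⟩ := Finset.mem_filter.1 hw
    have hprod : ∏ i, g (w i)
        = lam ^ (Finset.univ.filter fun i => w i ≠ 0).card * (1 / 2) ^ (∑ i, (w i).natAbs) := by
      simp only [hg, Finset.prod_mul_distrib, Finset.prod_pow_eq_pow_sum, Finset.prod_ite,
        Finset.prod_const_one, one_mul, Finset.prod_const]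
    rw [hprod]
    calc (1 : ℝ) = (lam⁻¹) ^ K * 2 ^ m * (lam ^ K * (1 / 2) ^ m) := by
          rw [inv_pow, one_div, inv_pow]
          field_simp
      _ ≤ _ := by
          apply mul_le_mul_of_nonneg_left _ (by positivity)
          apply mul_le_mul (pow_le_pow_of_le_one hlam.le hlam1 hK)
            (pow_le_pow_of_le_one (by norm_num) (by norm_num) hm) (by positivity) (by positivity)
  calc ((latticeNet ι K m).card : ℝ) = ∑ w ∈ latticeNet ι K m, (1 : ℝ) := by simp
    _ ≤ ∑ w ∈ latticeNet ι K m, (lam⁻¹) ^ K * 2 ^ m * ∏ i, g (w i) := Finset.sum_le_sum hweight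
    _ ≤ ∑ w ∈ Fintype.piFinset fun _ : ι => Finset.Icc (-(m : ℤ)) m,
          (lam⁻¹) ^ K * 2 ^ m * ∏ i, g (w i) := by
        apply Finset.sum_le_sum_of_subset_of_nonneg (Finset.filter_subset _ _)
        intro w _ _
        have := Finset.prod_nonneg fun i (_ : i ∈ Finset.univ) => hg0 (w i)
        positivity
    _ = (lam⁻¹) ^ K * 2 ^ m * (∑ a ∈ Finset.Icc (-(m : ℤ)) m, g a) ^ Fintype.card ι := by
        rw [← Finset.mul_sum, ← Finset.prod_univ_sum, Finset.prod_const, Finset.card_univ]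
    _ ≤ (lam⁻¹) ^ K * 2 ^ m * Real.exp (2 * lam) ^ Fintype.card ι := by
        gcongr
        · refine (sum_latticeWeight_le hlam.le m).trans ?_
          linarith [Real.add_one_le_exp (2 * lam)]
    _ = _ := by
        rw [← Real.exp_nat_mul]
        congr 2
        ring

/-- Rounding to the lattice, towards zero. -/
theorem exists_mem_latticeNet {K D : ℕ} (hK : 0 < K) (hD : 0 < D) {z : ι → ℝ}
    (hz : IsSparse K z) (hz1 : l2norm z ≤ 1) :
    ∃ w ∈ latticeNet ι K (K * D), ∃ u : ι → ℝ, IsSparse K u ∧ l2norm u ≤ 1 ∧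
      z = (√(K : ℝ) * D)⁻¹ • (fun i => (w i : ℝ)) + (D : ℝ)⁻¹ • u ∧
      l2norm ((√(K : ℝ) * D)⁻¹ • (fun i => (w i : ℝ))) ≤ l2norm z := by
  classical
  have hK' : (0 : ℝ) < K := by exact_mod_cast hK
  have hD' : (0 : ℝ) < D := by exact_mod_cast hD
  have hsK : 0 < √(K : ℝ) := Real.sqrt_pos.2 hK'
  set r := √(K : ℝ) * D with hr
  have hr0 : 0 < r := by positivity
  -- Rounding towards zero keeps the support and does not increase any entry in modulus; the first
  -- gives sparsity of `w` and of the error, the second the bounds on both norms. The mesh `1 / (√K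
  -- D)` makes the `ℓ₂`-error of a `K`-sparse vector at most `1 / D`.
  set w : ι → ℤ := fun i => if 0 ≤ z i then ⌊z i * r⌋ else ⌈z i * r⌉ with hw
  have hw0 : ∀ i, z i = 0 → w i = 0 := by
    intro i hi
    simp [hw, hi]
  have hwabs : ∀ i, |(w i : ℝ)| ≤ |z i| * r ∧ |z i * r - w i| ≤ 1 := by
    intro i
    by_cases hi : 0 ≤ z i
    · have h1 := Int.floor_le (z i * r)
      have h2 := Int.lt_floor_add_one (z i * r)
      have h3 : (0 : ℝ) ≤ ⌊z i * r⌋ := by exact_mod_cast Int.floor_nonneg.2 (by positivity)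
      simp only [hw, hi, if_true]
      rw [abs_of_nonneg h3, abs_of_nonneg hi, abs_le]
      refine ⟨h1, ?_, ?_⟩ <;> linarith
    · have h1 := Int.le_ceil (z i * r)
      have h2 := Int.ceil_lt_add_one (z i * r)
      have h3 : (⌈z i * r⌉ : ℝ) ≤ 0 := by
        have : ⌈z i * r⌉ ≤ 0 := Int.ceil_le.2 (by push_cast; nlinarith)
        exact_mod_cast this
      simp only [hw, hi, if_false]
      rw [abs_of_nonpos h3, abs_of_neg (not_le.1 hi), abs_le]
      refine ⟨?_, ?_, ?_⟩ <;> linarith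
  have hsum : ∑ i, (w i).natAbs ≤ K * D := by
    have h1 : ((∑ i, (w i).natAbs : ℕ) : ℝ) ≤ (K * D : ℕ) := by
      push_cast
      calc ∑ i, ((w i).natAbs : ℝ) = ∑ i, |(w i : ℝ)| := by simp [Nat.cast_natAbs]
        _ ≤ ∑ i, |z i| * r := Finset.sum_le_sum fun i _ => (hwabs i).1
        _ = l1norm z * r := by rw [l1norm, Finset.sum_mul]
        _ ≤ (√(K : ℝ) * 1) * r := by
            have := hz.l1norm_le
            gcongr
            exact this.trans (by gcongr)
        _ = (√(K : ℝ) * √(K : ℝ)) * D := by rw [hr]; ring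
        _ = K * D := by rw [Real.mul_self_sqrt hK'.le]
    exact_mod_cast h1
  obtain ⟨T, hT, hzT⟩ := hz
  refine ⟨w, ?_, fun i => D * (z i - r⁻¹ * w i), ⟨T, hT, fun i hi => ?_⟩, ?_, ?_, ?_⟩
  · refine Finset.mem_filter.2 ⟨?_, ?_, hsum⟩
    · rw [Fintype.mem_piFinset]
      intro i
      have h1 := Finset.single_le_sum (f := fun i => (w i).natAbs) (fun _ _ => Nat.zero_le _)
        (Finset.mem_univ i)
      rw [Finset.mem_Icc]
      omega
    · refine le_trans (Finset.card_le_card ?_) hT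
      intro i hi
      by_contra hiT
      exact (Finset.mem_filter.1 hi).2 (hw0 i (hzT i hiT))
  · simp [hzT i hi, hw0 i (hzT i hi)]
  · have hsp : IsSparse K fun i => (D : ℝ) * (z i - r⁻¹ * w i) :=
      ⟨T, hT, fun i hi => by simp [hzT i hi, hw0 i (hzT i hi)]⟩
    refine (hsp.l2norm_le (M := (√(K : ℝ))⁻¹) (by positivity) fun i => ?_).trans ?_
    · have h1 : (D : ℝ) * (z i - r⁻¹ * w i) = (√(K : ℝ))⁻¹ * (z i * r - w i) := by
        rw [hr]; field_simp
      rw [h1, abs_mul, abs_of_pos (inv_pos.2 hsK)]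
      have := (hwabs i).2
      have := inv_pos.2 hsK
      nlinarith
    · rw [mul_inv_cancel₀ hsK.ne']
  · ext i
    simp only [Pi.add_apply, Pi.smul_apply, smul_eq_mul]
    field_simp
    ring
  · apply l2norm_le_of_abs_le
    intro i
    simp only [Pi.smul_apply, smul_eq_mul]
    rw [abs_mul, abs_of_pos (inv_pos.2 hr0), inv_mul_le_iff₀ hr0, mul_comm]
    exact (hwabs i).1

/-- Self-improvement: if `M` is the supremum of `p` over sparse unit vectors, rounding gives `M ≤ b
+ M / D ≤ b + M / 2`, because the rounding error is again sparse. The crude bound `hcrude` makes `M`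
finite. -/
theorem le_of_le_on_latticeNet {p : (ι → ℝ) → ℝ} (hadd : ∀ x y, p (x + y) ≤ p x + p y)
    (hhom : ∀ (c : ℝ) x, p (c • x) = |c| * p x) (hcrude : ∀ x, p x ≤ l1norm x)
    {K D : ℕ} (hK : 0 < K) (hD : 2 ≤ D) {b : ℝ} (hb : 0 ≤ b)
    (hp : ∀ w ∈ latticeNet ι K (K * D), p (fun i => (w i : ℝ)) ≤ b * l2norm fun i => (w i : ℝ))
    {x : ι → ℝ} (hx : IsSparse K x) : p x ≤ 2 * b * l2norm x := by
  have hD' : (2 : ℝ) ≤ D := by exact_mod_cast hD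
  set A : Set ℝ := {t | ∃ z, IsSparse K z ∧ l2norm z ≤ 1 ∧ p z = t} with hA
  have hbdd : BddAbove A := by
    refine ⟨√(K : ℝ) * 1, ?_⟩
    rintro _ ⟨z, hz, hz1, rfl⟩
    refine (hcrude z).trans (hz.l1norm_le.trans ?_)
    gcongr
  have hp0 : p 0 = 0 := by simpa using hhom 0 0
  have hne : A.Nonempty := ⟨0, 0, ⟨∅, by simp, by simp⟩, by simp [l2norm], hp0⟩
  have hM0 : 0 ≤ sSup A := le_csSup hbdd ⟨0, ⟨∅, by simp, by simp⟩, by simp [l2norm], hp0⟩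
  have hM : sSup A ≤ b + sSup A / 2 := by
    apply csSup_le hne
    rintro _ ⟨z, hz, hz1, rfl⟩
    obtain ⟨w, hw, u, hu, hu1, hzeq, hle⟩ := exists_mem_latticeNet hK (by omega : 0 < D) hz hz1
    have h1 : p u ≤ sSup A := le_csSup hbdd ⟨u, hu, hu1, rfl⟩
    have h2 : p ((√(K : ℝ) * D)⁻¹ • fun i => (w i : ℝ)) ≤ b := by
      rw [hhom]
      refine (mul_le_mul_of_nonneg_left (hp w hw) (abs_nonneg _)).trans ?_
      rw [mul_left_comm, ← l2norm_smul]
      calc _ ≤ b * 1 := by gcongr; exact hle.trans hz1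
        _ = b := mul_one b
    have h3 : p ((D : ℝ)⁻¹ • u) ≤ sSup A / 2 := by
      rw [hhom, abs_of_pos (by positivity), inv_mul_le_iff₀ (by linarith)]
      nlinarith
    calc p z ≤ _ := by rw [hzeq]; exact hadd _ _
      _ ≤ _ := add_le_add h2 h3
  rcases (l2norm_nonneg x).eq_or_lt with h0 | h0
  · have hx0 : x = 0 := by
      ext i
      have := abs_le_l2norm x i
      rw [← h0] at this
      exact abs_nonpos_iff.1 this
    rw [hx0, hp0]
    have := l2norm_nonneg (0 : ι → ℝ)
    positivity
  · have h1 : p ((l2norm x)⁻¹ • x) ≤ sSup A := by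
      refine le_csSup hbdd ⟨_, hx.smul _, ?_, rfl⟩
      rw [l2norm_smul, abs_of_pos (inv_pos.2 h0), inv_mul_cancel₀ h0.ne']
    rw [hhom, abs_of_pos (inv_pos.2 h0), inv_mul_le_iff₀ h0] at h1
    nlinarith

/-- Rounding a unit vector loses `1 / D` in `ℓ₂`-norm, which costs `a / D`, and changes `p` by at
most `b / D` by the upper bound on sparse vectors. -/
theorem ge_of_ge_on_latticeNet {p : (ι → ℝ) → ℝ} (hadd : ∀ x y, p (x + y) ≤ p x + p y)
    (hhom : ∀ (c : ℝ) x, p (c • x) = |c| * p x) {K D : ℕ} (hK : 0 < K) (hD : 0 < D)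
    {a b : ℝ} (ha : 0 ≤ a) (hb : 0 ≤ b) (hupp : ∀ x, IsSparse K x → p x ≤ b * l2norm x)
    (hp : ∀ w ∈ latticeNet ι K (K * D), a * l2norm (fun i => (w i : ℝ)) ≤ p fun i => (w i : ℝ))
    {x : ι → ℝ} (hx : IsSparse K x) : (a - (a + b) / D) * l2norm x ≤ p x := by
  have hD' : (0 : ℝ) < D := by exact_mod_cast hD
  have hunit : ∀ z : ι → ℝ, IsSparse K z → l2norm z = 1 → a - (a + b) / D ≤ p z := by
    intro z hz hz1
    obtain ⟨w, hw, u, hu, hu1, hzeq, -⟩ := exists_mem_latticeNet hK hD hz hz1.le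
    set c := (√(K : ℝ) * D)⁻¹
    set wr : ι → ℝ := fun i => (w i : ℝ)
    have h1 : p ((-(D : ℝ)⁻¹) • u) ≤ b / D := by
      rw [hhom, abs_neg, abs_of_pos (inv_pos.2 hD'), inv_mul_le_iff₀ hD']
      calc p u ≤ b * l2norm u := hupp u hu
        _ ≤ b * 1 := by gcongr
        _ = D * (b / D) := by field_simp
    have h2 : c • wr = z + (-(D : ℝ)⁻¹) • u := by
      rw [hzeq]; simp
    have h3 : a * l2norm (c • wr) ≤ p (c • wr) := by
      rw [hhom, l2norm_smul, mul_left_comm]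
      exact mul_le_mul_of_nonneg_left (hp w hw) (abs_nonneg _)
    have h4 : 1 - (D : ℝ)⁻¹ ≤ l2norm (c • wr) := by
      have h5 : l2norm z ≤ l2norm (c • wr) + l2norm ((D : ℝ)⁻¹ • u) := by
        rw [hzeq]; exact l2norm_add_le _ _
      rw [l2norm_smul (D : ℝ)⁻¹, abs_of_pos (inv_pos.2 hD'), hz1] at h5
      have : (D : ℝ)⁻¹ * l2norm u ≤ (D : ℝ)⁻¹ * 1 := by gcongr
      linarith
    have h6 : p (c • wr) ≤ p z + b / D := by
      rw [h2]
      exact (hadd _ _).trans (by linarith)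
    have h7 : a * (1 - (D : ℝ)⁻¹) ≤ a * l2norm (c • wr) := by gcongr
    have h8 : a - (a + b) / D = a * (1 - (D : ℝ)⁻¹) - b / D := by field_simp; ring
    linarith
  rcases (l2norm_nonneg x).eq_or_lt with h0 | h0
  · have hp0 : p 0 = 0 := by simpa using hhom 0 0
    have hx0 : x = 0 := by
      ext i
      have := abs_le_l2norm x i
      rw [← h0] at this
      exact abs_nonpos_iff.1 this
    rw [← h0, mul_zero, hx0, hp0]
  · have h1 := hunit ((l2norm x)⁻¹ • x) (hx.smul _) (by
      rw [l2norm_smul, abs_of_pos (inv_pos.2 h0), inv_mul_cancel₀ h0.ne'])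
    rw [hhom, abs_of_pos (inv_pos.2 h0), le_inv_mul_iff₀ h0] at h1
    linarith

end Net

/-! ### Random matrices with independent subexponential rows -/

theorem l1norm_mulVec_le {ι : Type} [Fintype ι] {n : ℕ} {B : Matrix (Fin n) ι ℝ}
    (hB : ∀ i j, |B i j| ≤ 1) (x : ι → ℝ) : l1norm (B *ᵥ x) ≤ n * l1norm x := by
  calc l1norm (B *ᵥ x) ≤ ∑ _i : Fin n, l1norm x := by
        refine Finset.sum_le_sum fun i _ => ?_
        refine (Finset.abs_sum_le_sum_abs _ _).trans (Finset.sum_le_sum fun j _ => ?_)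
        rw [abs_mul]
        nlinarith [hB i j, abs_nonneg (x j)]
    _ = n * l1norm x := by simp

section Rows

variable {Ω : Type} [Finite Ω] [MeasurableSpace Ω] [MeasurableSingletonClass Ω]
  {μ : Measure Ω} [IsProbabilityMeasure μ]

/-- Chernoff's bound for independent copies, with the free parameter absorbed into `g`. -/
theorem measureReal_le_sum_le (g : Ω → ℝ) (t : ℝ) (n : ℕ) :
    (Measure.pi fun _ : Fin n => μ).real {ω | t ≤ ∑ i, g (ω i)}
      ≤ Real.exp (-t) * (∫ x, Real.exp (g x) ∂μ) ^ n := by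
  have h1 := mul_meas_ge_le_integral_of_nonneg (μ := Measure.pi fun _ : Fin n => μ)
    (f := fun ω => Real.exp (∑ i, g (ω i))) (ae_of_all _ fun _ => (Real.exp_pos _).le)
    Integrable.of_finite (Real.exp t)
  have h2 : ∫ ω, Real.exp (∑ i, g (ω i)) ∂(Measure.pi fun _ : Fin n => μ)
      = (∫ x, Real.exp (g x) ∂μ) ^ n := by
    simp only [Real.exp_sum]
    rw [integral_fintype_prod_eq_pow (ι := Fin n) (fun x => Real.exp (g x)), Fintype.card_fin]
  simp only [Real.exp_le_exp] at h1
  rw [h2] at h1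
  rw [Real.exp_neg, le_inv_mul_iff₀ (Real.exp_pos t)]
  exact h1

/-- An isotropic random vector with entries bounded by `1` and subexponential marginals. -/
structure IsSubexpRow {ι : Type} [Fintype ι] (μ : Measure Ω) (X : Ω → ι → ℝ) : Prop where
  abs_le_one : ∀ ω j, |X ω j| ≤ 1
  second_moment : ∀ v : ι → ℝ, ∫ ω, (∑ j, X ω j * v j) ^ 2 ∂μ = ∑ j, v j ^ 2
  exp_moment : ∀ v : ι → ℝ, ∑ j, v j ^ 2 = 1 → ∫ ω, Real.exp (|∑ j, X ω j * v j| / 8) ∂μ ≤ 4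

/-- The matrix whose rows are the samples of a random vector. -/
def sampleMatrix {ι : Type} {n : ℕ} (X : Ω → ι → ℝ) (ω : Fin n → Ω) : Matrix (Fin n) ι ℝ :=
  Matrix.of fun i j => X (ω i) j

variable {ι : Type} [Fintype ι] {X : Ω → ι → ℝ}

/-- Follows from `(1 - x + x²/2)(1 + x + x²/2) = 1 + x⁴/4 ≥ 1` and the quadratic lower bound for
`exp x`. -/
theorem exp_neg_le_quadratic {x : ℝ} (hx : 0 ≤ x) : Real.exp (-x) ≤ 1 - x + x ^ 2 / 2 := by
  have h1 := Real.quadratic_le_exp_of_nonneg hx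
  have h2 : 0 < Real.exp (-x) := Real.exp_pos _
  have h3 : Real.exp (-x) * Real.exp x = 1 := by rw [← Real.exp_add]; simp
  have h4 : 0 < 1 - x + x ^ 2 / 2 := by nlinarith [sq_nonneg (x - 1)]
  have h5 : 1 ≤ (1 - x + x ^ 2 / 2) * (1 + x + x ^ 2 / 2) := by nlinarith [sq_nonneg (x ^ 2)]
  nlinarith

/-- The fourth moment bound implied by `IsSubexpRow.exp_moment` and the second moment bound the
first absolute moment from below. -/
theorem IsSubexpRow.abs_moment_ge (hX : IsSubexpRow μ X) {v : ι → ℝ} (hv : ∑ j, v j ^ 2 = 1) :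
    1 / 2048 ≤ ∫ ω, |∑ j, X ω j * v j| ∂μ := by
  set Y : Ω → ℝ := fun ω => ∑ j, X ω j * v j with hY
  have h4 : ∫ ω, Y ω ^ 4 ∂μ ≤ 393216 := by
    -- `98304 = 4! * 8 ^ 4`, from `x⁴ / 4! ≤ exp x` at `x = |Y| / 8`.
    have hpt : ∀ ω, Y ω ^ 4 ≤ 98304 * Real.exp (|Y ω| / 8) := by
      intro ω
      have h1 := Real.pow_div_factorial_le_exp (|Y ω| / 8) (by positivity) 4
      have h2 : (Nat.factorial 4 : ℝ) = 24 := by norm_num [Nat.factorial]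
      rw [h2, div_pow] at h1
      have h3 : |Y ω| ^ 4 = Y ω ^ 4 := by rw [← abs_pow, abs_of_nonneg (by positivity)]
      rw [h3] at h1
      linarith
    calc ∫ ω, Y ω ^ 4 ∂μ ≤ ∫ ω, 98304 * Real.exp (|Y ω| / 8) ∂μ :=
          integral_mono Integrable.of_finite Integrable.of_finite hpt
      _ = 98304 * ∫ ω, Real.exp (|Y ω| / 8) ∂μ := integral_const_mul _ _
      _ ≤ 98304 * 4 := by
          have := hX.exp_moment v hv
          gcongr
      _ = 393216 := by norm_num
  have h2 : ∫ ω, Y ω ^ 2 ∂μ = 1 := (hX.second_moment v).trans hv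
  -- This is `u² ≤ u + u⁴` at `u = |Y| / 1024`. The scale is large enough that the fourth moment
  -- eats less than half of the second-moment term.
  have hpt : ∀ ω, Y ω ^ 2 * (1 / 1024) - Y ω ^ 4 * (1 / 1024 ^ 3) ≤ |Y ω| := by
    intro ω
    set u := |Y ω| / 1024 with hu
    have hu0 : 0 ≤ u := by positivity
    have h3 : |Y ω| = 1024 * u := by rw [hu]; ring
    have h4 : Y ω ^ 2 = (1024 * u) ^ 2 := by rw [← h3, sq_abs]
    have h5 : Y ω ^ 4 = (1024 * u) ^ 4 := by
      rw [← h3, ← abs_pow, abs_of_nonneg (by positivity)]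
    rw [h3, h4, h5]
    have h6 : u ^ 2 ≤ u + u ^ 4 := by
      rcases le_total u 1 with h | h
      · nlinarith [pow_nonneg hu0 4]
      · nlinarith [pow_le_pow_right₀ h (show 2 ≤ 4 by norm_num)]
    nlinarith
  calc (1 : ℝ) / 2048 ≤ 1 * (1 / 1024) - 393216 * (1 / 1024 ^ 3) := by norm_num
    _ ≤ (∫ ω, Y ω ^ 2 ∂μ) * (1 / 1024) - (∫ ω, Y ω ^ 4 ∂μ) * (1 / 1024 ^ 3) := by
        rw [h2]; gcongr
    _ = ∫ ω, (Y ω ^ 2 * (1 / 1024) - Y ω ^ 4 * (1 / 1024 ^ 3)) ∂μ := by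
        rw [integral_sub Integrable.of_finite Integrable.of_finite, integral_mul_const,
          integral_mul_const]
    _ ≤ ∫ ω, |Y ω| ∂μ := integral_mono Integrable.of_finite Integrable.of_finite hpt

/-- Chernoff's bound with parameter `-1/4096`. The Laplace transform is at most `1 - 2/4096² + 1/(2
* 4096²) = 1 - 3/2^25`, and passing to the level `n / 4096` costs `2n / 2^25` in the exponent, so `n
/ 2^25` survives. -/
theorem IsSubexpRow.measureReal_lower_le (hX : IsSubexpRow μ X) {v : ι → ℝ}
    (hv : ∑ j, v j ^ 2 = 1) (n : ℕ) :
    (Measure.pi fun _ : Fin n => μ).real {ω | ∑ i, |∑ j, X (ω i) j * v j| ≤ n / 4096}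
      ≤ Real.exp (-(n / 2 ^ 25)) := by
  set Y : Ω → ℝ := fun ω => ∑ j, X ω j * v j with hY
  have h1 := measureReal_le_sum_le (μ := μ) (fun ω => -(|Y ω| / 4096)) (-(n / 4096 ^ 2)) n
  have hset : {ω : Fin n → Ω | ∑ i, |Y (ω i)| ≤ n / 4096}
      = {ω | -(n / 4096 ^ 2 : ℝ) ≤ ∑ i, -(|Y (ω i)| / 4096)} := by
    ext ω
    simp only [Set.mem_ofPred_eq, Finset.sum_neg_distrib, ← Finset.sum_div, neg_le_neg_iff]
    constructor <;> intro h <;> linarith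
  have hint : ∫ ω, Real.exp (-(|Y ω| / 4096)) ∂μ ≤ Real.exp (-(3 / 2 ^ 25)) := by
    have h2 : ∫ ω, Y ω ^ 2 ∂μ = 1 := (hX.second_moment v).trans hv
    have h3 := hX.abs_moment_ge hv
    calc ∫ ω, Real.exp (-(|Y ω| / 4096)) ∂μ
        ≤ ∫ ω, (1 - |Y ω| * (1 / 4096) + Y ω ^ 2 * (1 / (2 * 4096 ^ 2))) ∂μ := by
          refine integral_mono Integrable.of_finite Integrable.of_finite fun ω => ?_
          refine (exp_neg_le_quadratic (by positivity)).trans (le_of_eq ?_)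
          rw [div_pow, sq_abs]
          ring
      _ = 1 - (∫ ω, |Y ω| ∂μ) * (1 / 4096) + (∫ ω, Y ω ^ 2 ∂μ) * (1 / (2 * 4096 ^ 2)) := by
          rw [integral_add Integrable.of_finite Integrable.of_finite,
            integral_sub Integrable.of_finite Integrable.of_finite, integral_mul_const,
            integral_mul_const]
          simp
      _ ≤ -(3 / 2 ^ 25) + 1 := by rw [h2]; norm_num at h3 ⊢; linarith
      _ ≤ _ := Real.add_one_le_exp _
  rw [hset]
  refine h1.trans ?_
  calc Real.exp (-(-(n / 4096 ^ 2 : ℝ))) * (∫ ω, Real.exp (-(|Y ω| / 4096)) ∂μ) ^ n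
      ≤ Real.exp (-(-(n / 4096 ^ 2 : ℝ))) * (Real.exp (-(3 / 2 ^ 25))) ^ n := by
        gcongr
    _ = Real.exp (-(n / 2 ^ 25)) := by
        rw [← Real.exp_nat_mul, ← Real.exp_add]
        congr 1
        ring

/-- The level `24 n` is `3 n` for `|Y| / 8`, whose exponential moment is at most `4 ≤ e²`. The
resulting `exp (-n)` is weakened to match the lower tail. -/
theorem IsSubexpRow.measureReal_upper_le (hX : IsSubexpRow μ X) {v : ι → ℝ}
    (hv : ∑ j, v j ^ 2 = 1) (n : ℕ) :
    (Measure.pi fun _ : Fin n => μ).real {ω | 24 * n ≤ ∑ i, |∑ j, X (ω i) j * v j|}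
      ≤ Real.exp (-(n / 2 ^ 25)) := by
  set Y : Ω → ℝ := fun ω => ∑ j, X ω j * v j with hY
  have h1 := measureReal_le_sum_le (μ := μ) (fun ω => |Y ω| / 8) (3 * n) n
  have hset : {ω : Fin n → Ω | 24 * (n : ℝ) ≤ ∑ i, |Y (ω i)|}
      = {ω | 3 * (n : ℝ) ≤ ∑ i, |Y (ω i)| / 8} := by
    ext ω
    simp only [Set.mem_ofPred_eq, ← Finset.sum_div]
    constructor <;> intro h <;> linarith
  have h4 : (4 : ℝ) ≤ Real.exp 2 := by
    have h5 : (2 : ℝ) ≤ Real.exp 1 := by linarith [Real.add_one_le_exp (1 : ℝ)]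
    have h6 : Real.exp 2 = Real.exp 1 * Real.exp 1 := by rw [← Real.exp_add]; norm_num
    nlinarith
  rw [hset]
  refine h1.trans ?_
  calc Real.exp (-(3 * n)) * (∫ ω, Real.exp (|Y ω| / 8) ∂μ) ^ n
      ≤ Real.exp (-(3 * n)) * Real.exp 2 ^ n := by
        gcongr
        exact (hX.exp_moment v hv).trans h4
    _ = Real.exp (-n) := by
        rw [← Real.exp_nat_mul, ← Real.exp_add]
        congr 1
        ring
    _ ≤ _ := by
        apply Real.exp_le_exp.2
        have : (0 : ℝ) ≤ n := Nat.cast_nonneg n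
        have := div_le_self this (show (1 : ℝ) ≤ 2 ^ 25 by norm_num)
        linarith

theorem IsSubexpRow.measureReal_not_isometric_le (hX : IsSubexpRow μ X) (v : ι → ℝ) (n : ℕ) :
    (Measure.pi fun _ : Fin n => μ).real {ω |
      ¬ (n / 4096 * l2norm v ≤ l1norm (sampleMatrix X ω *ᵥ v) ∧
        l1norm (sampleMatrix X ω *ᵥ v) ≤ 24 * n * l2norm v)}
      ≤ 2 * Real.exp (-(n / 2 ^ 25)) := by
  rcases (l2norm_nonneg v).eq_or_lt with h0 | h0
  · have hv0 : v = 0 := by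
      ext i
      have := abs_le_l2norm v i
      rw [← h0] at this
      exact abs_nonpos_iff.1 this
    subst hv0
    simp only [← h0, Matrix.mulVec_zero]
    simp only [l1norm, Pi.zero_apply, abs_zero, Finset.sum_const_zero, mul_zero, le_refl, and_self,
      not_true_eq_false, Set.ofPred_false, measureReal_empty]
    positivity
  · set u : ι → ℝ := (l2norm v)⁻¹ • v with hu
    have hu1 : ∑ j, u j ^ 2 = 1 := by
      rw [← l2norm_sq, hu, l2norm_smul, abs_of_pos (inv_pos.2 h0), inv_mul_cancel₀ h0.ne', one_pow]
    have hvu : v = l2norm v • u := by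
      rw [hu, smul_smul, mul_inv_cancel₀ h0.ne', one_smul]
    have hl1 : ∀ ω : Fin n → Ω, l1norm (sampleMatrix X ω *ᵥ v)
        = l2norm v * ∑ i, |∑ j, X (ω i) j * u j| := by
      intro ω
      conv_lhs => rw [hvu, Matrix.mulVec_smul, l1norm_smul, abs_of_pos h0]
      rfl
    have hsub : {ω : Fin n → Ω | ¬ (n / 4096 * l2norm v ≤ l1norm (sampleMatrix X ω *ᵥ v) ∧
        l1norm (sampleMatrix X ω *ᵥ v) ≤ 24 * n * l2norm v)}
        ⊆ {ω | ∑ i, |∑ j, X (ω i) j * u j| ≤ n / 4096}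
          ∪ {ω | 24 * (n : ℝ) ≤ ∑ i, |∑ j, X (ω i) j * u j|} := by
      intro ω hω
      by_contra hcon
      simp only [Set.mem_union, Set.mem_ofPred_eq, not_or, not_le] at hcon
      apply hω
      rw [hl1]
      constructor <;> nlinarith [hcon.1, hcon.2]
    calc _ ≤ _ := measureReal_mono hsub
      _ ≤ _ := measureReal_union_le _ _
      _ ≤ _ := add_le_add (hX.measureReal_lower_le hu1 n) (hX.measureReal_upper_le hu1 n)
      _ = _ := by ring

/-- Up to an exponentially small probability, `ℓ₁`-minimization with a random matrix with
subexponential rows is stable for vectors supported in `S`. -/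
theorem IsSubexpRow.measureReal_cone_le (hX : IsSubexpRow μ X) (S : Finset ι)
    (hS : S.Nonempty) {lam : ℝ} (hlam : 0 < lam) (hlam1 : lam ≤ 1)
    (hcard : lam * Fintype.card ι ≤ S.card) {n : ℕ}
    (hn : 2 ^ 89 * (S.card * (1 + Real.log lam⁻¹)) ≤ (n : ℝ)) :
    (Measure.pi fun _ : Fin n => μ).real {ω | ∃ h : ι → ℝ,
      l1norm h / 2 ≤ ∑ i ∈ S, |h i| ∧
        ∃ i, 2 ^ 14 * l1norm (sampleMatrix X ω *ᵥ h) < n * |h i|}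
      ≤ Real.exp (-(n / 2 ^ 26)) := by
  classical
  set s := S.card with hs
  have hs1 : (1 : ℝ) ≤ s := by exact_mod_cast Finset.card_pos.2 hS
  have hlog : 0 ≤ Real.log lam⁻¹ := Real.log_nonneg ((one_le_inv₀ hlam).2 hlam1)
  have hn0 : (0 : ℝ) < n := by
    refine lt_of_lt_of_le ?_ hn
    positivity
  -- The sparse bounds below are `a = 2 ^ (-13)` and `b = 48`, so `abs_le_of_mem_cone` needs `96 √s
  -- ≤ 2 ^ (-14) √k`; here the right side is `128 √s`.
  set k := 2 ^ 42 * s with hk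
  set K := k + s with hK
  have hK0 : 0 < K := by
    have := Finset.card_pos.2 hS
    omega
  set N := latticeNet ι K (K * 2 ^ 20) with hN
  set bad : (ι → ℤ) → Set (Fin n → Ω) := fun w => {ω |
      ¬ (n / 4096 * l2norm (fun i => (w i : ℝ)) ≤ l1norm (sampleMatrix X ω *ᵥ fun i => (w i : ℝ)) ∧
        l1norm (sampleMatrix X ω *ᵥ fun i => (w i : ℝ)) ≤ 24 * n * l2norm (fun i => (w i : ℝ)))}
    with hbad
  have hsub : {ω : Fin n → Ω | ∃ h : ι → ℝ, l1norm h / 2 ≤ ∑ i ∈ S, |h i| ∧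
        ∃ i, 2 ^ 14 * l1norm (sampleMatrix X ω *ᵥ h) < n * |h i|} ⊆ ⋃ w ∈ N, bad w := by
    intro ω hω
    by_contra hcon
    simp only [Set.mem_iUnion, not_exists, hbad, Set.mem_ofPred_eq, not_not] at hcon
    obtain ⟨h, hcone, i, hi⟩ := hω
    set p : (ι → ℝ) → ℝ := fun x => (n : ℝ)⁻¹ * l1norm (sampleMatrix X ω *ᵥ x) with hp
    have hadd : ∀ x y, p (x + y) ≤ p x + p y := by
      intro x y
      simp only [hp]
      rw [Matrix.mulVec_add, ← mul_add]
      gcongr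
      exact l1norm_add_le _ _
    have hhom : ∀ (c : ℝ) x, p (c • x) = |c| * p x := by
      intro c x
      simp only [hp]
      rw [Matrix.mulVec_smul, l1norm_smul]
      ring
    have hneg : ∀ x, p (-x) = p x := by
      intro x
      simpa using hhom (-1) x
    have hcrude : ∀ x, p x ≤ l1norm x := by
      intro x
      simp only [hp]
      rw [inv_mul_le_iff₀ hn0]
      exact l1norm_mulVec_le (fun i j => hX.abs_le_one (ω i) j) x
    have hupp : ∀ x, IsSparse K x → p x ≤ 48 * l2norm x := by
      intro x hx
      have := le_of_le_on_latticeNet hadd hhom hcrude hK0 (D := 2 ^ 20) (by norm_num) (b := 24)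
        (by norm_num) (by
          intro w hw
          have := (hcon w hw).2
          simp only [hp]
          rw [inv_mul_le_iff₀ hn0]
          linarith) hx
      linarith
    have hlow : ∀ x, IsSparse K x → 1 / 2 ^ 13 * l2norm x ≤ p x := by
      intro x hx
      -- The mesh parameter `2 ^ 20` makes the loss `(a + b) / D` at most half of `a = 1/4096`.
      have h1 := ge_of_ge_on_latticeNet hadd hhom hK0 (D := 2 ^ 20) (by norm_num) (a := 1 / 4096)
        (b := 48) (by norm_num) (by norm_num) hupp (by
          intro w hw
          have := (hcon w hw).1
          simp only [hp]
          rw [le_inv_mul_iff₀ hn0]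
          linarith) hx
      refine le_trans ?_ h1
      have := l2norm_nonneg x
      gcongr
      norm_num
    have hfin := abs_le_of_mem_cone hadd hneg (a := 1 / 2 ^ 13) (b := 48) (by norm_num)
      (by norm_num) S hS (k := k) (by rw [hk]; omega) (by
        have hk2 : (k : ℝ) = (2 ^ 21) ^ 2 * s := by
          rw [hk]
          push_cast
          ring
        rw [hk2, Real.sqrt_mul (by norm_num), Real.sqrt_sq (by norm_num), ← hs]
        have := Real.sqrt_nonneg (s : ℝ)
        linarith) (fun x hx => hlow x hx)
      (fun x hx => hupp x (by
        obtain ⟨T, hT, hx⟩ := hx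
        exact ⟨T, hT.trans (by omega), hx⟩)) h (by
        have h1 : l1norm h = ∑ i ∈ S, |h i| + ∑ i ∈ Sᶜ, |h i| :=
          (Finset.sum_add_sum_compl S _).symm
        linarith) i
    simp only [hp] at hfin
    rw [le_inv_mul_iff₀ hn0] at hfin
    linarith
  -- Half of the exponent `n / 2^25` pays for the union bound. The dominant term `K * 2^20` is about
  -- `2^62 s`; multiplying by `2^26` stays below the `2^89 s` of `hn`.
  have hlogcard : 2 * ((lam⁻¹) ^ K * 2 ^ (K * 2 ^ 20) * Real.exp (2 * (lam * Fintype.card ι)))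
      ≤ Real.exp (n / 2 ^ 26) := by
    have h2 : (2 : ℝ) ≤ Real.exp 1 := by linarith [Real.add_one_le_exp (1 : ℝ)]
    have hl : (lam⁻¹) ^ K = Real.exp (K * Real.log lam⁻¹) := by
      rw [Real.exp_nat_mul, Real.exp_log (inv_pos.2 hlam)]
    have h3 : (2 : ℝ) ^ (K * 2 ^ 20) ≤ Real.exp (K * 2 ^ 20) := by
      calc (2 : ℝ) ^ (K * 2 ^ 20) ≤ Real.exp 1 ^ (K * 2 ^ 20) := by gcongr
        _ = _ := by
          rw [← Real.exp_nat_mul, mul_one]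
          norm_num
    have h4 : Real.exp (2 * (lam * Fintype.card ι)) ≤ Real.exp (2 * s) := by gcongr
    calc _ ≤ Real.exp 1 * (Real.exp (K * Real.log lam⁻¹) * Real.exp (K * 2 ^ 20)
          * Real.exp (2 * s)) := by rw [hl]; gcongr
      _ = Real.exp (1 + (K * Real.log lam⁻¹ + K * 2 ^ 20 + 2 * s)) := by
          rw [Real.exp_add, Real.exp_add, Real.exp_add]
      _ ≤ _ := by
          apply Real.exp_le_exp.2
          rw [le_div_iff₀ (by norm_num)]
          refine le_trans ?_ hn
          have h5 : (K : ℝ) = (2 ^ 42 + 1) * s := by rw [hK, hk]; push_cast; ring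
          rw [h5]
          have h6 : 0 ≤ (s : ℝ) * Real.log lam⁻¹ := by positivity
          linarith
  calc _ ≤ (Measure.pi fun _ : Fin n => μ).real (⋃ w ∈ N, bad w) := measureReal_mono hsub (measure_ne_top _ _)
    _ ≤ ∑ w ∈ N, (Measure.pi fun _ : Fin n => μ).real (bad w) := measureReal_biUnion_finset_le _ _
    _ ≤ ∑ w ∈ N, 2 * Real.exp (-(n / 2 ^ 25)) :=
        Finset.sum_le_sum fun w _ => hX.measureReal_not_isometric_le _ n
    _ = (2 * (N.card : ℝ)) * Real.exp (-(n / 2 ^ 25)) := by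
        rw [Finset.sum_const, nsmul_eq_mul]; ring
    _ ≤ Real.exp (n / 2 ^ 26) * Real.exp (-(n / 2 ^ 25)) := by
        gcongr
        refine le_trans ?_ hlogcard
        gcongr
        exact card_latticeNet_le hlam hlam1 K (K * 2 ^ 20)
    _ = Real.exp (-(n / 2 ^ 26)) := by
        rw [← Real.exp_add]
        congr 1
        ring

end Rows

/-! ### Gaussian integrals -/

theorem integral_exp_mul_sq_gaussianReal {t : ℝ} (ht : t < 1 / 2) :
    ∫ x, Real.exp (t * x ^ 2) ∂(gaussianReal 0 1) = (√(1 - 2 * t))⁻¹ := by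
  rw [integral_gaussianReal_eq_integral_smul one_ne_zero]
  have h1 : ∀ x : ℝ, gaussianPDFReal 0 1 x • Real.exp (t * x ^ 2)
      = (√(2 * Real.pi))⁻¹ * Real.exp (-(1 / 2 - t) * x ^ 2) := by
    intro x
    rw [gaussianPDFReal, smul_eq_mul, mul_assoc, ← Real.exp_add]
    simp only [NNReal.coe_one, mul_one, sub_zero]
    congr 2
    ring
  simp only [h1]
  rw [integral_const_mul, integral_gaussian, ← Real.sqrt_inv, ← Real.sqrt_inv,
    ← Real.sqrt_mul (by positivity)]
  congr 1
  have : 1 / 2 - t ≠ 0 := by linarith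
  have : 1 - 2 * t ≠ 0 := by linarith
  field_simp

theorem integrable_exp_mul_sq_gaussianReal {t : ℝ} (ht : t < 1 / 2) :
    Integrable (fun x => Real.exp (t * x ^ 2)) (gaussianReal 0 1) := by
  -- The integral of a non-integrable function is `0` by convention, so the nonzero closed formula
  -- already proves integrability.
  apply Integrable.of_integral_ne_zero
  rw [integral_exp_mul_sq_gaussianReal ht]
  have : 0 < √(1 - 2 * t) := Real.sqrt_pos.2 (by linarith)
  positivity

theorem integral_exp_mul_gaussianReal (t : ℝ) :
    ∫ x, Real.exp (t * x) ∂(gaussianReal 0 1) = Real.exp (t ^ 2 / 2) := by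
  have := mgf_gaussianReal (p := gaussianReal 0 1) (X := id) (μ := 0) (v := 1) (by simp) t
  simpa [mgf] using this

theorem integrable_exp_mul_gaussianReal (t : ℝ) :
    Integrable (fun x => Real.exp (t * x)) (gaussianReal 0 1) := by
  apply Integrable.of_integral_ne_zero
  rw [integral_exp_mul_gaussianReal]
  positivity

/-! ### Rademacher sums -/

instance : IsProbabilityMeasure coin := by
  unfold coin
  infer_instance

theorem sgn_true : sgn true = 1 := rfl

theorem sgn_false : sgn false = -1 := rfl

theorem sgn_sq (b : Bool) : sgn b ^ 2 = 1 := by cases b <;> simp [sgn]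

theorem abs_sgn (b : Bool) : |sgn b| = 1 := by cases b <;> simp [sgn]

theorem sgn_beq (b c : Bool) : sgn (b == c) = sgn b * sgn c := by
  cases b <;> cases c <;> simp [sgn]

theorem integral_coin (F : Bool → ℝ) : ∫ b, F b ∂coin = (F true + F false) / 2 := by
  rw [coin, PMF.integral_eq_sum]
  simp
  ring

section Signs

variable {V : Type} [Fintype V]

/-- The law of independent fair bits. -/
noncomputable def signLaw (V : Type) [Fintype V] : Measure (V → Bool) := Measure.pi fun _ => coin

instance : IsProbabilityMeasure (signLaw V) := by
  unfold signLaw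
  infer_instance

/-- Hoeffding's estimate: the integral factors into `cosh (a i)`, and `cosh x ≤ exp (x²/2)`. -/
theorem integral_exp_sum_sgn_le (a : V → ℝ) :
    ∫ b, Real.exp (∑ i, a i * sgn (b i)) ∂(signLaw V) ≤ Real.exp (∑ i, a i ^ 2 / 2) := by
  simp only [Real.exp_sum]
  rw [signLaw, integral_fintype_prod_eq_prod (fun i (b : Bool) => Real.exp (a i * sgn b))]
  refine Finset.prod_le_prod (fun i _ => integral_nonneg fun _ => (Real.exp_pos _).le)
    fun i _ => ?_
  rw [integral_coin]
  have : (Real.exp (a i * sgn true) + Real.exp (a i * sgn false)) / 2 = Real.cosh (a i) := by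
    rw [Real.cosh_eq]
    simp [sgn]
  rw [this]
  exact Real.cosh_le_exp_half_sq _

variable [DecidableEq V]

theorem integral_signLaw (F : (V → Bool) → ℝ) :
    ∫ b, F b ∂(signLaw V) = ∑ b, (1 / 2) ^ Fintype.card V * F b := by
  have hcoin : ∀ c : Bool, coin {c} = 2⁻¹ := by
    intro c
    rw [coin, PMF.toMeasure_apply_singleton _ _ (measurableSet_singleton c)]
    simp
  rw [integral_fintype Integrable.of_finite]
  refine Finset.sum_congr rfl fun b _ => ?_
  rw [smul_eq_mul, measureReal_def, signLaw, Measure.pi_singleton]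
  simp [hcoin]

/-- In terms of signs, `==` with `c` multiplies by a fixed sign vector, an involution of the uniform
space. -/
theorem integral_signLaw_flip (c : V → Bool) (F : (V → Bool) → ℝ) :
    ∫ b, F (fun i => b i == c i) ∂(signLaw V) = ∫ b, F b ∂(signLaw V) := by
  rw [integral_signLaw, integral_signLaw]
  have hinv : Function.Involutive fun (b : V → Bool) i => b i == c i := by
    intro b
    funext i
    change ((b i == c i) == c i) = b i
    cases b i <;> cases c i <;> rfl
  exact Fintype.sum_equiv hinv.toPerm _ _ fun b => rfl

theorem integral_signLaw_eq_zero (c : V → Bool) {F : (V → Bool) → ℝ}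
    (hF : ∀ b, F (fun i => b i == c i) = -F b) : ∫ b, F b ∂(signLaw V) = 0 := by
  have := integral_signLaw_flip c F
  simp only [hF, integral_neg] at this
  linarith

/-- The square is linearised: `exp (y²/8)` is the mean of `exp (y g / 2)` over a standard Gaussian
`g`. For fixed `g` the sign average is at most `exp (g²/8)`, whose Gaussian mean is `(3/4)^(-1/2) ≤
2`. -/
theorem integral_exp_sq_sum_sgn_le {a : V → ℝ} (ha : ∑ i, a i ^ 2 ≤ 1) :
    ∫ b, Real.exp (1 / 8 * (∑ i, a i * sgn (b i)) ^ 2) ∂(signLaw V) ≤ 2 := by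
  have h1 : ∀ y : ℝ, Real.exp (1 / 8 * y ^ 2)
      = ∫ g, Real.exp (1 / 2 * y * g) ∂(gaussianReal 0 1) := by
    intro y
    rw [integral_exp_mul_gaussianReal]
    congr 1
    ring
  simp only [h1]
  rw [integral_signLaw]
  simp only [← integral_const_mul]
  rw [← integral_finsetSum _ fun b _ => (integrable_exp_mul_gaussianReal _).const_mul _]
  calc _ ≤ ∫ g, Real.exp (1 / 8 * g ^ 2) ∂(gaussianReal 0 1) := by
        refine integral_mono (integrable_finsetSum _ fun b _ =>
          (integrable_exp_mul_gaussianReal _).const_mul _)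
          (integrable_exp_mul_sq_gaussianReal (by norm_num)) fun g => ?_
        simp only
        rw [← integral_signLaw fun b => Real.exp (1 / 2 * (∑ i, a i * sgn (b i)) * g)]
        have h2 : ∀ b : V → Bool, 1 / 2 * (∑ i, a i * sgn (b i)) * g
            = ∑ i, (1 / 2 * g * a i) * sgn (b i) := by
          intro b
          rw [Finset.mul_sum, Finset.sum_mul]
          exact Finset.sum_congr rfl fun i _ => by ring
        simp only [h2]
        refine (integral_exp_sum_sgn_le _).trans (Real.exp_le_exp.2 ?_)
        have h3 : ∑ i, (1 / 2 * g * a i) ^ 2 / 2 = 1 / 8 * g ^ 2 * ∑ i, a i ^ 2 := by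
          rw [Finset.mul_sum]
          exact Finset.sum_congr rfl fun i _ => by ring
        rw [h3]
        nlinarith [sq_nonneg g]
    _ ≤ 2 := by
        rw [integral_exp_mul_sq_gaussianReal (by norm_num)]
        rw [inv_le_comm₀ (Real.sqrt_pos.2 (by norm_num)) (by norm_num)]
        exact Real.le_sqrt_of_sq_le (by norm_num)

/-! ### Rademacher chaos of order two -/

theorem ind_sq (b : Bool) : ind b ^ 2 = ind b := by cases b <;> simp [ind]

/-- A uniform random subset contains `i` but not `j` with probability `1/4`; this is the origin of
the factor `4` in decoupling. -/
theorem integral_ind_mul_ind {i j : V} (hij : i ≠ j) :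
    ∫ δ, ind (δ i) * (1 - ind (δ j)) ∂(signLaw V) = 1 / 4 := by
  have h1 : ∀ δ : V → Bool, ind (δ i) * (1 - ind (δ j))
      = 1 / 4 + (1 / 4 * sgn (δ i) - 1 / 4 * (1 + sgn (δ i)) * sgn (δ j)) := by
    intro δ
    cases δ i <;> cases δ j <;> norm_num [ind, sgn]
  have h2 : ∫ δ, 1 / 4 * sgn (δ i) ∂(signLaw V) = 0 :=
    integral_signLaw_eq_zero (Function.update (fun _ => true) i false) fun b => by
      rw [sgn_beq]; simp [sgn_false]
  have h3 : ∫ δ, 1 / 4 * (1 + sgn (δ i)) * sgn (δ j) ∂(signLaw V) = 0 :=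
    integral_signLaw_eq_zero (Function.update (fun _ => true) j false) fun b => by
      rw [sgn_beq, sgn_beq]; simp [sgn_true, sgn_false, hij]
  simp only [h1]
  rw [integral_add Integrable.of_finite Integrable.of_finite,
    integral_sub Integrable.of_finite Integrable.of_finite, h2, h3]
  simp

/-- Exponential moments of decoupled Rademacher chaos. -/
theorem integral_exp_decoupled_chaos_le {A : V → V → ℝ} (hA : ∑ i, ∑ j, A i j ^ 2 = 1) {t : ℝ}
    (ht : t ^ 2 ≤ 1 / 64) (δ : V → Bool) :
    ∫ b, Real.exp (t * (4 * ∑ i, ∑ j, A i j * sgn (b i) * sgn (b j)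
      * (ind (δ i) * (1 - ind (δ j))))) ∂(signLaw V) ≤ 2 := by
  set c : V → (V → Bool) → ℝ := fun i b => ∑ j, A i j * (1 - ind (δ j)) * sgn (b j) with hc
  set G : (V → Bool) → ℝ := fun b => Real.exp (t * (4 * ∑ i, ∑ j, A i j * sgn (b i) * sgn (b j)
      * (ind (δ i) * (1 - ind (δ j))))) with hG
  -- Only signs at coordinates selected by `δ` are re-randomised by `b'`. Since `c i` involves only
  -- the other coordinates, the exponent becomes linear in `b'`.
  have hflip : ∀ b b' : V → Bool, G (fun i => b i == (b' i || !(δ i)))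
      = Real.exp (∑ i, (4 * t * (ind (δ i) * sgn (b i) * c i b)) * sgn (b' i)) := by
    intro b b'
    simp only [hG, hc]
    congr 1
    simp only [Finset.mul_sum, Finset.sum_mul]
    refine Finset.sum_congr rfl fun i _ => Finset.sum_congr rfl fun j _ => ?_
    rw [sgn_beq, sgn_beq]
    cases δ i <;> cases δ j <;> (simp [ind, sgn_true]; try ring)
  set r : V → ℝ := fun i => √(∑ j, A i j ^ 2) with hr
  have hr2 : ∀ i, r i ^ 2 = ∑ j, A i j ^ 2 := fun i =>
    Real.sq_sqrt (Finset.sum_nonneg fun _ _ => sq_nonneg _)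
  -- The row sums, normalised to unit coefficient vectors. If `r i = 0` the whole row vanishes and
  -- division by zero gives `0`, so `hcq` still holds.
  set q : V → (V → Bool) → ℝ := fun i b => ∑ j, A i j * (1 - ind (δ j)) / r i * sgn (b j) with hq
  have hcq : ∀ i b, c i b = r i * q i b := by
    intro i b
    simp only [hc, hq]
    rw [Finset.mul_sum]
    refine Finset.sum_congr rfl fun j _ => ?_
    by_cases h0 : r i = 0
    · have h1 : ∑ j, A i j ^ 2 = 0 := by rw [← hr2, h0]; norm_num
      have h2 := (Finset.sum_eq_zero_iff_of_nonneg fun _ _ => sq_nonneg _).1 h1 j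
        (Finset.mem_univ j)
      rw [pow_eq_zero_iff two_ne_zero] at h2
      simp [h2]
    · field_simp
  have hq2 : ∀ i, ∫ b, Real.exp (1 / 8 * q i b ^ 2) ∂(signLaw V) ≤ 2 := by
    intro i
    apply integral_exp_sq_sum_sgn_le
    calc ∑ j, (A i j * (1 - ind (δ j)) / r i) ^ 2 ≤ ∑ j, A i j ^ 2 / r i ^ 2 := by
          refine Finset.sum_le_sum fun j _ => ?_
          rw [div_pow]
          apply div_le_div_of_nonneg_right _ (sq_nonneg _)
          cases δ j <;> simp [ind, sq_nonneg]
      _ = r i ^ 2 / r i ^ 2 := by rw [← Finset.sum_div, hr2]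
      _ ≤ 1 := div_self_le_one _
  have hinner : ∀ b : V → Bool,
      ∫ b', G (fun i => b i == (b' i || !(δ i))) ∂(signLaw V)
        ≤ ∑ i, r i ^ 2 * Real.exp (1 / 8 * q i b ^ 2) := by
    intro b
    simp only [hflip]
    refine (integral_exp_sum_sgn_le _).trans ?_
    -- The hypothesis on `t` gives `8 t² ≤ 1/8`. As the weights `r i ^ 2` sum to `1`, convexity of
    -- `exp` then separates the rows, although they share the same signs.
    calc Real.exp (∑ i, (4 * t * (ind (δ i) * sgn (b i) * c i b)) ^ 2 / 2)
        ≤ Real.exp (∑ i, r i ^ 2 • (1 / 8 * q i b ^ 2)) := by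
          apply Real.exp_le_exp.2
          refine Finset.sum_le_sum fun i _ => ?_
          rw [hcq]
          have h1 : (4 * t * (ind (δ i) * sgn (b i) * (r i * q i b))) ^ 2 / 2
              = t ^ 2 * (8 * (ind (δ i) * (r i ^ 2 * q i b ^ 2))) := by
            calc _ = 8 * t ^ 2 * (ind (δ i) ^ 2 * sgn (b i) ^ 2 * (r i ^ 2 * q i b ^ 2)) := by ring
              _ = _ := by rw [ind_sq, sgn_sq]; ring
          have h2 : ind (δ i) * (r i ^ 2 * q i b ^ 2) ≤ r i ^ 2 * q i b ^ 2 := by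
            have : 0 ≤ r i ^ 2 * q i b ^ 2 := by positivity
            cases δ i <;> simp [ind, this]
          have h3 : 0 ≤ ind (δ i) * (r i ^ 2 * q i b ^ 2) := by
            have : 0 ≤ r i ^ 2 * q i b ^ 2 := by positivity
            cases δ i <;> simp [ind, this]
          rw [h1, smul_eq_mul]
          nlinarith
      _ ≤ ∑ i, r i ^ 2 • Real.exp (1 / 8 * q i b ^ 2) :=
          convexOn_exp.map_sum_le (fun i _ => sq_nonneg _)
            (by simp only [hr2]; exact hA) fun i _ => Set.mem_univ _
      _ = _ := by simp only [smul_eq_mul]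
  calc ∫ b, G b ∂(signLaw V)
      = ∫ b', ∫ b, G (fun i => b i == (b' i || !(δ i))) ∂(signLaw V) ∂(signLaw V) := by
        simp only [integral_signLaw_flip _ G]
        simp
    _ = ∫ b, ∫ b', G (fun i => b i == (b' i || !(δ i))) ∂(signLaw V) ∂(signLaw V) :=
        integral_integral_swap Integrable.of_finite
    _ ≤ ∫ b, ∑ i, r i ^ 2 * Real.exp (1 / 8 * q i b ^ 2) ∂(signLaw V) :=
        integral_mono Integrable.of_finite Integrable.of_finite hinner
    _ = ∑ i, r i ^ 2 * ∫ b, Real.exp (1 / 8 * q i b ^ 2) ∂(signLaw V) := by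
        rw [integral_finsetSum _ fun _ _ => Integrable.of_finite]
        simp only [integral_const_mul]
    _ ≤ ∑ i, r i ^ 2 * 2 := by
        refine Finset.sum_le_sum fun i _ => ?_
        have := hq2 i
        gcongr
    _ = 2 := by
        rw [← Finset.sum_mul]
        simp only [hr2, hA, one_mul]

/-- Exponential moments of Rademacher chaos of order two, by decoupling. -/
theorem integral_exp_chaos_le {A : V → V → ℝ} (hdiag : ∀ i, A i i = 0)
    (hA : ∑ i, ∑ j, A i j ^ 2 = 1) {t : ℝ} (ht : t ^ 2 ≤ 1 / 64) :
    ∫ b, Real.exp (t * ∑ i, ∑ j, A i j * sgn (b i) * sgn (b j)) ∂(signLaw V) ≤ 2 := by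
  set W : (V → Bool) → (V → Bool) → ℝ := fun b δ => t * (4 * ∑ i, ∑ j, A i j * sgn (b i)
    * sgn (b j) * (ind (δ i) * (1 - ind (δ j)))) with hW
  -- Averaging the decoupled form over the partition `δ` returns the chaos, because the diagonal is
  -- zero. Jensen's inequality moves the average outside the exponential.
  have hmean : ∀ b : V → Bool, t * ∑ i, ∑ j, A i j * sgn (b i) * sgn (b j)
      = ∫ δ, W b δ ∂(signLaw V) := by
    intro b
    simp only [hW]
    rw [integral_const_mul, integral_const_mul, integral_finsetSum _ fun _ _ =>
      Integrable.of_finite]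
    congr 1
    rw [Finset.mul_sum]
    refine Finset.sum_congr rfl fun i _ => ?_
    rw [integral_finsetSum _ fun _ _ => Integrable.of_finite, Finset.mul_sum]
    refine Finset.sum_congr rfl fun j _ => ?_
    rw [integral_const_mul]
    by_cases hij : i = j
    · subst hij
      simp [hdiag]
    · rw [integral_ind_mul_ind hij]
      ring
  calc ∫ b, Real.exp (t * ∑ i, ∑ j, A i j * sgn (b i) * sgn (b j)) ∂(signLaw V)
      ≤ ∫ b, ∫ δ, Real.exp (W b δ) ∂(signLaw V) ∂(signLaw V) := by
        refine integral_mono Integrable.of_finite Integrable.of_finite fun b => ?_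
        simp only [hmean]
        exact convexOn_exp.map_integral_le Real.continuous_exp.continuousOn isClosed_univ
          (ae_of_all _ fun _ => Set.mem_univ _) Integrable.of_finite Integrable.of_finite
    _ = ∫ δ, ∫ b, Real.exp (W b δ) ∂(signLaw V) ∂(signLaw V) :=
        integral_integral_swap Integrable.of_finite
    _ ≤ ∫ _δ, 2 ∂(signLaw V) :=
        integral_mono Integrable.of_finite Integrable.of_finite fun δ =>
          integral_exp_decoupled_chaos_le hA ht δ
    _ = 2 := by simp

end Signs

/-! ### The rows of the two measurement matrices -/

section SignRows

theorem integral_sq_of_orthonormal {Ω ι : Type} [Finite Ω] [MeasurableSpace Ω]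
    [MeasurableSingletonClass Ω] {μ : Measure Ω} [IsProbabilityMeasure μ] [Fintype ι]
    {X : Ω → ι → ℝ} (hsq : ∀ ω j, X ω j ^ 2 = 1)
    (horth : ∀ j k, j ≠ k → ∫ ω, X ω j * X ω k ∂μ = 0) (v : ι → ℝ) :
    ∫ ω, (∑ j, X ω j * v j) ^ 2 ∂μ = ∑ j, v j ^ 2 := by
  have h1 : ∀ ω, (∑ j, X ω j * v j) ^ 2 = ∑ j, ∑ k, X ω j * X ω k * (v j * v k) := by
    intro ω
    rw [sq, Finset.sum_mul_sum]
    exact Finset.sum_congr rfl fun j _ => Finset.sum_congr rfl fun k _ => by ring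
  simp only [h1]
  rw [integral_finsetSum _ fun _ _ => Integrable.of_finite]
  refine Finset.sum_congr rfl fun j _ => ?_
  rw [integral_finsetSum _ fun _ _ => Integrable.of_finite, Finset.sum_eq_single j]
  · simp only [← sq, hsq, one_mul]
    simp
  · intro k _ hkj
    rw [integral_mul_const, horth j k (Ne.symm hkj), zero_mul]
  · simp

theorem integral_exp_abs_le {Ω : Type} [Finite Ω] [MeasurableSpace Ω]
    [MeasurableSingletonClass Ω] {μ : Measure Ω} [IsProbabilityMeasure μ] {Y : Ω → ℝ}
    (h : ∀ t : ℝ, t ^ 2 = 1 / 64 → ∫ ω, Real.exp (t * Y ω) ∂μ ≤ 2) :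
    ∫ ω, Real.exp (|Y ω| / 8) ∂μ ≤ 4 := by
  calc ∫ ω, Real.exp (|Y ω| / 8) ∂μ
      ≤ ∫ ω, (Real.exp (1 / 8 * Y ω) + Real.exp (-(1 / 8) * Y ω)) ∂μ := by
        refine integral_mono Integrable.of_finite Integrable.of_finite fun ω => ?_
        have h1 := Real.exp_pos (1 / 8 * Y ω)
        have h2 := Real.exp_pos (-(1 / 8) * Y ω)
        rcases abs_cases (Y ω) with ⟨h3, -⟩ | ⟨h3, -⟩
        · simp only [h3, show Y ω / 8 = 1 / 8 * Y ω by ring]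
          linarith
        · simp only [h3, show -Y ω / 8 = -(1 / 8) * Y ω by ring]
          linarith
    _ = (∫ ω, Real.exp (1 / 8 * Y ω) ∂μ) + ∫ ω, Real.exp (-(1 / 8) * Y ω) ∂μ :=
        integral_add Integrable.of_finite Integrable.of_finite
    _ ≤ 2 + 2 := add_le_add (h _ (by norm_num)) (h _ (by norm_num))
    _ = 4 := by norm_num

variable {d : ℕ}

/-- Signs live on all coordinates but only the columns in `P` are used: a vector on `P` is extended
by zero, so the estimates over `Fin d` apply. -/
theorem isSubexpRow_linear (P : Finset (Fin d)) :
    IsSubexpRow (signLaw (Fin d)) fun (b : Fin d → Bool) (p : P) => sgn (b p) where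
  abs_le_one b p := (abs_sgn _).le
  second_moment v := by
    apply integral_sq_of_orthonormal fun b p => sgn_sq _
    intro j k hjk
    have hjk' : (k : Fin d) ≠ j := fun h => hjk (Subtype.ext h.symm)
    refine integral_signLaw_eq_zero (Function.update (fun _ => true) (j : Fin d) false) fun b => ?_
    rw [sgn_beq, sgn_beq]
    simp [sgn_true, sgn_false, hjk']
  exp_moment v hv := by
    apply integral_exp_abs_le
    intro t ht
    have hsum : ∀ F : Fin d → ℝ → ℝ, (∀ i, F i 0 = 0) →
        ∑ p : P, F p (v p) = ∑ i, F i (if h : i ∈ P then v ⟨i, h⟩ else 0) := by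
      intro F hF
      refine Fintype.sum_of_injective (fun p : P => (p : Fin d)) Subtype.val_injective _ _ ?_ ?_
      · intro i hi
        have : i ∉ P := fun h => hi ⟨⟨i, h⟩, rfl⟩
        simp [this, hF]
      · intro p
        simp
    have h1 : ∀ b : Fin d → Bool, t * ∑ p : P, sgn (b p) * v p
        = ∑ i, (t * (if h : i ∈ P then v ⟨i, h⟩ else 0)) * sgn (b i) := by
      intro b
      rw [Finset.mul_sum, ← hsum (fun i x => t * x * sgn (b i)) (by simp)]
      exact Finset.sum_congr rfl fun p _ => by ring
    simp only [h1]
    refine (integral_exp_sum_sgn_le _).trans ?_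
    rw [← hsum (fun i x => (t * x) ^ 2 / 2) (by simp)]
    have h2 : ∑ p : P, (t * v p) ^ 2 / 2 = 1 / 128 := by
      calc _ = t ^ 2 / 2 * ∑ p : P, v p ^ 2 := by
            rw [Finset.mul_sum]
            exact Finset.sum_congr rfl fun p _ => by ring
        _ = 1 / 128 := by rw [ht, hv]; norm_num
    rw [h2]
    have h3 := Real.exp_one_lt_d9
    have h4 : Real.exp (1 / 128) * Real.exp (1 / 128) ≤ Real.exp 1 := by
      rw [← Real.exp_add]
      exact Real.exp_le_exp.2 (by norm_num)
    nlinarith [Real.exp_pos (1 / 128 : ℝ)]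

theorem isSubexpRow_chaos :
    IsSubexpRow (signLaw (Fin d)) fun (b : Fin d → Bool) (j : Pair d) =>
      sgn (b j.1.1) * sgn (b j.1.2) where
  abs_le_one b j := by rw [abs_mul, abs_sgn, abs_sgn, one_mul]
  second_moment v := by
    apply integral_sq_of_orthonormal fun b j => by rw [mul_pow, sgn_sq, sgn_sq, one_mul]
    rintro ⟨⟨j₁, j₂⟩, hj⟩ ⟨⟨k₁, k₂⟩, hk⟩ hjk
    simp only [ne_eq, Subtype.mk.injEq, Prod.mk.injEq, not_and] at hjk hj hk ⊢
    -- Two distinct pairs differ in some coordinate: either `j₁` or `j₂` is missing from the other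
    -- pair. Flipping that one sign negates the integrand.
    by_cases h1 : j₁ ≠ k₁ ∧ j₁ ≠ k₂
    · refine integral_signLaw_eq_zero (Function.update (fun _ => true) j₁ false) fun b => ?_
      simp only [sgn_beq, Function.update_self, Function.update_of_ne h1.1.symm,
        Function.update_of_ne h1.2.symm, Function.update_of_ne hj.ne']
      simp [sgn_true, sgn_false]
    · have h2 : j₂ ≠ k₁ ∧ j₂ ≠ k₂ := by
        by_cases h3 : j₁ = k₁
        · exact ⟨fun h => by omega, hjk h3⟩
        · have h4 : j₁ = k₂ := by
            by_contra h4
            exact h1 ⟨h3, h4⟩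
          constructor <;> intro h <;> omega
      refine integral_signLaw_eq_zero (Function.update (fun _ => true) j₂ false) fun b => ?_
      simp only [sgn_beq, Function.update_self, Function.update_of_ne h2.1.symm,
        Function.update_of_ne h2.2.symm, Function.update_of_ne hj.ne]
      simp [sgn_true, sgn_false]
  exp_moment v hv := by
    apply integral_exp_abs_le
    intro t ht
    set A : Fin d → Fin d → ℝ := fun i j => if h : i < j then v ⟨(i, j), h⟩ else 0 with hAdef
    have hsum : ∀ F : Fin d → Fin d → ℝ → ℝ, (∀ i j, F i j 0 = 0) →
        ∑ j : Pair d, F j.1.1 j.1.2 (v j) = ∑ i, ∑ j, F i j (A i j) := by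
      intro F hF
      rw [← Fintype.sum_prod_type' fun i j => F i j (A i j)]
      refine Fintype.sum_of_injective (fun j : Pair d => (j : Fin d × Fin d))
        Subtype.val_injective _ _ ?_ ?_
      · intro i hi
        have : ¬ i.1 < i.2 := fun h => hi ⟨⟨i, h⟩, rfl⟩
        simp [hAdef, this, hF]
      · rintro ⟨j, hj⟩
        simp [hAdef, hj]
    have h1 : ∀ b : Fin d → Bool, ∑ j : Pair d, sgn (b j.1.1) * sgn (b j.1.2) * v j
        = ∑ i, ∑ j, A i j * sgn (b i) * sgn (b j) := by
      intro b
      rw [← hsum (fun i j x => x * sgn (b i) * sgn (b j)) (by simp)]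
      exact Finset.sum_congr rfl fun j _ => by ring
    simp only [h1]
    refine integral_exp_chaos_le (fun i => by simp [hAdef]) ?_ ht.le
    rw [← hsum (fun _ _ x => x ^ 2) (by simp), hv]

end SignRows

/-! ### Concentration of the norm of Gaussian noise -/

section Noise

/-- Allows integrals to be computed with Tonelli's theorem in `[0, ∞]`, obtaining integrability at
the end instead of assuming it. -/
theorem integral_eq_of_lintegral_ofReal_eq {Ω : Type*} [MeasurableSpace Ω] {μ : Measure Ω}
    {f : Ω → ℝ} (hf : Measurable f) (hf0 : ∀ x, 0 ≤ f x) {B : ℝ} (hB : 0 ≤ B)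
    (h : ∫⁻ x, ENNReal.ofReal (f x) ∂μ = ENNReal.ofReal B) :
    Integrable f μ ∧ ∫ x, f x ∂μ = B := by
  constructor
  · refine ⟨hf.aestronglyMeasurable, ?_⟩
    rw [hasFiniteIntegral_iff_ofReal (ae_of_all _ hf0), h]
    exact ENNReal.ofReal_lt_top
  · rw [integral_eq_lintegral_of_nonneg_ae (ae_of_all _ hf0) hf.aestronglyMeasurable, h,
      ENNReal.toReal_ofReal hB]

theorem lintegral_exp_linear_gaussian {Q : Type} [Fintype Q] (v : NNReal) (a : Q → ℝ) :
    ∫⁻ ω, ENNReal.ofReal (Real.exp (∑ q, a q * ω q)) ∂(Measure.pi fun _ : Q => gaussianReal 0 v)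
      = ENNReal.ofReal (Real.exp (v * ∑ q, a q ^ 2 / 2)) := by
  have h1 : ∀ t : ℝ, ∫ x, Real.exp (t * x) ∂(gaussianReal 0 v) = Real.exp (v * (t ^ 2 / 2)) := by
    intro t
    have := mgf_gaussianReal (p := gaussianReal 0 v) (X := id) (μ := 0) (v := v) (by simp) t
    rw [mgf] at this
    simp only [id, zero_mul, zero_add] at this
    rw [this]
    congr 1
    ring
  have h2 : ∀ t : ℝ, Integrable (fun x => Real.exp (t * x)) (gaussianReal 0 v) := by
    intro t
    apply Integrable.of_integral_ne_zero
    rw [h1]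
    positivity
  simp only [Real.exp_sum]
  rw [← ofReal_integral_eq_lintegral_ofReal
    (Integrable.fintype_prod (f := fun q x => Real.exp (a q * x)) fun q => h2 (a q))
    (ae_of_all _ fun ω => Finset.prod_nonneg fun _ _ => (Real.exp_pos _).le),
    integral_fintype_prod_eq_prod (fun q x => Real.exp (a q * x))]
  simp only [h1]
  rw [← Real.exp_sum, Finset.mul_sum]

theorem lintegral_exp_mul_sum_sq_gaussian {t : ℝ} (ht : t < 1 / 2) (n : ℕ) :
    ∫⁻ g, ENNReal.ofReal (Real.exp (t * ∑ i, g i ^ 2))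
        ∂(Measure.pi fun _ : Fin n => gaussianReal 0 1)
      = ENNReal.ofReal ((√(1 - 2 * t))⁻¹ ^ n) := by
  simp only [Finset.mul_sum, Real.exp_sum]
  rw [← ofReal_integral_eq_lintegral_ofReal
    (Integrable.fintype_prod (f := fun _ x => Real.exp (t * x ^ 2)) fun _ =>
      integrable_exp_mul_sq_gaussianReal ht)
    (ae_of_all _ fun ω => Finset.prod_nonneg fun _ _ => (Real.exp_pos _).le),
    integral_fintype_prod_eq_pow (ι := Fin n) (fun x => Real.exp (t * x ^ 2)),
    integral_exp_mul_sq_gaussianReal ht, Fintype.card_fin]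

/-- Second-order bound for the Laplace transform of a squared Gaussian. The linear term `t` is the
mean and must be sharp, since it cancels in the Chernoff exponent below. -/
theorem inv_sqrt_one_sub_le {t : ℝ} (ht0 : 0 ≤ t) (ht : t ≤ 1 / 4) :
    (√(1 - 2 * t))⁻¹ ≤ Real.exp (t + 2 * t ^ 2) := by
  have h1 : 0 < √(1 - 2 * t) := Real.sqrt_pos.2 (by linarith)
  rw [inv_le_iff_one_le_mul₀ h1, ← Real.sqrt_sq (Real.exp_pos (t + 2 * t ^ 2)).le,
    ← Real.sqrt_mul (sq_nonneg _)]
  apply Real.le_sqrt_of_sq_le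
  have h2 : Real.exp (t + 2 * t ^ 2) ^ 2 = Real.exp (2 * t + 4 * t ^ 2) := by
    rw [← Real.exp_nat_mul]
    congr 1
    push_cast
    ring
  have h3 := Real.quadratic_le_exp_of_nonneg (show 0 ≤ 2 * t + 4 * t ^ 2 by positivity)
  rw [h2, one_pow]
  have h4 : 4 * t ≤ (1 - 4 * t ^ 2) * (1 + 2 * t) := by nlinarith
  have h5 : 1 ≤ (1 + (2 * t + 4 * t ^ 2) + (2 * t + 4 * t ^ 2) ^ 2 / 2) * (1 - 2 * t) := by
    nlinarith [mul_nonneg (sq_nonneg t) (sub_nonneg.2 h4)]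
  nlinarith

/-- Disjoint linear combinations, with the same coefficients, of independent Gaussian variables. -/
theorem measureReal_noise_gt_le {Q K : Type} [Fintype Q] [Fintype K] {n : ℕ} {e : Fin n × K → Q}
    (he : Function.Injective e) (w : K → ℝ) {σ s ε : ℝ} (hs : 0 < s)
    (hsw : s ^ 2 = σ ^ 2 * ∑ k, w k ^ 2) (hε : 0 < ε) (hε1 : ε < 1) :
    (Measure.pi fun _ : Q => gaussianReal 0 (σ ^ 2).toNNReal).real
        {ω | ¬ ∑ i, (∑ k, w k * ω (e (i, k))) ^ 2 ≤ (1 + ε) ^ 2 * s ^ 2 * n}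
      ≤ Real.exp (-(3 / 8 * ε ^ 2 * n)) := by
  set π := Measure.pi fun _ : Q => gaussianReal 0 (σ ^ 2).toNNReal
  set γ := Measure.pi fun _ : Fin n => gaussianReal 0 1
  -- With this choice `t (1 + ε)² - t - 2 t² = 3ε²/8 + ε³/4`, the source of the constant `3/8`.
  set t := ε / 4 with ht
  -- An auxiliary standard Gaussian vector `g` linearises the squares: `exp (t G² / s²)` is the mean
  -- of `exp (κ G g)`. After swapping integrals only linear exponents in the noise occur, so the law
  -- of the combinations `G i` need not be identified.
  set κ := √(2 * t) / s with hκ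
  have hκ2 : κ ^ 2 = 2 * t / s ^ 2 := by rw [hκ, div_pow, Real.sq_sqrt (by positivity)]
  set G : Fin n → (Q → ℝ) → ℝ := fun i ω => ∑ k, w k * ω (e (i, k)) with hG
  set f : (Q → ℝ) → ℝ := fun ω => Real.exp (t / s ^ 2 * ∑ i, G i ω ^ 2) with hf
  have hGm : ∀ i, Measurable (G i) := fun i => by fun_prop
  have hlin : ∀ ω, ENNReal.ofReal (f ω)
      = ∫⁻ g, ENNReal.ofReal (Real.exp (∑ i, κ * G i ω * g i)) ∂γ := by
    intro ω
    rw [lintegral_exp_linear_gaussian, NNReal.coe_one, one_mul]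
    simp only [hf]
    congr 2
    rw [Finset.mul_sum]
    refine Finset.sum_congr rfl fun i _ => ?_
    rw [mul_pow, hκ2]
    ring
  have hswap : ∀ g : Fin n → ℝ,
      ∫⁻ ω, ENNReal.ofReal (Real.exp (∑ i, κ * G i ω * g i)) ∂π
        = ENNReal.ofReal (Real.exp (t * ∑ i, g i ^ 2)) := by
    intro g
    set b : Q → ℝ := Function.extend e (fun x => κ * g x.1 * w x.2) 0 with hb
    have hbe : ∀ x, b (e x) = κ * g x.1 * w x.2 := fun x => he.extend_apply _ _ x
    have hb0 : ∀ q ∉ Set.range e, b q = 0 := fun q hq =>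
      Function.extend_apply' _ _ _ (by simpa using hq)
    have h1 : ∀ ω : Q → ℝ, ∑ i, κ * G i ω * g i = ∑ q, b q * ω q := by
      intro ω
      rw [← Fintype.sum_of_injective e he (fun x => κ * g x.1 * w x.2 * ω (e x))
        (fun q => b q * ω q) (fun q hq => by rw [hb0 q hq, zero_mul]) fun x => by rw [hbe],
        Fintype.sum_prod_type]
      refine Finset.sum_congr rfl fun i _ => ?_
      simp only [hG, Finset.mul_sum, Finset.sum_mul]
      exact Finset.sum_congr rfl fun k _ => by ring
    have h2 : ∑ q, b q ^ 2 / 2 = κ ^ 2 / 2 * (∑ k, w k ^ 2) * ∑ i, g i ^ 2 := by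
      rw [← Fintype.sum_of_injective e he (fun x => (κ * g x.1 * w x.2) ^ 2 / 2)
        (fun q => b q ^ 2 / 2) (fun q hq => by rw [hb0 q hq]; norm_num) fun x => by rw [hbe],
        Fintype.sum_prod_type, Finset.mul_sum]
      refine Finset.sum_congr rfl fun i _ => ?_
      simp only [Finset.mul_sum, Finset.sum_mul]
      exact Finset.sum_congr rfl fun k _ => by ring
    simp only [h1]
    rw [lintegral_exp_linear_gaussian, h2, Real.coe_toNNReal _ (sq_nonneg σ), hκ2]
    congr 2
    have h3 : σ ^ 2 * (2 * t / s ^ 2 / 2 * (∑ k, w k ^ 2) * ∑ i, g i ^ 2)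
        = t / s ^ 2 * (σ ^ 2 * ∑ k, w k ^ 2) * ∑ i, g i ^ 2 := by ring
    rw [h3, ← hsw]
    field_simp
  obtain ⟨hint, hval⟩ := integral_eq_of_lintegral_ofReal_eq (μ := π) (f := f)
    (B := (√(1 - 2 * t))⁻¹ ^ n) (by fun_prop) (fun _ => (Real.exp_pos _).le) (by positivity) (by
      simp only [hlin]
      rw [lintegral_lintegral_swap (by fun_prop)]
      simp only [hswap]
      exact lintegral_exp_mul_sum_sq_gaussian (by linarith) n)
  have hmarkov := mul_meas_ge_le_integral_of_nonneg (μ := π) (f := f)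
    (ae_of_all _ fun _ => (Real.exp_pos _).le) hint (Real.exp (t * (1 + ε) ^ 2 * n))
  rw [hval] at hmarkov
  have hsub : {ω : Q → ℝ | ¬ ∑ i, G i ω ^ 2 ≤ (1 + ε) ^ 2 * s ^ 2 * n}
      ⊆ {ω | Real.exp (t * (1 + ε) ^ 2 * n) ≤ f ω} := by
    intro ω hω
    simp only [Set.mem_ofPred_eq, not_le] at hω
    simp only [Set.mem_ofPred_eq, hf]
    apply Real.exp_le_exp.2
    have h1 : t * (1 + ε) ^ 2 * n = t / s ^ 2 * ((1 + ε) ^ 2 * s ^ 2 * n) := by field_simp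
    rw [h1]
    gcongr
  have h1 : π.real {ω | Real.exp (t * (1 + ε) ^ 2 * n) ≤ f ω}
      ≤ Real.exp (-(t * (1 + ε) ^ 2 * n)) * (√(1 - 2 * t))⁻¹ ^ n := by
    rw [Real.exp_neg, le_inv_mul_iff₀ (Real.exp_pos _)]
    exact hmarkov
  refine (measureReal_mono hsub).trans (h1.trans ?_)
  calc Real.exp (-(t * (1 + ε) ^ 2 * n)) * (√(1 - 2 * t))⁻¹ ^ n
      ≤ Real.exp (-(t * (1 + ε) ^ 2 * n)) * Real.exp (t + 2 * t ^ 2) ^ n := by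
        gcongr
        exact inv_sqrt_one_sub_le (by positivity) (by linarith)
    _ = Real.exp (-(3 / 8 * ε ^ 2 * n) - ε ^ 3 / 4 * n) := by
        rw [← Real.exp_nat_mul, ← Real.exp_add]
        congr 1
        rw [ht]
        ring
    _ ≤ _ := by
        apply Real.exp_le_exp.2
        have : 0 ≤ ε ^ 3 / 4 * n := by positivity
        linarith

end Noise

/-! ### Recovery by `ℓ₁`-minimization -/

section Recovery

variable {ι : Type} [Fintype ι] {n : ℕ}

/-- A feasible point cuts the feasible set down to a compact set, so feasibility of the truth
guarantees that the programs have solutions. -/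
theorem exists_l1norm_minimizer {F : (ι → ℝ) → ℝ} (hF : Continuous F) {ν : ℝ} {w₀ : ι → ℝ}
    (hw₀ : F w₀ ≤ ν) : ∃ z, F z ≤ ν ∧ ∀ w, F w ≤ ν → l1norm z ≤ l1norm w := by
  have hcont : Continuous (l1norm : (ι → ℝ) → ℝ) := by
    unfold l1norm
    fun_prop
  have hK : IsCompact {w : ι → ℝ | F w ≤ ν ∧ l1norm w ≤ l1norm w₀} := by
    refine Metric.isCompact_of_isClosed_isBounded ?_ ?_
    · exact (isClosed_le hF continuous_const).inter (isClosed_le hcont continuous_const)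
    · refine (Metric.isBounded_closedBall (x := (0 : ι → ℝ)) (r := l1norm w₀)).subset ?_
      rintro w ⟨-, hw⟩
      rw [mem_closedBall_zero_iff, pi_norm_le_iff_of_nonneg (l1norm_nonneg w₀)]
      intro i
      exact (Finset.single_le_sum (f := fun i => |w i|) (fun _ _ => abs_nonneg _)
        (Finset.mem_univ i)).trans hw
  obtain ⟨z, hz, hmin⟩ := hK.exists_isMinOn ⟨w₀, hw₀, le_rfl⟩ hcont.continuousOn
  refine ⟨z, hz.1, fun w hw => ?_⟩
  by_cases hle : l1norm w ≤ l1norm w₀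
  · exact hmin ⟨hw, hle⟩
  · exact hz.2.trans (not_le.1 hle).le

/-- The matrix `B` controls the entries of all vectors concentrated on `S`. -/
def IsStableOn (S : Finset ι) (B : Matrix (Fin n) ι ℝ) : Prop :=
  ∀ h : ι → ℝ, l1norm h / 2 ≤ ∑ i ∈ S, |h i| → ∀ i, n * |h i| ≤ 2 ^ 14 * l1norm (B *ᵥ h)

theorem isStableOn_empty (B : Matrix (Fin n) ι ℝ) : IsStableOn ∅ B := by
  intro h hh i
  have h1 : |h i| ≤ l1norm h :=
    Finset.single_le_sum (f := fun i => |h i|) (fun _ _ => abs_nonneg _) (Finset.mem_univ i)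
  rw [Finset.sum_empty] at hh
  have h2 : |h i| = 0 := le_antisymm (by linarith) (abs_nonneg _)
  rw [h2, mul_zero]
  have := l1norm_nonneg (B *ᵥ h)
  positivity

/-- The null-space argument: off `S` the difference coincides with `w`, and mass of `w` gained there
must be lost on `S`. -/
theorem l1norm_sub_half_le {S : Finset ι} {z w : ι → ℝ} (hz : ∀ i ∉ S, z i = 0)
    (hle : l1norm w ≤ l1norm z) : l1norm (w - z) / 2 ≤ ∑ i ∈ S, |(w - z) i| := by
  classical
  have hsplit : ∀ v : ι → ℝ, l1norm v = ∑ i ∈ S, |v i| + ∑ i ∈ Sᶜ, |v i| := fun v =>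
    (Finset.sum_add_sum_compl S _).symm
  have h1 : ∑ i ∈ Sᶜ, |z i| = 0 := Finset.sum_eq_zero fun i hi => by
    rw [hz i (Finset.mem_compl.1 hi), abs_zero]
  have h2 : ∑ i ∈ Sᶜ, |(w - z) i| = ∑ i ∈ Sᶜ, |w i| := Finset.sum_congr rfl fun i hi => by
    rw [Pi.sub_apply, hz i (Finset.mem_compl.1 hi), sub_zero]
  have h3 : ∑ i ∈ S, |z i| ≤ ∑ i ∈ S, |(w - z) i| + ∑ i ∈ S, |w i| := by
    rw [← Finset.sum_add_distrib]
    refine Finset.sum_le_sum fun i _ => ?_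
    have h4 : |z i| = |w i - (w - z) i| := by simp
    rw [h4]
    linarith [abs_sub (w i) ((w - z) i)]
  rw [hsplit w, hsplit z, h1] at hle
  rw [hsplit (w - z), h2]
  linarith

/-- Truth and solution are both feasible, so `B` maps their difference to `ℓ₁`-norm at most `2 * ν`;
stability contributes the other factor `2 ^ 14`. -/
theorem SparseRec.IsP2.abs_sub_le {R : SparseRec n ι} {ν : ℝ} (hR : R.IsP2 ν) {S : Finset ι}
    {B : Matrix (Fin n) ι ℝ} (hB : IsStableOn S B) {z : ι → ℝ} (hz : ∀ i ∉ S, z i = 0)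
    {y : Fin n → ℝ} (hy : l1norm (y - B *ᵥ z) ≤ ν) (i : ι) :
    n * |R B y i - z i| ≤ 2 ^ 15 * ν := by
  have hsol : SolvesP2 ν B y (R B y) := by
    refine hR B y ?_
    refine exists_l1norm_minimizer (F := fun w => l1norm (y - B *ᵥ w)) ?_ hy
    unfold l1norm Matrix.mulVec dotProduct
    fun_prop
  have h1 := hB (R B y - z) (l1norm_sub_half_le hz (hsol.2 z hy)) i
  have h2 : B *ᵥ (R B y - z) = (y - B *ᵥ z) + (-1 : ℝ) • (y - B *ᵥ R B y) := by
    rw [Matrix.mulVec_sub, neg_one_smul]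
    abel
  have h3 : l1norm (B *ᵥ (R B y - z)) ≤ 2 * ν := by
    rw [h2]
    refine (l1norm_add_le _ _).trans ?_
    rw [l1norm_smul, abs_neg, abs_one, one_mul]
    linarith [hsol.1]
  rw [Pi.sub_apply] at h1
  linarith

/-- As for (P2), with Cauchy–Schwarz turning the `ℓ₂`-residual into an `ℓ₁`-residual at the price of
`√n`. -/
theorem SparseRec.IsP1.abs_sub_le {R : SparseRec n ι} {ν : ℝ} (hR : R.IsP1 ν) {S : Finset ι}
    {B : Matrix (Fin n) ι ℝ} (hB : IsStableOn S B) {z : ι → ℝ} (hz : ∀ i ∉ S, z i = 0)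
    {y : Fin n → ℝ} (hy : l2norm (y - B *ᵥ z) ≤ ν) (i : ι) :
    n * |R B y i - z i| ≤ 2 ^ 15 * (√(n : ℝ) * ν) := by
  have hsol : SolvesP1 ν B y (R B y) := by
    refine hR B y ?_
    refine exists_l1norm_minimizer (F := fun w => l2norm (y - B *ᵥ w)) ?_ hy
    unfold l2norm Matrix.mulVec dotProduct
    fun_prop
  have h1 := hB (R B y - z) (l1norm_sub_half_le hz (hsol.2 z hy)) i
  have h2 : B *ᵥ (R B y - z) = (y - B *ᵥ z) + (-1 : ℝ) • (y - B *ᵥ R B y) := by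
    rw [Matrix.mulVec_sub, neg_one_smul]
    abel
  have h3 : l2norm (B *ᵥ (R B y - z)) ≤ 2 * ν := by
    rw [h2]
    refine (l2norm_add_le _ _).trans ?_
    rw [l2norm_smul, abs_neg, abs_one, one_mul]
    linarith [hsol.1]
  have h4 : l1norm (B *ᵥ (R B y - z)) ≤ √(n : ℝ) * (2 * ν) := by
    refine (l1norm_le_sqrt_card_mul_l2norm _).trans ?_
    rw [Fintype.card_fin]
    gcongr
  rw [Pi.sub_apply] at h1
  linarith

end Recovery

/-! ### The grid -/

theorem gridValue_mem_Icc (m : ℕ) (k : Fin (2 * m + 1)) : gridValue m k ∈ Set.Icc (-1 : ℝ) 1 := by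
  have hk : ((k : ℕ) : ℝ) ≤ 2 * m := by exact_mod_cast Nat.lt_succ_iff.1 k.2
  have hm : (0 : ℝ) ≤ m := Nat.cast_nonneg m
  rw [Set.mem_Icc, ← abs_le, gridValue, abs_div, abs_of_nonneg hm]
  -- Covers `m = 0` as well, where division by zero makes the only grid value `0`.
  refine div_le_one_of_le₀ ?_ hm
  rw [abs_le]
  have : (0 : ℝ) ≤ ((k : ℕ) : ℝ) := Nat.cast_nonneg _
  constructor <;> linarith

theorem exists_gridValue_near {m : ℕ} (hm : 0 < m) {s : ℝ} (hs : s ∈ Set.Icc (-1 : ℝ) 1) :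
    ∃ k, |s - gridValue m k| ≤ 1 / m := by
  have hm' : (0 : ℝ) < m := by exact_mod_cast hm
  have h0 : 0 ≤ (s + 1) * m := mul_nonneg (by linarith [hs.1]) hm'.le
  have h1 := Nat.floor_le h0
  have h2 := Nat.lt_floor_add_one ((s + 1) * m)
  have hk : ⌊(s + 1) * m⌋₊ < 2 * m + 1 := by
    have h3 : ((⌊(s + 1) * m⌋₊ : ℕ) : ℝ) ≤ ((2 * m : ℕ) : ℝ) := by
      push_cast
      nlinarith [hs.2]
    exact Nat.lt_succ_of_le (by exact_mod_cast h3)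
  refine ⟨⟨_, hk⟩, ?_⟩
  have h4 : s - gridValue m ⟨_, hk⟩ = ((s + 1) * m - ⌊(s + 1) * m⌋₊) / m := by
    rw [gridValue]
    field_simp
    ring
  rw [h4, abs_div, abs_of_pos hm']
  gcongr
  rw [abs_le]
  constructor <;> linarith

/-- The grid resolution rule: at distance `r ≤ (D / (3L))^(1/α)` a Hölder component changes by at
most `D / 3`. -/
theorem mul_rpow_le_third {L D α r : ℝ} (hL : 0 < L) (hD : 0 < D) (hα : 0 < α) (hr : 0 ≤ r)
    (h : r * (3 * L / D) ^ (1 / α) ≤ 1) : L * r ^ α ≤ D / 3 := by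
  have hT : 0 < 3 * L / D := by positivity
  have h1 : (r * (3 * L / D) ^ (1 / α)) ^ α ≤ 1 := Real.rpow_le_one (by positivity) h hα.le
  rw [Real.mul_rpow hr (by positivity), ← Real.rpow_mul hT.le, one_div, inv_mul_cancel₀ hα.ne',
    Real.rpow_one] at h1
  rw [← mul_div_assoc, div_le_one hD] at h1
  linarith

/-! ### The measurements of the first stage -/

section Model

variable {d : ℕ} {f : (Fin d → ℝ) → ℝ} {S₁ : Finset (Fin d)} {S₂ : Finset (Pair d)}
  {φ : Fin d → ℝ → ℝ} {ψ : Pair d → ℝ → ℝ → ℝ} {L α D₁ D₂ : ℝ}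

theorem ind_mul_mem_Icc (b : Bool) {x : ℝ} (hx : x ∈ Set.Icc (-1 : ℝ) 1) :
    ind b * x ∈ Set.Icc (-1 : ℝ) 1 := by
  cases b <;> simp [ind, hx.1, hx.2]

open Classical in
/-- The values of the bivariate components at `x` that are visible to the partition `h`. -/
noncomputable def visible₂ (S₂ : Finset (Pair d)) (ψ : Pair d → ℝ → ℝ → ℝ) (h : Fin d → Fin 2)
    (x : Fin d → ℝ) : Pair d → ℝ :=
  fun j => if j ∈ S₂ ∧ h j.1.1 ≠ h j.1.2 then ψ j (x j.1.1) (x j.1.2) else 0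

/-- A term depending on coordinates of one part only takes each of its two values once with each
sign and cancels. For a separated pair the four points run through all ways of keeping or dropping
the two coordinates; anchoring kills all but the one keeping both, whose sign is `β_{j₁} β_{j₂}`. -/
theorem IsBivariateModel.alternating_sum (hf : IsBivariateModel f S₁ S₂ φ ψ L α D₁ D₂)
    (h : Fin d → Fin 2) (β : Fin d → Bool) {x : Fin d → ℝ} (hx : ∀ i, x i ∈ Set.Icc (-1 : ℝ) 1) :
    f (samplePoint₂ h β x 0) - f (samplePoint₂ h β x 1) - f (samplePoint₂ h β x 2)
        + f (samplePoint₂ h β x 3)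
      = ∑ j, sgn (β j.1.1) * sgn (β j.1.2) * visible₂ S₂ ψ h x j := by
  have hmem : ∀ t i, samplePoint₂ h β x t i ∈ Set.Icc (-1 : ℝ) 1 := fun t i =>
    ind_mul_mem_Icc _ (hx i)
  have huni : ∀ i, φ i (samplePoint₂ h β x 0 i) - φ i (samplePoint₂ h β x 1 i)
      - φ i (samplePoint₂ h β x 2 i) + φ i (samplePoint₂ h β x 3 i) = 0 := by
    intro i
    by_cases hi : h i = 0 <;> simp [samplePoint₂, hi]
  have hbiv : ∀ j ∈ S₂, ψ j (samplePoint₂ h β x 0 j.1.1) (samplePoint₂ h β x 0 j.1.2)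
      - ψ j (samplePoint₂ h β x 1 j.1.1) (samplePoint₂ h β x 1 j.1.2)
      - ψ j (samplePoint₂ h β x 2 j.1.1) (samplePoint₂ h β x 2 j.1.2)
      + ψ j (samplePoint₂ h β x 3 j.1.1) (samplePoint₂ h β x 3 j.1.2)
      = sgn (β j.1.1) * sgn (β j.1.2) * visible₂ S₂ ψ h x j := by
    intro j hj
    have h1 := (hf.biv_anchor j hj _ (hx j.1.1)).1
    have h2 := (hf.biv_anchor j hj _ (hx j.1.2)).2
    have h3 := (hf.biv_anchor j hj 0 (by norm_num)).1
    have hfin : ∀ a : Fin 2, a = 0 ∨ a = 1 := by decide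
    rcases hfin (h j.1.1) with ha | ha <;> rcases hfin (h j.1.2) with hb | hb <;>
      cases hc : β j.1.1 <;> cases hd : β j.1.2 <;>
      simp [samplePoint₂, visible₂, ha, hb, hc, hd, hj, h1, h2, h3, ind, sgn]
  have hsupp : ∑ j, sgn (β j.1.1) * sgn (β j.1.2) * visible₂ S₂ ψ h x j
      = ∑ j ∈ S₂, sgn (β j.1.1) * sgn (β j.1.2) * visible₂ S₂ ψ h x j := by
    refine (Finset.sum_subset (Finset.subset_univ S₂) fun j _ hj => ?_).symm
    simp [visible₂, hj]
  rw [hsupp, ← Finset.sum_congr rfl hbiv, hf.repr _ (hmem 0), hf.repr _ (hmem 1),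
    hf.repr _ (hmem 2), hf.repr _ (hmem 3)]
  have h1 := Finset.sum_congr (rfl : S₁ = S₁) fun i _ => huni i
  have h2 := Finset.sum_congr (rfl : pairVars S₂ = pairVars S₂) fun i _ => huni i
  simp only [Finset.sum_add_distrib, Finset.sum_sub_distrib, Finset.sum_const_zero] at h1 h2 ⊢
  linarith

/-- The contribution of the noise to the measurements of the first stage. -/
noncomputable def noise₂ (A : Params d) (ω : Query₂ A → ℝ) (l : Fin A.M)
    (c : Fin (2 * A.m₂ + 1) × Fin (2 * A.m₂ + 1)) : Fin A.n₂ → ℝ :=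
  fun i => ∑ k : Fin 4 × Fin A.N₂, (![1, -1, -1, 1] k.1 / A.N₂ : ℝ) * ω (l, c, i, k.1, k.2)

theorem basePoint₂_mem_Icc (m : ℕ) (h : Fin d → Fin 2)
    (c : Fin (2 * m + 1) × Fin (2 * m + 1)) (i : Fin d) :
    basePoint₂ m h c i ∈ Set.Icc (-1 : ℝ) 1 := by
  unfold basePoint₂
  split_ifs
  · exact gridValue_mem_Icc _ _
  · exact gridValue_mem_Icc _ _

theorem IsBivariateModel.measurement₂_eq (hf : IsBivariateModel f S₁ S₂ φ ψ L α D₁ D₂)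
    (A : Params d) (hN : 0 < A.N₂) (β : Fin A.n₂ → Fin d → Bool) (ω : Query₂ A → ℝ) (l : Fin A.M)
    (c : Fin (2 * A.m₂ + 1) × Fin (2 * A.m₂ + 1)) :
    measurement₂ A (fun q => f (queryPoint₂ A β q) + ω q) l c
      = signMatrix₂ β *ᵥ visible₂ S₂ ψ (A.hash l) (basePoint₂ A.m₂ (A.hash l) c)
        + noise₂ A ω l c := by
  have hN' : (A.N₂ : ℝ) ≠ 0 := by exact_mod_cast hN.ne'
  ext i
  rw [Pi.add_apply]
  have h1 := hf.alternating_sum (A.hash l) (β i) (basePoint₂_mem_Icc A.m₂ (A.hash l) c)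
  have h2 : (signMatrix₂ β *ᵥ visible₂ S₂ ψ (A.hash l) (basePoint₂ A.m₂ (A.hash l) c)) i
      = ∑ j : Pair d, sgn (β i j.1.1) * sgn (β i j.1.2)
        * visible₂ S₂ ψ (A.hash l) (basePoint₂ A.m₂ (A.hash l) c) j := rfl
  rw [h2, ← h1]
  simp only [measurement₂, noise₂, queryPoint₂, Fintype.sum_prod_type, Fin.sum_univ_four,
    Finset.sum_add_distrib, Finset.sum_const, Finset.card_univ, Fintype.card_fin, nsmul_eq_mul,
    ← Finset.mul_sum]
  simp only [Matrix.cons_val]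
  field_simp
  ring

theorem injective_pair {i j : Fin d} (hij : i ≠ j) : Function.Injective ![i, j] := by
  intro a b hab
  fin_cases a <;> fin_cases b <;> simp_all [eq_comm]

/-- A hash function separating the pair lets its two coordinates be placed independently at the grid
values nearest to a point where `|ψ j| > D₂`. Which grid value comes first depends on the part
containing `j₁`. -/
theorem IsBivariateModel.exists_visible₂_large (hf : IsBivariateModel f S₁ S₂ φ ψ L α D₁ D₂)
    (hL : 0 < L) (hα : 0 < α) (hD : 0 < D₂) (A : Params d) (hH : IsHashFamily A.hash)
    (hm : √2 * (3 * L / D₂) ^ (1 / α) ≤ A.m₂) {j : Pair d} (hj : j ∈ S₂) :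
    ∃ l c, A.hash l j.1.1 ≠ A.hash l j.1.2 ∧
      2 / 3 * D₂ < |visible₂ S₂ ψ (A.hash l) (basePoint₂ A.m₂ (A.hash l) c) j| := by
  have hT : 0 < (3 * L / D₂) ^ (1 / α) := by positivity
  have hm' : (0 : ℝ) < A.m₂ := lt_of_lt_of_le (by positivity) hm
  have hm0 : 0 < A.m₂ := by exact_mod_cast hm'
  obtain ⟨s, hs, t, ht, hst⟩ := hf.biv_ident j hj
  obtain ⟨a, ha⟩ := exists_gridValue_near hm0 hs
  obtain ⟨b, hb⟩ := exists_gridValue_near hm0 ht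
  obtain ⟨l, hl⟩ := hH ![j.1.1, j.1.2] (injective_pair j.2.ne)
  have hsep : A.hash l j.1.1 ≠ A.hash l j.1.2 := by
    intro h
    have := @hl 0 1 (by simpa using h)
    simp at this
  have hlarge : 2 / 3 * D₂ < |ψ j (gridValue A.m₂ a) (gridValue A.m₂ b)| := by
    have h1 := hf.biv_holder j hj s hs t ht _ (gridValue_mem_Icc A.m₂ a) _
      (gridValue_mem_Icc A.m₂ b)
    have h2 : √((s - gridValue A.m₂ a) ^ 2 + (t - gridValue A.m₂ b) ^ 2) ≤ √2 / A.m₂ := by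
      rw [Real.sqrt_le_left (by positivity), div_pow, Real.sq_sqrt (by norm_num)]
      have h3 := pow_le_pow_left₀ (abs_nonneg _) ha 2
      have h4 := pow_le_pow_left₀ (abs_nonneg _) hb 2
      rw [sq_abs, div_pow, one_pow] at h3 h4
      calc _ ≤ 1 / (A.m₂ : ℝ) ^ 2 + 1 / (A.m₂ : ℝ) ^ 2 := add_le_add h3 h4
        _ = _ := by ring
    have h5 : L * (√((s - gridValue A.m₂ a) ^ 2 + (t - gridValue A.m₂ b) ^ 2)) ^ α ≤ D₂ / 3 := by
      apply mul_rpow_le_third hL hD hα (Real.sqrt_nonneg _)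
      calc _ ≤ √2 / A.m₂ * (3 * L / D₂) ^ (1 / α) := by gcongr
        _ = √2 * (3 * L / D₂) ^ (1 / α) / A.m₂ := by ring
        _ ≤ 1 := div_le_one_of_le₀ hm hm'.le
    have h6 := abs_sub_abs_le_abs_sub (ψ j s t) (ψ j (gridValue A.m₂ a) (gridValue A.m₂ b))
    linarith
  have hfin : ∀ a : Fin 2, a = 0 ∨ a = 1 := by decide
  rcases hfin (A.hash l j.1.1) with h1 | h1
  · have h2 : A.hash l j.1.2 ≠ 0 := fun h => hsep (h1.trans h.symm)
    refine ⟨l, (a, b), hsep, ?_⟩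
    rw [visible₂, if_pos ⟨hj, hsep⟩]
    simpa [basePoint₂, h1, h2] using hlarge
  · have h2 : A.hash l j.1.2 = 0 := (hfin _).resolve_right fun h => hsep (h1.trans h.symm)
    refine ⟨l, (b, a), hsep, ?_⟩
    rw [visible₂, if_pos ⟨hj, hsep⟩]
    simpa [basePoint₂, h1, h2] using hlarge

/-- Exactness of the first stage. -/
theorem IsBivariateModel.estimate₂_eq (hf : IsBivariateModel f S₁ S₂ φ ψ L α D₁ D₂)
    (hL : 0 < L) (hα : 0 < α) (hD : 0 < D₂) (A : Params d) (hH : IsHashFamily A.hash)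
    (hm : √2 * (3 * L / D₂) ^ (1 / α) ≤ A.m₂) (hN : 0 < A.N₂) (hn : 0 < A.n₂) {ν : ℝ}
    (hν : 2 ^ 15 * ν ≤ A.n₂ * A.thr₂) (hthr : A.thr₂ ≤ D₂ / 3)
    {R : SparseRec A.n₂ (Pair d)} (hR : R.IsP2 ν) {β : Fin A.n₂ → Fin d → Bool}
    (hβ : IsStableOn S₂ (signMatrix₂ β)) {ω : Query₂ A → ℝ}
    (hω : ∀ l c, l1norm (noise₂ A ω l c) ≤ ν) :
    estimate₂ A R β (fun q => f (queryPoint₂ A β q) + ω q) = S₂ := by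
  have hn' : (0 : ℝ) < A.n₂ := by exact_mod_cast hn
  -- Error at most `thr₂ ≤ D₂ / 3` suffices in both directions: a zero entry never strictly exceeds
  -- the threshold, and an entry above `2 D₂ / 3` stays above `D₂ / 3`.
  have herr : ∀ l c j, |R (signMatrix₂ β)
      (measurement₂ A (fun q => f (queryPoint₂ A β q) + ω q) l c) j
        - visible₂ S₂ ψ (A.hash l) (basePoint₂ A.m₂ (A.hash l) c) j| ≤ A.thr₂ := by
    intro l c j
    have h1 := hR.abs_sub_le hβ
      (z := visible₂ S₂ ψ (A.hash l) (basePoint₂ A.m₂ (A.hash l) c))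
      (fun j hj => by simp [visible₂, hj])
      (y := measurement₂ A (fun q => f (queryPoint₂ A β q) + ω q) l c)
      (by rw [hf.measurement₂_eq A hN, add_sub_cancel_left]; exact hω l c) j
    exact le_of_mul_le_mul_left (h1.trans hν) hn'
  ext j
  simp only [estimate₂, Finset.mem_filter, Finset.mem_univ, true_and]
  constructor
  · rintro ⟨l, c, -, hlt⟩
    by_contra hj
    have h1 := herr l c j
    have h2 : visible₂ S₂ ψ (A.hash l) (basePoint₂ A.m₂ (A.hash l) c) j = 0 := by
      simp [visible₂, hj]
    rw [h2, sub_zero] at h1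
    linarith
  · intro hj
    obtain ⟨l, c, hsep, hlarge⟩ := hf.exists_visible₂_large hL hα hD A hH hm hj
    refine ⟨l, c, hsep, ?_⟩
    have h1 := herr l c j
    rw [abs_sub_comm] at h1
    have h2 := abs_sub_abs_le_abs_sub
      (visible₂ S₂ ψ (A.hash l) (basePoint₂ A.m₂ (A.hash l) c) j)
      (R (signMatrix₂ β) (measurement₂ A (fun q => f (queryPoint₂ A β q) + ω q) l c) j)
    linarith

/-! ### The measurements of the second stage -/

open Classical in
/-- The values of the univariate components at `s`. -/
noncomputable def visible₁ (S₁ P : Finset (Fin d)) (φ : Fin d → ℝ → ℝ) (s : ℝ) : P → ℝ :=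
  fun p => if (p : Fin d) ∈ S₁ then φ p s else 0

theorem IsBivariateModel.subset_compl (hf : IsBivariateModel f S₁ S₂ φ ψ L α D₁ D₂) :
    S₁ ⊆ (pairVars S₂)ᶜ := by
  intro p hp
  rw [Finset.mem_compl]
  exact fun h => Finset.disjoint_left.1 hf.disjoint hp h

/-- All coordinates in `pairVars S₂` are set to zero, so anchoring removes the bivariate terms and
their univariate companions. Each remaining `φ p` sees `s` at one point and `0` at the other. -/
theorem IsBivariateModel.difference (hf : IsBivariateModel f S₁ S₂ φ ψ L α D₁ D₂)
    (β : Fin d → Bool) {s : ℝ} (hs : s ∈ Set.Icc (-1 : ℝ) 1) :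
    f (samplePoint₁ (pairVars S₂)ᶜ β s 0) - f (samplePoint₁ (pairVars S₂)ᶜ β s 1)
      = ∑ p : ((pairVars S₂)ᶜ : Finset (Fin d)), sgn (β p) * visible₁ S₁ (pairVars S₂)ᶜ φ s p := by
  set P := (pairVars S₂)ᶜ with hP
  have hmem : ∀ t i, samplePoint₁ P β s t i ∈ Set.Icc (-1 : ℝ) 1 := by
    intro t i
    unfold samplePoint₁
    split_ifs
    · exact ind_mul_mem_Icc _ hs
    · norm_num
  have hzero : ∀ t, ∀ i ∈ pairVars S₂, samplePoint₁ P β s t i = 0 := by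
    intro t i hi
    simp [samplePoint₁, hP, hi]
  have hbiv : ∀ t, ∑ j ∈ S₂, ψ j (samplePoint₁ P β s t j.1.1) (samplePoint₁ P β s t j.1.2) = 0 := by
    intro t
    refine Finset.sum_eq_zero fun j hj => ?_
    rw [hzero t j.1.1 (Finset.mem_biUnion.2 ⟨j, hj, by simp⟩)]
    exact (hf.biv_anchor j hj _ (hmem t _)).2
  have huni : ∀ t, ∑ l ∈ pairVars S₂, φ l (samplePoint₁ P β s t l) = 0 := by
    intro t
    refine Finset.sum_eq_zero fun l hl => ?_
    rw [hzero t l hl, hf.uni_anchor l (Finset.mem_union_right _ hl)]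
  have hS : ∀ p ∈ S₁, φ p (samplePoint₁ P β s 0 p) - φ p (samplePoint₁ P β s 1 p)
      = sgn (β p) * φ p s := by
    intro p hp
    have h1 : p ∈ P := hf.subset_compl hp
    have h2 := hf.uni_anchor p (Finset.mem_union_left _ hp)
    cases hb : β p <;> simp [samplePoint₁, h1, hb, ind, sgn, h2]
  have hsum : ∑ p : P, sgn (β p) * visible₁ S₁ P φ s p = ∑ p ∈ S₁, sgn (β p) * φ p s := by
    classical
    have h1 := Finset.sum_coe_sort P fun p => if p ∈ S₁ then sgn (β p) * φ p s else 0
    have h2 : P ∩ S₁ = S₁ := Finset.inter_eq_right.2 hf.subset_compl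
    rw [← Finset.sum_filter (s := P), Finset.filter_mem_eq_inter, h2] at h1
    rw [← h1]
    refine Finset.sum_congr rfl fun p _ => ?_
    simp [visible₁]
  rw [hsum, ← Finset.sum_congr rfl hS, Finset.sum_sub_distrib, hf.repr _ (hmem 0),
    hf.repr _ (hmem 1), hbiv, hbiv, huni, huni]
  ring

/-- The contribution of the noise to the measurements of the second stage. -/
noncomputable def noise₁ (A : Params d) (ω : Query₁ A → ℝ) (c : Fin (2 * A.m₁ + 1)) :
    Fin A.n₁ → ℝ :=
  fun i => ∑ k : Fin 2 × Fin A.N₁, (![1, -1] k.1 / A.N₁ : ℝ) * ω (c, i, k.1, k.2)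

theorem IsBivariateModel.measurement₁_eq (hf : IsBivariateModel f S₁ S₂ φ ψ L α D₁ D₂)
    (A : Params d) (hN : 0 < A.N₁) (β : Fin A.n₁ → Fin d → Bool) (ω : Query₁ A → ℝ)
    (c : Fin (2 * A.m₁ + 1)) :
    measurement₁ A (fun q => f (queryPoint₁ A (pairVars S₂)ᶜ β q) + ω q) c
      = signMatrix₁ (pairVars S₂)ᶜ β *ᵥ visible₁ S₁ (pairVars S₂)ᶜ φ (gridValue A.m₁ c)
        + noise₁ A ω c := by
  have hN' : (A.N₁ : ℝ) ≠ 0 := by exact_mod_cast hN.ne'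
  ext i
  rw [Pi.add_apply]
  have h1 := hf.difference (β i) (gridValue_mem_Icc A.m₁ c)
  have h2 : (signMatrix₁ (pairVars S₂)ᶜ β *ᵥ visible₁ S₁ (pairVars S₂)ᶜ φ (gridValue A.m₁ c)) i
      = ∑ p : ((pairVars S₂)ᶜ : Finset (Fin d)), sgn (β i p)
        * visible₁ S₁ (pairVars S₂)ᶜ φ (gridValue A.m₁ c) p := rfl
  rw [h2, ← h1]
  simp only [measurement₁, noise₁, queryPoint₁, Fintype.sum_prod_type, Fin.sum_univ_two,
    Finset.sum_add_distrib, Finset.sum_const, Finset.card_univ, Fintype.card_fin, nsmul_eq_mul,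
    ← Finset.mul_sum]
  simp only [Matrix.cons_val]
  field_simp
  ring

theorem IsBivariateModel.exists_visible₁_large (hf : IsBivariateModel f S₁ S₂ φ ψ L α D₁ D₂)
    (hL : 0 < L) (hα : 0 < α) (hD : 0 < D₁) {m : ℕ} (hm : (3 * L / D₁) ^ (1 / α) ≤ m)
    {p : Fin d} (hp : p ∈ S₁) : ∃ c, 2 / 3 * D₁ < |φ p (gridValue m c)| := by
  have hT : 0 < (3 * L / D₁) ^ (1 / α) := by positivity
  have hm' : (0 : ℝ) < m := lt_of_lt_of_le hT hm
  obtain ⟨s, hs, hlt⟩ := hf.uni_ident p hp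
  obtain ⟨c, hc⟩ := exists_gridValue_near (by exact_mod_cast hm') hs
  refine ⟨c, ?_⟩
  have h1 := hf.uni_holder p (Finset.mem_union_left _ hp) s hs _ (gridValue_mem_Icc m c)
  have h2 : L * |s - gridValue m c| ^ α ≤ D₁ / 3 := by
    apply mul_rpow_le_third hL hD hα (abs_nonneg _)
    calc _ ≤ 1 / m * (3 * L / D₁) ^ (1 / α) := by gcongr
      _ = (3 * L / D₁) ^ (1 / α) / m := by ring
      _ ≤ 1 := div_le_one_of_le₀ hm hm'.le
  have h3 := abs_sub_abs_le_abs_sub (φ p s) (φ p (gridValue m c))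
  linarith

/-- Exactness of the second stage. -/
theorem IsBivariateModel.estimate₁_eq (hf : IsBivariateModel f S₁ S₂ φ ψ L α D₁ D₂)
    (hL : 0 < L) (hα : 0 < α) (hD : 0 < D₁) (A : Params d)
    (hm : (3 * L / D₁) ^ (1 / α) ≤ A.m₁) (hN : 0 < A.N₁) (hn : 0 < A.n₁) {ν : ℝ}
    (hν : 2 ^ 15 * (√(A.n₁ : ℝ) * ν) ≤ A.n₁ * A.thr₁) (hthr : A.thr₁ ≤ D₁ / 3)
    {P : Finset (Fin d)} (hP : P = (pairVars S₂)ᶜ)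
    {R : SparseRec A.n₁ P} (hR : R.IsP1 ν)
    {β : Fin A.n₁ → Fin d → Bool}
    (hβ : IsStableOn (S₁.subtype (· ∈ P))
      (signMatrix₁ P β)) {ω : Query₁ A → ℝ}
    (hω : ∀ c, l2norm (noise₁ A ω c) ≤ ν) :
    estimate₁ A P R β (fun q => f (queryPoint₁ A P β q) + ω q)
      = S₁ := by
  have hn' : (0 : ℝ) < A.n₁ := by exact_mod_cast hn
  have hmem : ∀ p ∈ S₁, p ∈ P := fun p hp => hP ▸ hf.subset_compl hp
  have herr : ∀ c p, |R (signMatrix₁ P β)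
      (measurement₁ A (fun q => f (queryPoint₁ A P β q) + ω q) c) p
        - visible₁ S₁ P φ (gridValue A.m₁ c) p| ≤ A.thr₁ := by
    intro c p
    have h1 := hR.abs_sub_le hβ (z := visible₁ S₁ P φ (gridValue A.m₁ c))
      (fun p hp => by
        rw [Finset.mem_subtype] at hp
        simp [visible₁, hp])
      (y := measurement₁ A (fun q => f (queryPoint₁ A P β q) + ω q) c)
      (by subst hP; rw [hf.measurement₁_eq A hN, add_sub_cancel_left]; exact hω c) p
    exact le_of_mul_le_mul_left (h1.trans hν) hn'
  ext p
  simp only [estimate₁, Finset.mem_filter, Finset.mem_univ, true_and]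
  constructor
  · rintro ⟨c, hp, hlt⟩
    by_contra hpS
    have h1 := herr c ⟨p, hp⟩
    have h2 : visible₁ S₁ P φ (gridValue A.m₁ c) ⟨p, hp⟩ = 0 := by simp [visible₁, hpS]
    rw [h2, sub_zero] at h1
    linarith
  · intro hp
    obtain ⟨c, hlarge⟩ := hf.exists_visible₁_large hL hα hD hm hp
    refine ⟨c, hmem p hp, ?_⟩
    have h1 := herr c ⟨p, hmem p hp⟩
    have h3 : visible₁ S₁ P φ (gridValue A.m₁ c) ⟨p, hmem p hp⟩
        = φ p (gridValue A.m₁ c) := by simp [visible₁, hp]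
    rw [abs_sub_comm, h3] at h1
    have h2 := abs_sub_abs_le_abs_sub (φ p (gridValue A.m₁ c))
      (R (signMatrix₁ P β) (measurement₁ A (fun q => f (queryPoint₁ A P β q) + ω q) c)
        ⟨p, hmem p hp⟩)
    linarith

end Model

/-! ### Stability of the two sign matrices -/

section Stability

/-- The net bound is applied with `lam = |S| / N`. A lower bound `ℓ` on the logarithm absorbs the
`1` in `1 + log (N / |S|)`, at the cost of the factor `1 + 1/ℓ`. -/
theorem IsSubexpRow.measureReal_not_stable_le {Ω ι : Type} [Finite Ω] [MeasurableSpace Ω]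
    [MeasurableSingletonClass Ω] {μ : Measure Ω} [IsProbabilityMeasure μ] [Fintype ι]
    {X : Ω → ι → ℝ} (hX : IsSubexpRow μ X) (S : Finset ι) {N ℓ : ℝ} (hℓ : 0 < ℓ)
    (hN : (Fintype.card ι : ℝ) ≤ N) (hlog : S.Nonempty → ℓ ≤ Real.log (N / S.card)) {n : ℕ}
    (hn : 2 ^ 89 * (1 + 1 / ℓ) * (S.card * Real.log (N / S.card)) ≤ n) :
    (Measure.pi fun _ : Fin n => μ).real {ω | ¬ IsStableOn S (sampleMatrix X ω)}
      ≤ Real.exp (-(n / 2 ^ 26)) := by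
  rcases S.eq_empty_or_nonempty with rfl | hS
  · simp only [isStableOn_empty, not_true_eq_false, Set.ofPred_false, measureReal_empty]
    positivity
  · have hs : (0 : ℝ) < S.card := by exact_mod_cast Finset.card_pos.2 hS
    have hsN : (S.card : ℝ) ≤ N := le_trans (by exact_mod_cast Finset.card_le_univ S) hN
    have hN0 : 0 < N := hs.trans_le hsN
    have hl := hlog hS
    have h1 := hX.measureReal_cone_le S hS (lam := S.card / N) (by positivity)
      ((div_le_one hN0).2 hsN) (by
        rw [div_mul_eq_mul_div, div_le_iff₀ hN0]
        gcongr) (n := n) (by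
        refine le_trans ?_ hn
        rw [inv_div]
        have h2 : 1 ≤ 1 / ℓ * Real.log (N / S.card) := by
          rw [one_div, ← div_eq_inv_mul, le_div_iff₀ hℓ]
          linarith
        nlinarith)
    refine le_trans (measureReal_mono ?_) h1
    intro ω hω
    simp only [Set.mem_ofPred_eq, IsStableOn, not_forall, not_le] at hω ⊢
    obtain ⟨h, hh, i, hi⟩ := hω
    exact ⟨h, hh, i, hi⟩

theorem two_mul_card_pair_le (d : ℕ) : 2 * Fintype.card (Pair d) ≤ d ^ 2 := by
  have hinj : Function.Injective fun x : Bool × Pair d =>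
      if x.1 then (x.2 : Fin d × Fin d) else (x.2 : Fin d × Fin d).swap := by
    rintro ⟨b, ⟨⟨i, j⟩, hij⟩⟩ ⟨b', ⟨⟨i', j'⟩, hij'⟩⟩ h
    simp only at hij hij'
    cases b <;> cases b' <;> simp at h ⊢ <;> omega
  have := Fintype.card_le_of_injective _ hinj
  simpa [sq] using this

variable {d : ℕ}

/-- Ordered pairs with `j₁ < j₂` number at most `d² / 2`; hence the first-stage constant is
absolute. -/
theorem log_two_le_log_div {S₂ : Finset (Pair d)} (hS : S₂.Nonempty) :
    Real.log 2 ≤ Real.log ((d : ℝ) ^ 2 / S₂.card) := by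
  have hs : (0 : ℝ) < S₂.card := by exact_mod_cast Finset.card_pos.2 hS
  apply Real.log_le_log (by norm_num)
  rw [le_div_iff₀ hs]
  have h1 : 2 * S₂.card ≤ d ^ 2 :=
    (Nat.mul_le_mul_left 2 (Finset.card_le_univ S₂)).trans (two_mul_card_pair_le d)
  exact_mod_cast h1

theorem complexity₂_nonneg (S₂ : Finset (Pair d)) : 0 ≤ complexity₂ S₂ := by
  unfold complexity₂
  rcases S₂.eq_empty_or_nonempty with rfl | hS
  · simp
  · have h1 := log_two_le_log_div hS
    have h2 := Real.log_pos (show (1 : ℝ) < 2 by norm_num)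
    exact mul_nonneg (Nat.cast_nonneg _) (by linarith)

/-- The role of `θ`: it keeps the logarithm in `complexity₁` away from `0`, and this is how the
second-stage constant depends on `θ`. -/
theorem neg_log_le_log_div {θ N s : ℝ} (hθ : 0 < θ) (hs : 0 < s) (h : s ≤ θ * N) :
    -Real.log θ ≤ Real.log (N / s) := by
  rw [← Real.log_inv]
  apply Real.log_le_log (inv_pos.2 hθ)
  rw [le_div_iff₀ hs, inv_mul_le_iff₀ hθ]
  exact h

theorem complexity₁_nonneg {S₁ : Finset (Fin d)} {S₂ : Finset (Pair d)} {θ : ℝ} (hθ : 0 < θ)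
    (hθ1 : θ < 1) (h : (S₁.card : ℝ) ≤ θ * ((d : ℝ) - (pairVars S₂).card)) :
    0 ≤ complexity₁ S₁ S₂ := by
  unfold complexity₁
  rcases S₁.eq_empty_or_nonempty with rfl | hS
  · simp
  · have h1 := neg_log_le_log_div hθ (by exact_mod_cast Finset.card_pos.2 hS) h
    have h2 := Real.log_neg hθ hθ1
    exact mul_nonneg (Nat.cast_nonneg _) (by linarith)

theorem measureReal_not_stable₂_le (S₂ : Finset (Pair d)) {n : ℕ}
    (hn : 2 ^ 89 * (1 + 1 / Real.log 2) * complexity₂ S₂ ≤ n) :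
    (Measure.pi fun _ : Fin n => signLaw (Fin d)).real {β | ¬ IsStableOn S₂ (signMatrix₂ β)}
      ≤ Real.exp (-(n / 2 ^ 26)) := by
  refine isSubexpRow_chaos.measureReal_not_stable_le S₂ (Real.log_pos (by norm_num)) ?_
    log_two_le_log_div hn
  have h1 := two_mul_card_pair_le d
  have h2 : Fintype.card (Pair d) ≤ d ^ 2 := by omega
  exact_mod_cast h2

theorem measureReal_not_stable₁_le {S₁ : Finset (Fin d)} {S₂ : Finset (Pair d)} {θ : ℝ}
    (hθ : 0 < θ) (hθ1 : θ < 1) (h : (S₁.card : ℝ) ≤ θ * ((d : ℝ) - (pairVars S₂).card))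
    (hsub : S₁ ⊆ (pairVars S₂)ᶜ) {n : ℕ}
    (hn : 2 ^ 89 * (1 + 1 / -Real.log θ) * complexity₁ S₁ S₂ ≤ n) :
    (Measure.pi fun _ : Fin n => signLaw (Fin d)).real
        {β | ¬ IsStableOn (S₁.subtype (· ∈ (pairVars S₂)ᶜ)) (signMatrix₁ (pairVars S₂)ᶜ β)}
      ≤ Real.exp (-(n / 2 ^ 26)) := by
  have hcard : (S₁.subtype (· ∈ (pairVars S₂)ᶜ)).card = S₁.card := by
    rw [Finset.card_subtype, Finset.filter_true_of_mem hsub]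
  refine (isSubexpRow_linear (pairVars S₂)ᶜ).measureReal_not_stable_le _
    (N := (d : ℝ) - (pairVars S₂).card) (neg_pos.2 (Real.log_neg hθ hθ1)) ?_ ?_ ?_
  · rw [Fintype.card_coe, Finset.card_compl, Fintype.card_fin,
      Nat.cast_sub ((Finset.card_le_univ _).trans_eq (Fintype.card_fin d))]
  · intro hne
    rw [← Finset.card_pos, hcard] at hne
    rw [hcard]
    exact neg_log_le_log_div hθ (by exact_mod_cast hne) h
  · rw [hcard]
    exact hn

end Stability

/-! ### The noise of the two stages -/

section NoiseBounds

variable {d : ℕ} {σ ε : ℝ}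

theorem sum_sq_coeff {T N : ℕ} (a : Fin T → ℝ) (ha : ∀ t, a t ^ 2 = 1) (hN : 0 < N) :
    ∑ k : Fin T × Fin N, (a k.1 / N) ^ 2 = T / N := by
  have hN' : (N : ℝ) ≠ 0 := by exact_mod_cast hN.ne'
  simp only [div_pow, ha]
  rw [Finset.sum_const, Finset.card_univ, Fintype.card_prod, Fintype.card_fin, Fintype.card_fin,
    nsmul_eq_mul]
  push_cast
  field_simp

theorem l2norm_le_of_sum_sq_le {n : ℕ} {v : Fin n → ℝ} {a s : ℝ} (ha : 0 ≤ a) (hs : 0 ≤ s)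
    (h : ∑ i, v i ^ 2 ≤ a ^ 2 * s ^ 2 * n) : l2norm v ≤ a * s * √(n : ℝ) := by
  rw [l2norm, Real.sqrt_le_left (by positivity), mul_pow, mul_pow,
    Real.sq_sqrt (Nat.cast_nonneg n)]
  exact h

/-- A measurement combines four averages of `N₂` answers, hence has standard deviation `2σ / √N₂`;
passing from `ℓ₂` to `ℓ₁` contributes `√n₂`. -/
theorem measureReal_noise₂_le (A : Params d) (hσ : 0 < σ) (hε : 0 < ε) (hε1 : ε < 1)
    (hN : 0 < A.N₂) (l : Fin A.M) (c : Fin (2 * A.m₂ + 1) × Fin (2 * A.m₂ + 1)) :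
    (Measure.pi fun _ : Query A => gaussianReal 0 (σ ^ 2).toNNReal).real
        {ω | ¬ l1norm (noise₂ A (fun q => ω (Sum.inl q)) l c)
          ≤ 2 * σ * (1 + ε) * A.n₂ / √(A.N₂ : ℝ)}
      ≤ Real.exp (-(3 / 8 * ε ^ 2 * A.n₂)) := by
  have hN' : (0 : ℝ) < A.N₂ := by exact_mod_cast hN
  have hs : 0 < 2 * σ / √(A.N₂ : ℝ) := by positivity
  have h1 := measureReal_noise_gt_le (Q := Query A) (K := Fin 4 × Fin A.N₂) (n := A.n₂)
    (e := fun x => Sum.inl (l, c, x.1, x.2.1, x.2.2))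
    (by rintro ⟨i, t, r⟩ ⟨i', t', r'⟩ h; simpa using h)
    (fun k => ![1, -1, -1, 1] k.1 / A.N₂) (σ := σ) (s := 2 * σ / √(A.N₂ : ℝ)) (ε := ε) hs
    (by
      rw [sum_sq_coeff _ (by intro t; fin_cases t <;> simp) hN, div_pow, Real.sq_sqrt hN'.le]
      push_cast
      ring) hε hε1
  refine le_trans (measureReal_mono ?_) h1
  intro ω hω hle
  apply hω
  have h2 : l2norm (noise₂ A (fun q => ω (Sum.inl q)) l c)
      ≤ (1 + ε) * (2 * σ / √(A.N₂ : ℝ)) * √(A.n₂ : ℝ) :=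
    l2norm_le_of_sum_sq_le (by positivity) hs.le hle
  calc l1norm (noise₂ A (fun q => ω (Sum.inl q)) l c)
      ≤ √(A.n₂ : ℝ) * ((1 + ε) * (2 * σ / √(A.N₂ : ℝ)) * √(A.n₂ : ℝ)) := by
        refine (l1norm_le_sqrt_card_mul_l2norm _).trans ?_
        rw [Fintype.card_fin]
        gcongr
    _ = (√(A.n₂ : ℝ) * √(A.n₂ : ℝ)) * ((1 + ε) * (2 * σ / √(A.N₂ : ℝ))) := by ring
    _ = _ := by
        rw [Real.mul_self_sqrt (Nat.cast_nonneg _)]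
        ring

theorem measureReal_noise₁_le (A : Params d) (hσ : 0 < σ) (hε : 0 < ε) (hε1 : ε < 1)
    (hN : 0 < A.N₁) (c : Fin (2 * A.m₁ + 1)) :
    (Measure.pi fun _ : Query A => gaussianReal 0 (σ ^ 2).toNNReal).real
        {ω | ¬ l2norm (noise₁ A (fun q => ω (Sum.inr q)) c)
          ≤ √2 * (1 + ε) * σ * √((A.n₁ : ℝ) / A.N₁)}
      ≤ Real.exp (-(3 / 8 * ε ^ 2 * A.n₁)) := by
  have hN' : (0 : ℝ) < A.N₁ := by exact_mod_cast hN
  have hs : 0 < √2 * σ / √(A.N₁ : ℝ) := by positivity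
  have h1 := measureReal_noise_gt_le (Q := Query A) (K := Fin 2 × Fin A.N₁) (n := A.n₁)
    (e := fun x => Sum.inr (c, x.1, x.2.1, x.2.2))
    (by rintro ⟨i, t, r⟩ ⟨i', t', r'⟩ h; simpa using h)
    (fun k => ![1, -1] k.1 / A.N₁) (σ := σ) (s := √2 * σ / √(A.N₁ : ℝ)) (ε := ε) hs
    (by
      rw [sum_sq_coeff _ (by intro t; fin_cases t <;> simp) hN, div_pow, mul_pow,
        Real.sq_sqrt hN'.le, Real.sq_sqrt (by norm_num)]
      push_cast
      ring) hε hε1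
  refine le_trans (measureReal_mono ?_) h1
  intro ω hω hle
  apply hω
  have h2 : l2norm (noise₁ A (fun q => ω (Sum.inr q)) c)
      ≤ (1 + ε) * (√2 * σ / √(A.N₁ : ℝ)) * √(A.n₁ : ℝ) :=
    l2norm_le_of_sum_sq_le (by positivity) hs.le hle
  refine h2.trans (le_of_eq ?_)
  rw [Real.sqrt_div (Nat.cast_nonneg _)]
  ring

/-- A union bound over `K` events of exponentially small probability. -/
theorem card_mul_exp_le {K : ℕ} {a n : ℝ} (ha : 0 < a)
    (h : 0 < K → 2 * Real.log K / a ≤ n) :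
    K * Real.exp (-(a * n)) ≤ Real.exp (-(a * n / 2)) := by
  rcases Nat.eq_zero_or_pos K with rfl | hK
  · simp only [Nat.cast_zero, zero_mul]
    positivity
  · have hK' : (0 : ℝ) < K := by exact_mod_cast hK
    have h1 := h hK
    rw [div_le_iff₀ ha] at h1
    rw [← Real.exp_log hK', ← Real.exp_add]
    apply Real.exp_le_exp.2
    linarith

theorem measureReal_exists_noise₂_le (A : Params d) (hσ : 0 < σ) (hε : 0 < ε) (hε1 : ε < 1)
    (hN : 0 < A.N₂) (hn : 2 * Real.log ((2 * (A.m₂ : ℝ) + 1) ^ 2 * Real.exp 1 * (A.M : ℝ))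
      / (3 / 8 * ε ^ 2) ≤ A.n₂) :
    (Measure.pi fun _ : Query A => gaussianReal 0 (σ ^ 2).toNNReal).real
        {ω | ¬ ∀ l c, l1norm (noise₂ A (fun q => ω (Sum.inl q)) l c)
          ≤ 2 * σ * (1 + ε) * A.n₂ / √(A.N₂ : ℝ)}
      ≤ Real.exp (-(3 / 8 * ε ^ 2 * A.n₂ / 2)) := by
  set π := Measure.pi fun _ : Query A => gaussianReal 0 (σ ^ 2).toNNReal
  set bad : Fin A.M × (Fin (2 * A.m₂ + 1) × Fin (2 * A.m₂ + 1)) → Set (Query A → ℝ) := fun x =>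
    {ω | ¬ l1norm (noise₂ A (fun q => ω (Sum.inl q)) x.1 x.2)
          ≤ 2 * σ * (1 + ε) * A.n₂ / √(A.N₂ : ℝ)} with hbad
  have hset : {ω : Query A → ℝ | ¬ ∀ l c, l1norm (noise₂ A (fun q => ω (Sum.inl q)) l c)
          ≤ 2 * σ * (1 + ε) * A.n₂ / √(A.N₂ : ℝ)} = ⋃ x, bad x := by
    ext ω
    simp [hbad]
  rw [hset]
  refine (measureReal_iUnion_fintype_le _).trans ?_
  calc ∑ x, π.real (bad x)
      ≤ ∑ _x : Fin A.M × (Fin (2 * A.m₂ + 1) × Fin (2 * A.m₂ + 1)),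
          Real.exp (-(3 / 8 * ε ^ 2 * A.n₂)) :=
        Finset.sum_le_sum fun x _ => measureReal_noise₂_le A hσ hε hε1 hN x.1 x.2
    _ = (A.M * ((2 * A.m₂ + 1) * (2 * A.m₂ + 1)) : ℕ) * Real.exp (-(3 / 8 * ε ^ 2 * A.n₂)) := by
        simp
    _ ≤ Real.exp (-(3 / 8 * ε ^ 2 * A.n₂ / 2)) := by
        refine card_mul_exp_le (by positivity) fun hK => le_trans ?_ hn
        have hM : (0 : ℝ) < A.M := by exact_mod_cast Nat.pos_of_mul_pos_right hK
        push_cast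
        refine div_le_div_of_nonneg_right (mul_le_mul_of_nonneg_left
          (Real.log_le_log (by positivity) ?_) (by norm_num)) (by positivity)
        have h1 : 1 ≤ Real.exp 1 := Real.one_le_exp (by norm_num)
        have h2 : 0 ≤ (A.M : ℝ) * (2 * A.m₂ + 1) ^ 2 := by positivity
        nlinarith

theorem measureReal_exists_noise₁_le (A : Params d) (hσ : 0 < σ) (hε : 0 < ε) (hε1 : ε < 1)
    (hN : 0 < A.N₁) (hn : 2 * Real.log (2 * (A.m₁ : ℝ) + 1) / (3 / 8 * ε ^ 2) ≤ A.n₁) :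
    (Measure.pi fun _ : Query A => gaussianReal 0 (σ ^ 2).toNNReal).real
        {ω | ¬ ∀ c, l2norm (noise₁ A (fun q => ω (Sum.inr q)) c)
          ≤ √2 * (1 + ε) * σ * √((A.n₁ : ℝ) / A.N₁)}
      ≤ Real.exp (-(3 / 8 * ε ^ 2 * A.n₁ / 2)) := by
  set π := Measure.pi fun _ : Query A => gaussianReal 0 (σ ^ 2).toNNReal
  set bad : Fin (2 * A.m₁ + 1) → Set (Query A → ℝ) := fun c =>
    {ω | ¬ l2norm (noise₁ A (fun q => ω (Sum.inr q)) c)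
          ≤ √2 * (1 + ε) * σ * √((A.n₁ : ℝ) / A.N₁)} with hbad
  have hset : {ω : Query A → ℝ | ¬ ∀ c, l2norm (noise₁ A (fun q => ω (Sum.inr q)) c)
          ≤ √2 * (1 + ε) * σ * √((A.n₁ : ℝ) / A.N₁)} = ⋃ c, bad c := by
    ext ω
    simp [hbad]
  rw [hset]
  refine (measureReal_iUnion_fintype_le _).trans ?_
  calc ∑ c, π.real (bad c)
      ≤ ∑ _c : Fin (2 * A.m₁ + 1), Real.exp (-(3 / 8 * ε ^ 2 * A.n₁)) :=
        Finset.sum_le_sum fun c _ => measureReal_noise₁_le A hσ hε hε1 hN c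
    _ = (2 * A.m₁ + 1 : ℕ) * Real.exp (-(3 / 8 * ε ^ 2 * A.n₁)) := by simp
    _ ≤ Real.exp (-(3 / 8 * ε ^ 2 * A.n₁ / 2)) := by
        refine card_mul_exp_le (by positivity) fun hK => le_trans ?_ hn
        push_cast
        rfl

end NoiseBounds

/-! ### The good event -/

section GoodEvent

variable {d : ℕ} {σ ε : ℝ}

/-- Both sign matrices are stable and the noise of all measurements is small. -/
def goodEvent (A : Params d) (S₁ : Finset (Fin d)) (S₂ : Finset (Pair d)) (σ ε : ℝ) :
    Set (Outcome A) :=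
  {ω | IsStableOn S₂ (signMatrix₂ ω.1) ∧
    IsStableOn (S₁.subtype (· ∈ (pairVars S₂)ᶜ)) (signMatrix₁ (pairVars S₂)ᶜ ω.2.1) ∧
    (∀ l c, l1norm (noise₂ A (fun q => ω.2.2 (Sum.inl q)) l c)
      ≤ 2 * σ * (1 + ε) * A.n₂ / √(A.N₂ : ℝ)) ∧
    ∀ c, l2norm (noise₁ A (fun q => ω.2.2 (Sum.inr q)) c)
      ≤ √2 * (1 + ε) * σ * √((A.n₁ : ℝ) / A.N₁)}

/-- Stability concerns sign arrays in a finite space, where every set is measurable; only the noise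
conditions require an argument. -/
theorem measurableSet_goodEvent (A : Params d) (S₁ : Finset (Fin d)) (S₂ : Finset (Pair d))
    (σ ε : ℝ) : MeasurableSet (goodEvent A S₁ S₂ σ ε) := by
  have h1 : MeasurableSet {ω : Outcome A | IsStableOn S₂ (signMatrix₂ ω.1)} :=
    measurable_fst (Set.toFinite {β | IsStableOn S₂ (signMatrix₂ β)}).measurableSet
  have h2 : MeasurableSet {ω : Outcome A |
      IsStableOn (S₁.subtype (· ∈ (pairVars S₂)ᶜ)) (signMatrix₁ (pairVars S₂)ᶜ ω.2.1)} :=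
    (measurable_fst.comp measurable_snd) (Set.toFinite {β : Fin A.n₁ → Fin d → Bool |
      IsStableOn (S₁.subtype (· ∈ (pairVars S₂)ᶜ)) (signMatrix₁ (pairVars S₂)ᶜ β)}).measurableSet
  have h3 : MeasurableSet {ω : Outcome A | ∀ l c,
      l1norm (noise₂ A (fun q => ω.2.2 (Sum.inl q)) l c)
        ≤ 2 * σ * (1 + ε) * A.n₂ / √(A.N₂ : ℝ)} := by
    simp only [Set.ofPred_forall]
    refine MeasurableSet.iInter fun l => MeasurableSet.iInter fun c => ?_
    refine measurableSet_le ?_ measurable_const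
    unfold l1norm noise₂
    fun_prop
  have h4 : MeasurableSet {ω : Outcome A | ∀ c,
      l2norm (noise₁ A (fun q => ω.2.2 (Sum.inr q)) c)
        ≤ √2 * (1 + ε) * σ * √((A.n₁ : ℝ) / A.N₁)} := by
    simp only [Set.ofPred_forall]
    refine MeasurableSet.iInter fun c => measurableSet_le ?_ measurable_const
    unfold l2norm noise₁
    fun_prop
  exact h1.inter (h2.inter (h3.inter h4))

instance (A : Params d) (σ : ℝ) : IsProbabilityMeasure (law A σ) := by
  unfold law
  infer_instance

/-- Each way to fail depends on a single factor of the product law, because the active set in the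
event is the true, deterministic one; a union bound suffices. -/
theorem le_measureReal_goodEvent (A : Params d) {S₁ : Finset (Fin d)} {S₂ : Finset (Pair d)}
    {p₂ p₁ q₂ q₁ : ℝ}
    (h₂ : (Measure.pi fun _ : Fin A.n₂ => signLaw (Fin d)).real
      {β | ¬ IsStableOn S₂ (signMatrix₂ β)} ≤ p₂)
    (h₁ : (Measure.pi fun _ : Fin A.n₁ => signLaw (Fin d)).real
      {β | ¬ IsStableOn (S₁.subtype (· ∈ (pairVars S₂)ᶜ)) (signMatrix₁ (pairVars S₂)ᶜ β)} ≤ p₁)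
    (hq₂ : (Measure.pi fun _ : Query A => gaussianReal 0 (σ ^ 2).toNNReal).real
        {ω | ¬ ∀ l c, l1norm (noise₂ A (fun q => ω (Sum.inl q)) l c)
          ≤ 2 * σ * (1 + ε) * A.n₂ / √(A.N₂ : ℝ)} ≤ q₂)
    (hq₁ : (Measure.pi fun _ : Query A => gaussianReal 0 (σ ^ 2).toNNReal).real
        {ω | ¬ ∀ c, l2norm (noise₁ A (fun q => ω (Sum.inr q)) c)
          ≤ √2 * (1 + ε) * σ * √((A.n₁ : ℝ) / A.N₁)} ≤ q₁) :
    1 - p₂ - q₂ - p₁ - q₁ ≤ (law A σ).real (goodEvent A S₁ S₂ σ ε) := by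
  set μ₂ := Measure.pi fun _ : Fin A.n₂ => signLaw (Fin d)
  set μ₁ := Measure.pi fun _ : Fin A.n₁ => signLaw (Fin d)
  set π := Measure.pi fun _ : Query A => gaussianReal 0 (σ ^ 2).toNNReal
  have hlaw : law A σ = μ₂.prod (μ₁.prod π) := rfl
  set B₂ : Set (Fin A.n₂ → Fin d → Bool) := {β | ¬ IsStableOn S₂ (signMatrix₂ β)}
  set B₁ : Set (Fin A.n₁ → Fin d → Bool) :=
    {β | ¬ IsStableOn (S₁.subtype (· ∈ (pairVars S₂)ᶜ)) (signMatrix₁ (pairVars S₂)ᶜ β)}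
  set W₂ : Set (Query A → ℝ) := {ω | ¬ ∀ l c, l1norm (noise₂ A (fun q => ω (Sum.inl q)) l c)
          ≤ 2 * σ * (1 + ε) * A.n₂ / √(A.N₂ : ℝ)}
  set W₁ : Set (Query A → ℝ) := {ω | ¬ ∀ c, l2norm (noise₁ A (fun q => ω (Sum.inr q)) c)
          ≤ √2 * (1 + ε) * σ * √((A.n₁ : ℝ) / A.N₁)}
  have hcompl : (goodEvent A S₁ S₂ σ ε)ᶜ ⊆ (B₂ ×ˢ Set.univ) ∪ ((Set.univ ×ˢ (B₁ ×ˢ Set.univ)) ∪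
      ((Set.univ ×ˢ (Set.univ ×ˢ W₂)) ∪ (Set.univ ×ˢ (Set.univ ×ˢ W₁)))) := by
    intro ω hω
    by_contra hcon
    simp only [Set.mem_union, Set.mem_prod, Set.mem_univ, true_and, and_true, not_or] at hcon
    exact hω ⟨not_not.1 hcon.1, not_not.1 hcon.2.1, not_not.1 hcon.2.2.1, not_not.1 hcon.2.2.2⟩
  have hle : (law A σ).real (goodEvent A S₁ S₂ σ ε)ᶜ ≤ p₂ + (p₁ + (q₂ + q₁)) := by
    refine (measureReal_mono hcompl).trans ?_
    refine (measureReal_union_le _ _).trans (add_le_add ?_ ?_)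
    · rw [hlaw, measureReal_prod_prod, probReal_univ, mul_one]
      exact h₂
    · refine (measureReal_union_le _ _).trans (add_le_add ?_ ?_)
      · rw [hlaw, measureReal_prod_prod, measureReal_prod_prod, probReal_univ, probReal_univ,
          mul_one, one_mul]
        exact h₁
      · refine (measureReal_union_le _ _).trans (add_le_add ?_ ?_)
        · rw [hlaw, measureReal_prod_prod, measureReal_prod_prod, probReal_univ, probReal_univ,
            one_mul, one_mul]
          exact hq₂
        · rw [hlaw, measureReal_prod_prod, measureReal_prod_prod, probReal_univ, probReal_univ,
            one_mul, one_mul]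
          exact hq₁
  rw [probReal_compl_eq_one_sub (measurableSet_goodEvent A S₁ S₂ σ ε)] at hle
  linarith

end GoodEvent

/-! ### Thresholds -/

theorem div_sqrt_le_third {c D x : ℝ} {N : ℕ} (hD : 0 < D)
    (hx : x = 9 * c ^ 2 / D ^ 2) (hN : ⌊x⌋₊ + 1 ≤ N) : c / √(N : ℝ) ≤ D / 3 := by
  have h1 : x < N := (Nat.lt_floor_add_one x).trans_le (by exact_mod_cast hN)
  have hN0 : (0 : ℝ) < N := by exact_mod_cast (by omega : 0 < N)
  rw [hx, div_lt_iff₀ (by positivity)] at h1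
  rw [div_le_iff₀ (Real.sqrt_pos.2 hN0)]
  apply le_of_sq_le_sq _ (by positivity)
  rw [mul_pow, Real.sq_sqrt hN0.le]
  linarith

/-! ### Exact recovery -/

theorem output_eq {d : ℕ} {A : Params d} {f : (Fin d → ℝ) → ℝ} {R₂ : SparseRec A.n₂ (Pair d)}
    {R₁ : (P : Finset (Fin d)) → SparseRec A.n₁ P} {ω : Outcome A} {T₂ : Finset (Pair d)}
    {T₁ : Finset (Fin d)}
    (h₂ : estimate₂ A R₂ ω.1 (fun q => f (queryPoint₂ A ω.1 q) + ω.2.2 (Sum.inl q)) = T₂)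
    (h₁ : estimate₁ A (pairVars T₂)ᶜ (R₁ (pairVars T₂)ᶜ) ω.2.1
      (fun q => f (queryPoint₁ A (pairVars T₂)ᶜ ω.2.1 q) + ω.2.2 (Sum.inr q)) = T₁) :
    output A f R₂ R₁ ω = (T₂, T₁) := by
  subst h₂
  subst h₁
  rfl

theorem IsBivariateModel.exact_recovery {d : ℕ} {f : (Fin d → ℝ) → ℝ} {S₁ : Finset (Fin d)}
    {S₂ : Finset (Pair d)} {φ : Fin d → ℝ → ℝ} {ψ : Pair d → ℝ → ℝ → ℝ} {L α D₁ D₂ : ℝ}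
    (hf : IsBivariateModel f S₁ S₂ φ ψ L α D₁ D₂) {σ ε : ℝ} {A : Params d}
    (hL : 0 < L) (hα : 0 < α) (hD₁ : 0 < D₁) (hD₂ : 0 < D₂)
    (hH : IsHashFamily A.hash) (hN₂ : 0 < A.N₂) (hN₁ : 0 < A.N₁) (hn₂ : 0 < A.n₂) (hn₁ : 0 < A.n₁)
    (ht₂ : A.thr₂ = 2 ^ 15 * (1 + ε) * (2 * σ / √(A.N₂ : ℝ))) (ht₂' : A.thr₂ ≤ D₂ / 3)
    (ht₁ : A.thr₁ = √2 * 2 ^ 15 * (1 + ε) * σ / √(A.N₁ : ℝ)) (ht₁' : A.thr₁ ≤ D₁ / 3)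
    (hm₂ : √2 * (3 * L / D₂) ^ (1 / α) ≤ A.m₂) (hm₁ : (3 * L / D₁) ^ (1 / α) ≤ A.m₁)
    {ω : Outcome A} (hω : ω ∈ goodEvent A S₁ S₂ σ ε) {R₂ : SparseRec A.n₂ (Pair d)}
    {R₁ : (P : Finset (Fin d)) → SparseRec A.n₁ P}
    (hR₂ : R₂.IsP2 (2 * σ * (1 + ε) * A.n₂ / √(A.N₂ : ℝ)))
    (hR₁ : ∀ P, (R₁ P).IsP1 (√2 * (1 + ε) * σ * √((A.n₁ : ℝ) / A.N₁))) :
    output A f R₂ R₁ ω = (S₂, S₁) := by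
  obtain ⟨h2, h1, hw2, hw1⟩ := hω
  have hT₂ := hf.estimate₂_eq hL hα hD₂ A hH hm₂ hN₂ hn₂ (by
    rw [ht₂]
    refine le_of_eq ?_
    ring) ht₂' hR₂ h2 hw2
  have hT₁ := hf.estimate₁_eq hL hα hD₁ A hm₁ hN₁ hn₁ (by
    rw [ht₁, Real.sqrt_div (Nat.cast_nonneg _)]
    refine le_of_eq ?_
    calc 2 ^ 15 * (√(A.n₁ : ℝ) * (√2 * (1 + ε) * σ * (√(A.n₁ : ℝ) / √(A.N₁ : ℝ))))
        = (√(A.n₁ : ℝ) * √(A.n₁ : ℝ)) * (√2 * 2 ^ 15 * (1 + ε) * σ / √(A.N₁ : ℝ)) := by ring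
      _ = _ := by rw [Real.mul_self_sqrt (Nat.cast_nonneg _)]) ht₁' rfl
    (hR₁ (pairVars S₂)ᶜ) h1 hw1
  exact output_eq hT₂ hT₁

/-! ### The number of queries -/

theorem numQueries_eq {d : ℕ} (A : Params d) : numQueries A =
    4 * (2 * A.m₂ + 1) ^ 2 * A.n₂ * A.N₂ * A.M + 2 * (2 * A.m₁ + 1) * A.n₁ * A.N₁ := by
  simp only [numQueries, Fintype.card_sum, Fintype.card_prod, Fintype.card_fin]
  ring

/-- The number of repetitions is at least of the order `1 + σ² / D²`. -/
theorem half_le_repetitions {x κ : ℝ} {N : ℕ} (hκ : κ ≤ x) (hN : ⌊x⌋₊ + 1 ≤ N) :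
    (1 + κ) / 2 ≤ N := by
  have h1 : x < N := (Nat.lt_floor_add_one x).trans_le (by exact_mod_cast hN)
  have h2 : (1 : ℝ) ≤ N := by exact_mod_cast (by omega : 1 ≤ N)
  linarith

theorem repetitions_le {x κ C : ℝ} (hx : 0 ≤ x) (hC : 1 ≤ C) (h : x ≤ C * κ) :
    ((⌊x⌋₊ + 1 : ℕ) : ℝ) ≤ C * (1 + κ) := by
  have := Nat.floor_le hx
  push_cast
  linarith

/-- `2 / (3/8) = 16/3`, and the `1` lost to the ceiling is at most `lg / ε²`; both fit into the `8`.
-/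
theorem measurements_le {a b c lg ε : ℝ} (ha : 0 ≤ a) (hc : 0 ≤ c) (hε : 0 < ε) (hε1 : ε < 1)
    (hlg : 1 ≤ lg) (hb : b = 2 * lg / (3 / 8 * ε ^ 2)) :
    ((⌈max (a * c) b⌉₊ : ℕ) : ℝ) ≤ (a + 8) * (c + lg / ε ^ 2) := by
  have hb' : b = 16 / 3 * (lg / ε ^ 2) := by rw [hb]; field_simp; norm_num
  have h1 : 1 ≤ lg / ε ^ 2 := by
    rw [le_div_iff₀ (by positivity)]
    nlinarith
  have hac : 0 ≤ a * c := mul_nonneg ha hc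
  have h2 : 0 ≤ max (a * c) b := hac.trans (le_max_left _ _)
  have h3 : max (a * c) b ≤ a * c + b := max_le (by linarith) (by linarith)
  have h4 := (Nat.ceil_lt_add_one h2).le
  nlinarith [mul_nonneg ha (by linarith : 0 ≤ lg / ε ^ 2)]

theorem le_numQueries {d : ℕ} {A : Params d} {L D₁ D₂ α σ c₁ c₂ : ℝ} (hL : 0 < L)
    (hD₁ : 0 < D₁) (hD₂ : 0 < D₂) (hc₁ : 0 ≤ c₁) (hc₂ : 0 ≤ c₂)
    (hN₂ : (1 + σ ^ 2 / D₂ ^ 2) / 2 ≤ A.N₂) (hN₁ : (1 + σ ^ 2 / D₁ ^ 2) / 2 ≤ A.N₁)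
    (hm₂ : (3 * L / D₂) ^ (1 / α) ≤ A.m₂) (hm₁ : (3 * L / D₁) ^ (1 / α) ≤ A.m₁)
    (hn₂ : c₂ ≤ A.n₂) (hn₁ : c₁ ≤ A.n₁) :
    costFactor 2 L D₂ α σ * c₂ * A.M + costFactor 1 L D₁ α σ * c₁ ≤ (numQueries A : ℝ) := by
  rw [numQueries_eq]
  push_cast
  unfold costFactor
  set T₂ := (3 * L / D₂) ^ (1 / α)
  set T₁ := (3 * L / D₁) ^ (1 / α)
  have hT₂ : 0 < T₂ := by positivity
  have hT₁ : 0 < T₁ := by positivity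
  refine add_le_add ?_ ?_
  · calc (1 + T₂) ^ 2 * (1 + σ ^ 2 / D₂ ^ 2) * c₂ * (A.M : ℝ)
        = 2 * ((1 + T₂) ^ 2 * c₂ * ((1 + σ ^ 2 / D₂ ^ 2) / 2) * (A.M : ℝ)) := by ring
      _ ≤ 2 * ((2 * (A.m₂ : ℝ) + 1) ^ 2 * A.n₂ * A.N₂ * A.M) := by
          have : 1 + T₂ ≤ 2 * (A.m₂ : ℝ) + 1 := by linarith
          gcongr
      _ ≤ 4 * (2 * (A.m₂ : ℝ) + 1) ^ 2 * A.n₂ * A.N₂ * A.M := by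
          have : (0 : ℝ) ≤ (2 * (A.m₂ : ℝ) + 1) ^ 2 * A.n₂ * A.N₂ * A.M := by positivity
          linarith
  · calc (1 + T₁) ^ 1 * (1 + σ ^ 2 / D₁ ^ 2) * c₁
        = 2 * ((1 + T₁) * c₁ * ((1 + σ ^ 2 / D₁ ^ 2) / 2)) := by ring
      _ ≤ 2 * ((2 * (A.m₁ : ℝ) + 1) * A.n₁ * A.N₁) := by
          have : 1 + T₁ ≤ 2 * (A.m₁ : ℝ) + 1 := by linarith
          gcongr
      _ = 2 * (2 * (A.m₁ : ℝ) + 1) * A.n₁ * A.N₁ := by ring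

theorem numQueries_le {d : ℕ} {A : Params d} {L D₁ D₂ α σ C a₁ a₂ e₁ e₂ : ℝ} (hL : 0 < L)
    (hD₁ : 0 < D₁) (hD₂ : 0 < D₂) (hC : 0 ≤ C) (ha₁ : 0 ≤ a₁) (ha₂ : 0 ≤ a₂) (he₁ : 0 ≤ e₁)
    (he₂ : A.M ≠ 0 → 0 ≤ e₂)
    (hN₂ : (A.N₂ : ℝ) ≤ C * (1 + σ ^ 2 / D₂ ^ 2)) (hN₁ : (A.N₁ : ℝ) ≤ C * (1 + σ ^ 2 / D₁ ^ 2))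
    (hm₂ : A.m₂ = ⌈√2 * (3 * L / D₂) ^ (1 / α)⌉₊) (hm₁ : A.m₁ = ⌈(3 * L / D₁) ^ (1 / α)⌉₊)
    (hn₂ : A.M ≠ 0 → (A.n₂ : ℝ) ≤ a₂ * e₂) (hn₁ : (A.n₁ : ℝ) ≤ a₁ * e₁) :
    (numQueries A : ℝ) ≤ 36 * C * (a₁ + a₂)
      * (costFactor 2 L D₂ α σ * A.M * e₂ + costFactor 1 L D₁ α σ * e₁) := by
  rw [numQueries_eq]
  push_cast
  unfold costFactor
  set T₂ := (3 * L / D₂) ^ (1 / α)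
  set T₁ := (3 * L / D₁) ^ (1 / α)
  have hT₂ : 0 < T₂ := by positivity
  have hT₁ : 0 < T₁ := by positivity
  have hg₂ : (2 * (A.m₂ : ℝ) + 1) ≤ 3 * (1 + T₂) := by
    have h1 := (Nat.ceil_lt_add_one (show 0 ≤ √2 * T₂ by positivity)).le
    rw [← hm₂] at h1
    have h2 : √2 ≤ 3 / 2 := by
      rw [Real.sqrt_le_left (by norm_num)]
      norm_num
    nlinarith
  have hg₁ : (2 * (A.m₁ : ℝ) + 1) ≤ 3 * (1 + T₁) := by
    have h1 := (Nat.ceil_lt_add_one hT₁.le).le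
    rw [← hm₁] at h1
    linarith
  rw [mul_add (36 * C * (a₁ + a₂))]
  refine add_le_add ?_ ?_
  -- Without hash functions the first stage makes no queries. This case is separate since `log 0 =
  -- 0` by convention, so the logarithm then need not dominate the rounding of `n₂`.
  · by_cases hM : A.M = 0
    · simp [hM]
    · have he := he₂ hM
      calc 4 * (2 * (A.m₂ : ℝ) + 1) ^ 2 * A.n₂ * A.N₂ * A.M
          ≤ 4 * (3 * (1 + T₂)) ^ 2 * (a₂ * e₂) * (C * (1 + σ ^ 2 / D₂ ^ 2)) * A.M := by
            gcongr
            exact hn₂ hM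
        _ = 36 * C * a₂ * ((1 + T₂) ^ 2 * (1 + σ ^ 2 / D₂ ^ 2) * A.M * e₂) := by ring
        _ ≤ 36 * C * (a₁ + a₂) * ((1 + T₂) ^ 2 * (1 + σ ^ 2 / D₂ ^ 2) * A.M * e₂) := by
            gcongr
            linarith
  · calc 2 * (2 * (A.m₁ : ℝ) + 1) * A.n₁ * A.N₁
        ≤ 2 * (3 * (1 + T₁)) * (a₁ * e₁) * (C * (1 + σ ^ 2 / D₁ ^ 2)) := by gcongr
      _ = 6 * C * a₁ * ((1 + T₁) ^ 1 * (1 + σ ^ 2 / D₁ ^ 2) * e₁) := by ring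
      _ ≤ 36 * C * (a₁ + a₂) * ((1 + T₁) ^ 1 * (1 + σ ^ 2 / D₁ ^ 2) * e₁) := by
          gcongr
          · norm_num
          · linarith

theorem one_le_log_of_three_le {x : ℝ} (hx : 3 ≤ x) : 1 ≤ Real.log x := by
  rw [Real.le_log_iff_exp_le (by linarith)]
  linarith [Real.exp_one_lt_d9]

theorem one_le_log_mul_exp {x M : ℝ} (hx : 1 ≤ x) (hM : 1 ≤ M) :
    1 ≤ Real.log (x * Real.exp 1 * M) := by
  have h1 := Real.exp_pos 1
  rw [Real.le_log_iff_exp_le (by positivity)]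
  calc Real.exp 1 = 1 * Real.exp 1 * 1 := by ring
    _ ≤ x * Real.exp 1 * M := by gcongr

end SPAM

/-! ### Choice of the constants and assembly -/

open SPAM

theorem mainTheorem4 :
    ∃ C₂ C₄ ct₂ c₃ ct₃ ct₄ ct₅ : ℝ,
      0 < C₂ ∧ 0 < C₄ ∧ 0 < ct₂ ∧ 0 < c₃ ∧ 0 < ct₃ ∧ 0 < ct₄ ∧ 0 < ct₅ ∧
    ∀ θ : ℝ, 0 < θ → θ < 1 →
    ∃ ct₁ cLow cUp : ℝ, 0 < ct₁ ∧ 0 < cLow ∧ 0 < cUp ∧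
    ∀ (d : ℕ) (f : (Fin d → ℝ) → ℝ) (S₁ : Finset (Fin d)) (S₂ : Finset (SPAM.Pair d))
      (φ : Fin d → ℝ → ℝ) (ψ : SPAM.Pair d → ℝ → ℝ → ℝ) (L α D₁ D₂ σ ε : ℝ)
      (A : SPAM.Params d),
      0 < L → 0 < α → α ≤ 1 → 0 < D₁ → 0 < D₂ → 0 < σ → 0 < ε → ε < 1 →
      SPAM.IsBivariateModel f S₁ S₂ φ ψ L α D₁ D₂ →
      (S₁.card : ℝ) ≤ θ * ((d : ℝ) - (SPAM.pairVars S₂).card) →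
      SPAM.IsHashFamily A.hash →
      -- thresholds
      A.thr₂ = C₄ * √(2 / Real.pi) * (1 + ε) * (2 * σ / √(A.N₂ : ℝ)) →
      A.thr₁ = √2 * C₂ * (1 + ε) * σ / √(A.N₁ : ℝ) →
      -- conditions on the parameters
      ⌊72 * C₄ ^ 2 * (1 + ε) ^ 2 * σ ^ 2 / (Real.pi * D₂ ^ 2)⌋₊ + 1 ≤ A.N₂ →
      √2 * (3 * L / D₂) ^ (1 / α) ≤ (A.m₂ : ℝ) →
      max (ct₃ * SPAM.complexity₂ S₂)
        (2 * Real.log ((2 * (A.m₂ : ℝ) + 1) ^ 2 * Real.exp 1 * (A.M : ℝ)) / (ct₅ * ε ^ 2))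
          ≤ (A.n₂ : ℝ) →
      ⌊18 * C₂ ^ 2 * (1 + ε) ^ 2 * σ ^ 2 / D₁ ^ 2⌋₊ + 1 ≤ A.N₁ →
      (3 * L / D₁) ^ (1 / α) ≤ (A.m₁ : ℝ) →
      max (ct₁ * SPAM.complexity₁ S₁ S₂)
        (2 * Real.log (2 * (A.m₁ : ℝ) + 1) / (c₃ * ε ^ 2)) ≤ (A.n₁ : ℝ) →
      -- exact recovery with high probability, for all solutions of (P2) and (P1)
      (∃ E : Set (SPAM.Outcome A), MeasurableSet E ∧
        1 - Real.exp (-ct₄ * A.n₂) - Real.exp (-(ct₅ * A.n₂ * ε ^ 2 / 2))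
            - 2 * Real.exp (-ct₂ * A.n₁) - 2 * Real.exp (-(c₃ * ε ^ 2 * A.n₁ / 2))
          ≤ (SPAM.law A σ).real E ∧
        ∀ ω ∈ E, ∀ (R₂ : SPAM.SparseRec A.n₂ (SPAM.Pair d))
          (R₁ : (P : Finset (Fin d)) → SPAM.SparseRec A.n₁ P),
          R₂.IsP2 (2 * σ * (1 + ε) * A.n₂ / √(A.N₂ : ℝ)) →
          (∀ P, (R₁ P).IsP1 (√2 * (1 + ε) * σ * √((A.n₁ : ℝ) / A.N₁))) →
          SPAM.output A f R₂ R₁ ω = (S₂, S₁)) ∧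
      -- the number of queries
      SPAM.numQueries A =
        4 * (2 * A.m₂ + 1) ^ 2 * A.n₂ * A.N₂ * A.M + 2 * (2 * A.m₁ + 1) * A.n₁ * A.N₁ ∧
      cLow * (SPAM.costFactor 2 L D₂ α σ * SPAM.complexity₂ S₂ * A.M
          + SPAM.costFactor 1 L D₁ α σ * SPAM.complexity₁ S₁ S₂)
        ≤ (SPAM.numQueries A : ℝ) ∧
      -- the matching upper bound when all parameters are as small as the conditions allow
      (A.N₂ = ⌊72 * C₄ ^ 2 * (1 + ε) ^ 2 * σ ^ 2 / (Real.pi * D₂ ^ 2)⌋₊ + 1 →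
        A.m₂ = ⌈√2 * (3 * L / D₂) ^ (1 / α)⌉₊ →
        A.n₂ = ⌈max (ct₃ * SPAM.complexity₂ S₂)
          (2 * Real.log ((2 * (A.m₂ : ℝ) + 1) ^ 2 * Real.exp 1 * (A.M : ℝ)) / (ct₅ * ε ^ 2))⌉₊ →
        A.N₁ = ⌊18 * C₂ ^ 2 * (1 + ε) ^ 2 * σ ^ 2 / D₁ ^ 2⌋₊ + 1 →
        A.m₁ = ⌈(3 * L / D₁) ^ (1 / α)⌉₊ →
        A.n₁ = ⌈max (ct₁ * SPAM.complexity₁ S₁ S₂)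
          (2 * Real.log (2 * (A.m₁ : ℝ) + 1) / (c₃ * ε ^ 2))⌉₊ →
        (SPAM.numQueries A : ℝ) ≤ cUp *
          (SPAM.costFactor 2 L D₂ α σ * A.M * (SPAM.complexity₂ S₂
              + Real.log ((2 * (A.m₂ : ℝ) + 1) ^ 2 * Real.exp 1 * (A.M : ℝ)) / ε ^ 2)
            + SPAM.costFactor 1 L D₁ α σ * (SPAM.complexity₁ S₁ S₂
              + Real.log (2 * (A.m₁ : ℝ) + 1) / ε ^ 2))) := by
  have hC₄ : (2 ^ 15 * √(Real.pi / 2)) * √(2 / Real.pi) = 2 ^ 15 := by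
    rw [mul_assoc, ← Real.sqrt_mul (by positivity)]
    have : Real.pi / 2 * (2 / Real.pi) = 1 := by
      have := Real.pi_ne_zero
      field_simp
    rw [this, Real.sqrt_one, mul_one]
  have hC₄sq : (2 ^ 15 * √(Real.pi / 2)) ^ 2 = 2 ^ 29 * Real.pi := by
    rw [mul_pow, Real.sq_sqrt (by positivity)]
    ring
  -- `2 ^ 15` is twice the stability constant `2 ^ 14`; the factor `√(π/2)` in `C₄` cancels the
  -- `√(2/π)` of the threshold. The rates `1 / 2^26` and `3/8` come from the net and from the noise
  -- estimate.
  refine ⟨2 ^ 15, 2 ^ 15 * √(Real.pi / 2), 1 / 2 ^ 26, 3 / 8, 2 ^ 89 * (1 + 1 / Real.log 2),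
    1 / 2 ^ 26, 3 / 8, by positivity, by positivity, by positivity, by positivity, ?_,
    by positivity, by positivity, ?_⟩
  · have := Real.log_pos (show (1 : ℝ) < 2 by norm_num)
    positivity
  intro θ hθ hθ1
  have hlog2 := Real.log_pos (show (1 : ℝ) < 2 by norm_num)
  have hlogθ : 0 < -Real.log θ := neg_pos.2 (Real.log_neg hθ hθ1)
  set a₂ : ℝ := 2 ^ 89 * (1 + 1 / Real.log 2) with ha₂
  set a₁ : ℝ := 2 ^ 89 * (1 + 1 / -Real.log θ) with ha₁
  have ha₂1 : 1 ≤ a₂ := by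
    have : 0 ≤ 1 / Real.log 2 := by positivity
    linarith
  have ha₁1 : 1 ≤ a₁ := by
    have : 0 ≤ 1 / -Real.log θ := by positivity
    linarith
  -- Since `(1 + ε)² ≤ 4`, the repetition bounds are at most `144 * 2^30` times `σ² / D²`, below `2
  -- ^ 38`.
  refine ⟨a₁, 1, 36 * 2 ^ 38 * (a₁ + 8 + (a₂ + 8)), by linarith, one_pos, by positivity, ?_⟩
  intro d f S₁ S₂ φ ψ L α D₁ D₂ σ ε A hL hα hα1 hD₁ hD₂ hσ hε hε1 hf hS₁ hH ht₂ ht₁ hN₂ hm₂ hn₂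
    hN₁ hm₁ hn₁
  rw [hC₄] at ht₂
  rw [hC₄sq] at hN₂ ⊢
  obtain ⟨hn₂c, hn₂l⟩ := max_le_iff.1 hn₂
  obtain ⟨hn₁c, hn₁l⟩ := max_le_iff.1 hn₁
  have hN₂0 : 0 < A.N₂ := by omega
  have hN₁0 : 0 < A.N₁ := by omega
  have hc₂ := complexity₂_nonneg S₂
  have hc₁ := complexity₁_nonneg hθ hθ1 hS₁
  set x₂ := 72 * (2 ^ 29 * Real.pi) * (1 + ε) ^ 2 * σ ^ 2 / (Real.pi * D₂ ^ 2) with hx₂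
  set x₁ := 18 * (2 ^ 15) ^ 2 * (1 + ε) ^ 2 * σ ^ 2 / D₁ ^ 2 with hx₁
  have hx₂' : x₂ = 36 * 2 ^ 30 * (1 + ε) ^ 2 * (σ ^ 2 / D₂ ^ 2) := by
    have := Real.pi_ne_zero
    rw [hx₂]
    field_simp
    ring
  have hx₁' : x₁ = 18 * 2 ^ 30 * (1 + ε) ^ 2 * (σ ^ 2 / D₁ ^ 2) := by
    rw [hx₁]
    ring
  have hκ₂ : 0 ≤ σ ^ 2 / D₂ ^ 2 := by positivity
  have hκ₁ : 0 ≤ σ ^ 2 / D₁ ^ 2 := by positivity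
  have hε2 : 1 ≤ (1 + ε) ^ 2 := one_le_pow₀ (by linarith)
  have hε4 : (1 + ε) ^ 2 ≤ 4 :=
    (pow_le_pow_left₀ (by linarith) (by linarith : 1 + ε ≤ 2) 2).trans (by norm_num)
  have hT₂ : 0 < (3 * L / D₂) ^ (1 / α) := by positivity
  have hT₁ : 0 < (3 * L / D₁) ^ (1 / α) := by positivity
  have hthr₂ : A.thr₂ ≤ D₂ / 3 := by
    rw [ht₂]
    have h1 := div_sqrt_le_third (c := 2 ^ 16 * (1 + ε) * σ) (x := x₂) hD₂
      (by rw [hx₂']; ring) hN₂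
    refine le_trans (le_of_eq ?_) h1
    ring
  have hthr₁ : A.thr₁ ≤ D₁ / 3 := by
    rw [ht₁]
    exact div_sqrt_le_third (x := x₁) hD₁
      (by rw [hx₁', mul_pow, mul_pow, mul_pow, Real.sq_sqrt (by norm_num)]; ring) hN₁
  refine ⟨?_, numQueries_eq A, ?_, ?_⟩
  -- With no measurements stability gives no information, but then the claimed probability is not
  -- positive and the empty event serves.
  · rcases Nat.eq_zero_or_pos A.n₂ with h0 | hn₂0
    · refine ⟨∅, MeasurableSet.empty, ?_, by simp⟩
      have h0' : (A.n₂ : ℝ) = 0 := by exact_mod_cast h0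
      rw [measureReal_empty, h0']
      simp only [mul_zero, zero_mul, zero_div, neg_zero, Real.exp_zero]
      have := Real.exp_pos (-(1 / 2 ^ 26) * (A.n₁ : ℝ))
      have := Real.exp_pos (-(3 / 8 * ε ^ 2 * (A.n₁ : ℝ) / 2))
      linarith
    rcases Nat.eq_zero_or_pos A.n₁ with h0 | hn₁0
    · refine ⟨∅, MeasurableSet.empty, ?_, by simp⟩
      have h0' : (A.n₁ : ℝ) = 0 := by exact_mod_cast h0
      rw [measureReal_empty, h0']
      simp only [mul_zero, zero_div, neg_zero, Real.exp_zero]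
      have := Real.exp_pos (-(1 / 2 ^ 26) * (A.n₂ : ℝ))
      have := Real.exp_pos (-(3 / 8 * (A.n₂ : ℝ) * ε ^ 2 / 2))
      linarith
    refine ⟨goodEvent A S₁ S₂ σ ε, measurableSet_goodEvent A S₁ S₂ σ ε, ?_, ?_⟩
    · refine le_trans ?_ (le_measureReal_goodEvent A (σ := σ) (ε := ε)
        (measureReal_not_stable₂_le S₂ hn₂c)
        (measureReal_not_stable₁_le hθ hθ1 hS₁ hf.subset_compl hn₁c)
        (measureReal_exists_noise₂_le A hσ hε hε1 hN₂0 hn₂l)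
        (measureReal_exists_noise₁_le A hσ hε hε1 hN₁0 hn₁l))
      have e1 : -(1 / 2 ^ 26) * (A.n₂ : ℝ) = -(A.n₂ / 2 ^ 26) := by ring
      have e2 : -(1 / 2 ^ 26) * (A.n₁ : ℝ) = -(A.n₁ / 2 ^ 26) := by ring
      have e3 : 3 / 8 * (A.n₂ : ℝ) * ε ^ 2 / 2 = 3 / 8 * ε ^ 2 * A.n₂ / 2 := by ring
      rw [e1, e2, e3]
      have := Real.exp_pos (-((A.n₁ : ℝ) / 2 ^ 26))
      have := Real.exp_pos (-(3 / 8 * ε ^ 2 * (A.n₁ : ℝ) / 2))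
      linarith
    · intro ω hω R₂ R₁ hR₂ hR₁
      exact hf.exact_recovery hL hα hD₁ hD₂ hH hN₂0 hN₁0 hn₂0 hn₁0 ht₂ hthr₂ ht₁ hthr₁ hm₂ hm₁ hω
        hR₂ hR₁
  · rw [one_mul]
    refine le_numQueries hL hD₁ hD₂ hc₁ hc₂ (half_le_repetitions (x := x₂) ?_ hN₂)
      (half_le_repetitions (x := x₁) ?_ hN₁) (le_trans ?_ hm₂) hm₁ (le_trans ?_ hn₂c)
      (le_trans ?_ hn₁c)
    · rw [hx₂']
      exact le_mul_of_one_le_left hκ₂ (by linarith)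
    · rw [hx₁']
      exact le_mul_of_one_le_left hκ₁ (by linarith)
    · exact le_mul_of_one_le_left hT₂.le (Real.one_le_sqrt.2 (by norm_num))
    · exact le_mul_of_one_le_left hc₂ ha₂1
    · exact le_mul_of_one_le_left hc₁ ha₁1
  · intro hN₂e hm₂e hn₂e hN₁e hm₁e hn₁e
    have hm₁1 : (1 : ℝ) ≤ A.m₁ := by
      have : (0 : ℝ) < A.m₁ := hT₁.trans_le hm₁
      have : 0 < A.m₁ := by exact_mod_cast this
      exact_mod_cast this
    have hl₁ : 1 ≤ Real.log (2 * (A.m₁ : ℝ) + 1) := one_le_log_of_three_le (by linarith)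
    have hl₂ : A.M ≠ 0 →
        1 ≤ Real.log ((2 * (A.m₂ : ℝ) + 1) ^ 2 * Real.exp 1 * (A.M : ℝ)) := by
      intro hM
      refine one_le_log_mul_exp (one_le_pow₀ ?_) (by exact_mod_cast Nat.one_le_iff_ne_zero.2 hM)
      have : (0 : ℝ) ≤ A.m₂ := Nat.cast_nonneg _
      linarith
    refine numQueries_le hL hD₁ hD₂ (by norm_num) (by linarith) (by linarith) (by positivity)
      (fun hM => ?_) ?_ ?_ hm₂e hm₁e (fun hM => ?_) ?_
    · have := hl₂ hM
      positivity
    · rw [hN₂e]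
      exact repetitions_le (by positivity) (by norm_num) (by
        rw [hx₂']
        exact mul_le_mul_of_nonneg_right (by linarith) hκ₂)
    · rw [hN₁e]
      exact repetitions_le (by positivity) (by norm_num) (by
        rw [hx₁']
        exact mul_le_mul_of_nonneg_right (by linarith) hκ₁)
    · rw [hn₂e]
      exact measurements_le (by linarith) hc₂ hε hε1 (hl₂ hM) rfl
    · rw [hn₁e]
      exact measurements_le (by linarith) hc₁ hε hε1 hl₁ rfl
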